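/- For $r\ge 0$ and $k\ge 0$ let $\pi_r(k)=\frac{r^k}{k!}e^{-r}$, and let $\delta_{jk}$ be the Kronecker delta. For a random graph on $n$ labelled vertices let $N_k=N_k(n)$ denote the number of vertices of degree $k$, $k\ge 0$. Let $\lambda>0$. All limits are as $n\to\infty$. **(i)** There are jointly normal random variables $U_k$, $k\ge 0$, with $\mathbb E U_k=0$ and $$\operatorname{Cov}(U_j,U_k)=\sigma_{jk}:=\pi_\lambda(j)\pi_\lambda(k)\left(\frac{(j-\lambda)(k-\lambda)}{\lambda}-1\right)+\pi_\lambda(k)\delta_{jk},$$ such that the following holds. Let $p=p(n)=\lambda_n/n\in[0,1]$ with $\lambda_n\to\lambda$, and consider the random graph $G(n,p)$, in which each pair of distinct vertices is joined by an edge with probability $p$, independently of all other pairs. Then $$n^{-1/2}\bigl(N_k-\pi_{\lambda_n}(k)\,n\bigr)\xrightarrow{d}U_k,\qquad k\ge 0,$$ jointly for all $k$ (that is, as random elements of $\mathbb R^{\{0,1,2,\dots\}}$ with the product topology). More generally, for any sequence $(a_k)_{k\ge0}$ of real numbers with $a_k=O(A^k)$ for some $A<\infty$, $$n^{-1/2}\Bigl(\sum_k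 a_kN_k-\sum_k a_k\pi_{\lambda_n}(k)\,n\Bigr)\xrightarrow{d}\sum_k a_kU_k,$$ where the series $\sum_k a_k\pi_{\lambda_n}(k)\,n$ converges, the series $\sum_k a_kU_k$ converges almost surely, and its sum is a normal random variable with mean $0$ and variance $\sum_{j,k}a_ja_k\sigma_{jk}$ (an absolutely convergent double series; the variance may be $0$, in which case the limit is the constant $0$). **(ii)** The same results hold for the random graph $G(n,m)$, chosen uniformly among all graphs on $n$ labelled vertices with exactly $m$ edges, where $0\le m=m(n)\le\binom n2$ and $\lambda_n:=2m/n\to\lambda$, except that $U_k$ is replaced by $\tilde U_k$, where the $\tilde U_k$, $k\ge0$, are jointly normal with $\mathbb E\tilde U_k=0$ and $$\operatorname{Cov}(\tilde U_j,\tilde U_k)=\tilde\sigma_{jk}:=\pi_\lambda(j)\pi_\lambda(k)\left(-\frac{(j-\lambda)(k-\lambda)}{\lambda}-1\right)+\pi_\lambda(k)\delta_{jk},$$ and $\sigma_{jk}$ is replaced by $\tilde\sigma_{jk}$ in the variance. -/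

import Mathlib

open MeasureTheory ProbabilityTheory Filter Topology SimpleGraph

/-- The Poisson probability `π_r(k) = r ^ k / k! * e ^ (-r)`. -/
noncomputable def poissonProb (r : ℝ) (k : ℕ) : ℝ :=
  r ^ k / (k.factorial : ℝ) * Real.exp (-r)

/-- The number `N_k` of vertices of degree `k` in the graph `G`. -/
noncomputable def degreeCount {n : ℕ} (G : SimpleGraph (Fin n)) (k : ℕ) : ℕ :=
  {v : Fin n | (G.neighborSet v).ncard = k}.ncard

/-- The set of graphs on the vertices `Fin n` with exactly `m` edges. -/
def graphsWithEdges (n m : ℕ) : Set (SimpleGraph (Fin n)) :=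
  {G | G.edgeSet.ncard = m}

theorem graphsWithEdges_nonempty {n m : ℕ} (h : m ≤ n.choose 2) :
    (graphsWithEdges n m).Nonempty := by
  classical
  have h1 : m ≤ ((⊤ : SimpleGraph (Fin n)).edgeFinset).card := by
    rw [SimpleGraph.card_edgeFinset_top_eq_card_choose_two, Fintype.card_fin]
    exact h
  obtain ⟨s, hs, hc⟩ := Finset.exists_subset_card_eq h1
  refine ⟨SimpleGraph.fromEdgeSet (s : Set (Sym2 (Fin n))), ?_⟩
  have h2 : (SimpleGraph.fromEdgeSet (s : Set (Sym2 (Fin n)))).edgeSet = s := by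
    rw [SimpleGraph.edgeSet_fromEdgeSet]
    ext e
    simp only [Set.mem_sdiff]
    constructor
    · exact fun h => h.1
    · intro he
      refine ⟨he, ?_⟩
      have := SimpleGraph.mem_edgeFinset.1 (hs he)
      exact SimpleGraph.not_isDiag_of_mem_edgeSet _ this
  change (SimpleGraph.fromEdgeSet (s : Set (Sym2 (Fin n)))).edgeSet.ncard = m
  rw [h2, Set.ncard_coe_finset, hc]

theorem measurableSingletonClass_simpleGraph (n : ℕ) :
    MeasurableSingletonClass (SimpleGraph (Fin n)) := by
  constructor
  intro G
  have h : ({G} : Set (SimpleGraph (Fin n))) = SimpleGraph.edgeSet ⁻¹' {G.edgeSet} := by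
    ext H
    simp
  rw [h]
  exact SimpleGraph.measurableEmbedding_edgeSet.measurable (MeasurableSet.singleton _)

/-- The random graph `G(n, p)`: Mathlib's binomial random graph on `Fin n`. -/
noncomputable def gnp (n : ℕ) (p : unitInterval) :
    ProbabilityMeasure (SimpleGraph (Fin n)) :=
  ⟨SimpleGraph.binomialRandom (Fin n) p, inferInstance⟩

/-- The random graph `G(n, m)`: the uniform distribution on the graphs on `Fin n`
with exactly `m` edges. -/
noncomputable def gnm (n m : ℕ) (h : m ≤ n.choose 2) :
    ProbabilityMeasure (SimpleGraph (Fin n)) :=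
  ⟨uniformOn (graphsWithEdges n m),
    haveI := measurableSingletonClass_simpleGraph n
    isProbabilityMeasure_uniformOn (Set.toFinite _) (graphsWithEdges_nonempty h)⟩

/-- The limiting covariances for `G(n, p)`. -/
noncomputable def covGnp (r : ℝ) (j k : ℕ) : ℝ :=
  poissonProb r j * poissonProb r k * (((j : ℝ) - r) * ((k : ℝ) - r) / r - 1)
    + if j = k then poissonProb r k else 0

/-- The limiting covariances for `G(n, m)`. -/
noncomputable def covGnm (r : ℝ) (j k : ℕ) : ℝ :=
  poissonProb r j * poissonProb r k * (-(((j : ℝ) - r) * ((k : ℝ) - r) / r) - 1)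
    + if j = k then poissonProb r k else 0

/-- The random variables `U k`, `k ≥ 0`, are jointly normal, centred, with covariances `σ j k`. -/
structure IsCenteredGaussianSeq {Ω : Type*} [MeasurableSpace Ω] (U : ℕ → Ω → ℝ)
    (P : ProbabilityMeasure Ω) (σ : ℕ → ℕ → ℝ) : Prop where
  gaussian : IsGaussianProcess U (P : Measure Ω)
  mean_eq_zero : ∀ k, ∫ ω, U k ω ∂(P : Measure Ω) = 0
  cov_eq : ∀ j k, covariance (U j) (U k) (P : Measure Ω) = σ j k

/-- For every sequence `a` of at most exponential growth, the series `∑ a_k U_k` converges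
almost surely, the double series `∑ a_j a_k σ_{jk}` converges absolutely, and
`∑ a_k U_k` is normal with mean `0` and variance `∑ a_j a_k σ_{jk}`. -/
def NormalLinearCombinations {Ω : Type*} [MeasurableSpace Ω] (U : ℕ → Ω → ℝ)
    (P : ProbabilityMeasure Ω) (σ : ℕ → ℕ → ℝ) : Prop :=
  ∀ (a : ℕ → ℝ) (A : ℝ), (a =O[atTop] fun k => A ^ k) →
    (∀ᵐ ω ∂(P : Measure Ω), Summable fun k => a k * U k ω) ∧
    ∃ v : NNReal,
      HasSum (fun q : ℕ × ℕ => a q.1 * a q.2 * σ q.1 q.2) (v : ℝ) ∧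
      HasLaw (fun ω => ∑' k, a k * U k ω) (gaussianReal 0 v) (P : Measure Ω)

/-- Joint convergence in distribution, in the product space `ℕ → ℝ`, of the normalized degree
counts `n ^ (-1/2) * (N_k - π_{r_n}(k) n)`, `k ≥ 0`, to `(U_k)`, where the random graph on `n`
vertices has law `μ n`. -/
def JointConvergence (μ : ∀ n : ℕ, ProbabilityMeasure (SimpleGraph (Fin n))) (r : ℕ → ℝ)
    {Ω : Type*} [MeasurableSpace Ω] (U : ℕ → Ω → ℝ) (P : ProbabilityMeasure Ω) : Prop :=
  TendstoInDistribution
    (fun (n : ℕ) (G : SimpleGraph (Fin n)) (k : ℕ) =>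
      (√(n : ℝ))⁻¹ * ((degreeCount G k : ℝ) - poissonProb (r n) k * n))
    atTop (fun ω k => U k ω) (fun n => (μ n : Measure (SimpleGraph (Fin n)))) (P : Measure Ω)

/-- For every sequence `a` of at most exponential growth, the centring series
`∑ a_k π_{r_n}(k) n` converge and `n ^ (-1/2) * (∑ a_k N_k - ∑ a_k π_{r_n}(k) n)` converges in
distribution to `∑ a_k U_k`. (In `∑ a_k N_k` only finitely many terms are nonzero.) -/
def LinearCombinationConvergence (μ : ∀ n : ℕ, ProbabilityMeasure (SimpleGraph (Fin n)))
    (r : ℕ → ℝ) {Ω : Type*} [MeasurableSpace Ω] (U : ℕ → Ω → ℝ)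
    (P : ProbabilityMeasure Ω) : Prop :=
  ∀ (a : ℕ → ℝ) (A : ℝ), (a =O[atTop] fun k => A ^ k) →
    (∀ n : ℕ, Summable fun k => a k * poissonProb (r n) k * (n : ℝ)) ∧
    TendstoInDistribution
      (fun (n : ℕ) (G : SimpleGraph (Fin n)) =>
        (√(n : ℝ))⁻¹ * ((∑' k, a k * (degreeCount G k : ℝ))
          - ∑' k, a k * poissonProb (r n) k * (n : ℝ)))
      atTop (fun ω => ∑' k, a k * U k ω)
      (fun n => (μ n : Measure (SimpleGraph (Fin n)))) (P : Measure Ω)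

/-!
Everything is reduced to characteristic functions of sums `∑ f(deg v)` over the vertices, for an
arbitrary `f` of exponential growth: `∑ a_k N_k` is such a sum, and, by the Cramér-Wold device, the
joint convergence is contained in the convergence of all linear combinations.

*Boxes and balls.* Throw `M` balls independently into `n` boxes, with `M / n → s`. The occupancy
numbers are independent Poisson variables conditioned on their sum, and Fourier inversion turns the
characteristic function of `∑ f(d_v)` into a quotient of two integrals of `n`-th powers of Poisson
averages (`integral_poissonAvg_pow`). By the ordinary central limit expansion and dominated
convergence, the quotient tends to `exp(-v/2)`, where `v` is the residual variance of `f(Z)` after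
linear regression on the Poisson variable `Z` (`tendsto_ballStep`). The domination uses the atoms of
`Z` at `0` and `1` only, which suffices after a multiple of the identity has been subtracted from `f`
so that `f 0 = f 1`: the sum of the occupancy numbers is deterministic.

*The graph `G(n, m)`.* Adding a uniformly random new edge differs from throwing two balls only
through loops and repeated edges, of probability `O(1/n)`. Exchanging the edges for pairs of balls
one at a time, as in Lindeberg's proof of the central limit theorem, costs `O(n^(-1/2))` in total
(`norm_uniformAvg_sub_ballStep_le`), because a single ball in a box of occupancy `d` changes the
exponential by at most `O(n^(-1/2) A^d)`, and the exponential moments of the degrees are bounded.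
Hence the limit for `G(n, m)` is that of the occupancy problem with `2 m` balls
(`tendsto_degreeCharFun`).

*The graph `G(n, p)`.* It is a mixture of the graphs `G(n, j)` with binomial weights. For `j` edges
the centring changes from `n E f(Z_r)` to `n E f(Z_{2j/n})`, which by strict differentiability of the
Poisson mean adds an asymptotically normal term proportional to `Cov(f(Z), Z)`
(`tendsto_binomial_mixture`).

*The limits.* Both limiting sequences are written down explicitly in terms of independent standard
normal variables (`limitSeq`): the coefficients decay fast enough for all series to converge almost
surely, and the variance of a linear combination is the quadratic form of the stated covariances
(`ExpGrowth.hasSum_limitVariance`).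
-/


/-! ### Poisson averages of functions of exponential growth -/

/-- The function `g` grows at most exponentially. The base is normalised to be at least `1`, and
the bound is required at every `k`. -/
def ExpGrowth {E : Type*} [Norm E] (g : ℕ → E) : Prop :=
  ∃ C A : ℝ, 0 ≤ C ∧ 1 ≤ A ∧ ∀ k, ‖g k‖ ≤ C * A ^ k

/-- The expectation of `g(Z)` for a Poisson variable `Z` with mean `r`. -/
noncomputable def poissonAvg {E : Type*} [NormedAddCommGroup E] [NormedSpace ℝ E] (r : ℝ)
    (g : ℕ → E) : E :=
  ∑' k, poissonProb r k • g k

theorem expGrowth_of_isBigO {a : ℕ → ℝ} {A : ℝ} (h : a =O[atTop] fun k => A ^ k) :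
    ExpGrowth a := by
  have h1 : a =O[atTop] fun k => (max |A| 1) ^ k := by
    refine h.trans (Asymptotics.isBigO_of_le _ fun k => ?_)
    rw [norm_pow, norm_pow]
    refine pow_le_pow_left₀ (norm_nonneg _) ?_ _
    exact (le_max_left _ _).trans (le_abs_self _)
  rw [← Nat.cofinite_eq_atTop] at h1
  obtain ⟨C, hC, h2⟩ := Asymptotics.bound_of_isBigO_cofinite h1
  refine ⟨C, max |A| 1, hC.le, le_max_right _ _, fun k => ?_⟩
  have hp : 0 < (max |A| 1) ^ k := pow_pos (lt_of_lt_of_le one_pos (le_max_right _ _)) _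
  have := h2 (x := k) hp.ne'
  rwa [Real.norm_of_nonneg hp.le] at this

section ExpGrowth

variable {E : Type*} [SeminormedAddCommGroup E]

theorem ExpGrowth.of_bdd {g : ℕ → E} {C : ℝ} (h : ∀ k, ‖g k‖ ≤ C) : ExpGrowth g :=
  ⟨C, 1, (norm_nonneg _).trans (h 0), le_rfl, by simpa using h⟩

theorem ExpGrowth.add {g h : ℕ → E} (hg : ExpGrowth g) (hh : ExpGrowth h) :
    ExpGrowth fun k => g k + h k := by
  obtain ⟨C, A, hC, hA, h1⟩ := hg
  obtain ⟨D, B, hD, hB, h2⟩ := hh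
  refine ⟨C + D, max A B, by positivity, hA.trans (le_max_left _ _), fun k => ?_⟩
  calc ‖g k + h k‖ ≤ C * A ^ k + D * B ^ k := (norm_add_le _ _).trans (add_le_add (h1 k) (h2 k))
    _ ≤ C * max A B ^ k + D * max A B ^ k := by
        gcongr
        · exact le_max_left _ _
        · exact le_max_right _ _
    _ = (C + D) * max A B ^ k := by ring

theorem ExpGrowth.mul {g h : ℕ → ℝ} (hg : ExpGrowth g) (hh : ExpGrowth h) :
    ExpGrowth fun k => g k * h k := by
  obtain ⟨C, A, hC, hA, h1⟩ := hg
  obtain ⟨D, B, hD, hB, h2⟩ := hh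
  refine ⟨C * D, A * B, by positivity, one_le_mul_of_one_le_of_one_le hA hB, fun k => ?_⟩
  rw [norm_mul, mul_pow]
  calc ‖g k‖ * ‖h k‖ ≤ (C * A ^ k) * (D * B ^ k) :=
        mul_le_mul (h1 k) (h2 k) (norm_nonneg _) (by positivity)
    _ = _ := by ring

theorem expGrowth_const (c : E) : ExpGrowth fun _ : ℕ => c := .of_bdd fun _ => le_rfl

theorem expGrowth_natCast : ExpGrowth fun k : ℕ => (k : ℝ) := by
  refine ⟨1, 2, by norm_num, by norm_num, fun k => ?_⟩
  rw [Real.norm_natCast, one_mul]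
  exact_mod_cast Nat.lt_two_pow_self.le

theorem ExpGrowth.const_mul {g : ℕ → ℝ} (hg : ExpGrowth g) (c : ℝ) :
    ExpGrowth fun k => c * g k := (expGrowth_const c).mul hg

theorem ExpGrowth.sub {g h : ℕ → E} (hg : ExpGrowth g) (hh : ExpGrowth h) :
    ExpGrowth fun k => g k - h k := by
  have : ExpGrowth fun k => - h k := by
    obtain ⟨D, B, hD, hB, h2⟩ := hh
    exact ⟨D, B, hD, hB, by simpa using h2⟩
  simpa [sub_eq_add_neg] using hg.add this

theorem ExpGrowth.abs {g : ℕ → ℝ} (hg : ExpGrowth g) : ExpGrowth fun k => |g k| := by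
  simpa [ExpGrowth] using hg

end ExpGrowth

theorem poissonProb_nonneg {r : ℝ} (hr : 0 ≤ r) (k : ℕ) : 0 ≤ poissonProb r k := by
  unfold poissonProb; positivity

theorem poissonProb_pos {r : ℝ} (hr : 0 < r) (k : ℕ) : 0 < poissonProb r k := by
  unfold poissonProb; positivity

theorem abs_poissonProb_le (r : ℝ) {R : ℝ} (hr : |r| ≤ R) (k : ℕ) :
    |poissonProb r k| ≤ Real.exp R * (R ^ k / k.factorial) := by
  unfold poissonProb
  rw [abs_mul, abs_div, abs_pow, Nat.abs_cast, Real.abs_exp, mul_comm]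
  have : -r ≤ R := (neg_le_abs r).trans hr
  gcongr

theorem hasSum_poissonProb (r : ℝ) : HasSum (poissonProb r) 1 := by
  have h := (NormedSpace.expSeries_div_hasSum_exp r).mul_right (Real.exp (-r))
  rw [← Real.exp_eq_exp_ℝ, ← Real.exp_add, add_neg_cancel, Real.exp_zero] at h
  exact h

theorem continuous_poissonProb (k : ℕ) : Continuous fun r => poissonProb r k := by
  unfold poissonProb; fun_prop

section PoissonAvg

variable {E : Type*} [NormedAddCommGroup E] [NormedSpace ℝ E] [CompleteSpace E]

theorem summable_exp_bound (C A R : ℝ) :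
    Summable fun k : ℕ => Real.exp R * (R ^ k / k.factorial) * (C * A ^ k) := by
  have h := (Real.summable_pow_div_factorial (R * A)).mul_left (Real.exp R * C)
  refine h.congr fun k => ?_
  rw [mul_pow]; ring

omit [CompleteSpace E] in
theorem norm_poissonProb_smul_le {r R : ℝ} (hr : |r| ≤ R) {C A : ℝ} {x : E} {k : ℕ}
    (h : ‖x‖ ≤ C * A ^ k) :
    ‖poissonProb r k • x‖ ≤ Real.exp R * (R ^ k / k.factorial) * (C * A ^ k) := by
  rw [norm_smul]
  have hR : 0 ≤ R := (abs_nonneg _).trans hr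
  exact mul_le_mul (abs_poissonProb_le r hr k) h (norm_nonneg _) (by positivity)

omit [CompleteSpace E] in
theorem ExpGrowth.summable_norm {g : ℕ → E} (hg : ExpGrowth g) (r : ℝ) :
    Summable fun k => ‖poissonProb r k • g k‖ := by
  obtain ⟨C, A, hC, hA, h⟩ := hg
  exact (summable_exp_bound C A |r|).of_nonneg_of_le (fun _ => norm_nonneg _)
    fun k => norm_poissonProb_smul_le le_rfl (h k)

theorem ExpGrowth.summable {g : ℕ → E} (hg : ExpGrowth g) (r : ℝ) :
    Summable fun k => poissonProb r k • g k := (hg.summable_norm r).of_norm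

theorem ExpGrowth.hasSum {g : ℕ → E} (hg : ExpGrowth g) (r : ℝ) :
    HasSum (fun k => poissonProb r k • g k) (poissonAvg r g) := (hg.summable r).hasSum

theorem ExpGrowth.hasSum' {g : ℕ → ℝ} (hg : ExpGrowth g) (r : ℝ) :
    HasSum (fun k => poissonProb r k * g k) (poissonAvg r g) := hg.hasSum r

/-- Dominated convergence for Poisson averages, with the mean and the integrand both varying. -/
theorem tendsto_poissonAvg {ι : Type*} {l : Filter ι} {r : ι → ℝ} {s : ℝ}
    (hr : Tendsto r l (𝓝 s)) {g : ι → ℕ → E} {g' : ℕ → E} {C A : ℝ}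
    (hg : ∀ k, Tendsto (fun i => g i k) l (𝓝 (g' k)))
    (hb : ∀ᶠ i in l, ∀ k, ‖g i k‖ ≤ C * A ^ k) :
    Tendsto (fun i => poissonAvg (r i) (g i)) l (𝓝 (poissonAvg s g')) := by
  refine tendsto_tsum_of_dominated_convergence (summable_exp_bound C A (|s| + 1))
    (fun k => ((continuous_poissonProb k).tendsto s |>.comp hr).smul (hg k)) ?_
  have h1 : ∀ᶠ i in l, |r i| < |s| + 1 :=
    hr.abs.eventually (gt_mem_nhds (lt_add_one |s|))
  filter_upwards [h1, hb] with i hi hb k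
  exact norm_poissonProb_smul_le hi.le (hb k)

theorem ExpGrowth.tendsto_poissonAvg {ι : Type*} {l : Filter ι} {r : ι → ℝ} {s : ℝ}
    (hr : Tendsto r l (𝓝 s)) {g : ℕ → E} (hg : ExpGrowth g) :
    Tendsto (fun i => poissonAvg (r i) g) l (𝓝 (poissonAvg s g)) := by
  obtain ⟨C, A, hC, hA, h⟩ := hg
  exact _root_.tendsto_poissonAvg hr (fun k => tendsto_const_nhds) (.of_forall fun _ => h)

theorem poissonAvg_add {r : ℝ} {g h : ℕ → E} (hg : ExpGrowth g) (hh : ExpGrowth h) :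
    poissonAvg r (fun k => g k + h k) = poissonAvg r g + poissonAvg r h := by
  unfold poissonAvg
  simp_rw [smul_add]
  exact (hg.summable r).tsum_add (hh.summable r)

theorem poissonAvg_sub {r : ℝ} {g h : ℕ → E} (hg : ExpGrowth g) (hh : ExpGrowth h) :
    poissonAvg r (fun k => g k - h k) = poissonAvg r g - poissonAvg r h := by
  unfold poissonAvg
  simp_rw [smul_sub]
  exact (hg.summable r).tsum_sub (hh.summable r)

end PoissonAvg

theorem poissonAvg_const_mul (r c : ℝ) (g : ℕ → ℝ) :
    poissonAvg r (fun k => c * g k) = c * poissonAvg r g := by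
  unfold poissonAvg
  rw [← tsum_mul_left]
  exact tsum_congr fun k => by simp only [smul_eq_mul]; ring

theorem poissonAvg_const {E : Type*} [NormedAddCommGroup E] [NormedSpace ℝ E] [CompleteSpace E]
    (r : ℝ) (c : E) : poissonAvg r (fun _ => c) = c := by
  have := (hasSum_poissonProb r).smul_const c
  rw [one_smul] at this
  exact this.tsum_eq

theorem poissonAvg_ofReal (r : ℝ) (g : ℕ → ℝ) :
    poissonAvg r (fun k => (g k : ℂ)) = ((poissonAvg r g : ℝ) : ℂ) := by
  unfold poissonAvg
  rw [Complex.ofReal_tsum]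
  exact tsum_congr fun k => by simp

theorem poissonProb_succ_mul (r : ℝ) (k : ℕ) :
    poissonProb r (k + 1) * ((k + 1 : ℕ) : ℝ) = r * poissonProb r k := by
  unfold poissonProb
  rw [Nat.factorial_succ]
  push_cast
  have : (k.factorial : ℝ) ≠ 0 := by positivity
  have : (k : ℝ) + 1 ≠ 0 := by positivity
  field_simp
  ring

/-- The Stein–Chen identity `E[Z g(Z)] = r E[g(Z + 1)]`. -/
theorem poissonAvg_natCast_mul {r : ℝ} {g : ℕ → ℝ} (hg : ExpGrowth g) :
    poissonAvg r (fun k => k * g k) = r * poissonAvg r (fun k => g (k + 1)) := by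
  have h := (expGrowth_natCast.mul hg).summable r
  unfold poissonAvg
  rw [h.tsum_eq_zero_add, ← tsum_mul_left]
  simp only [CharP.cast_eq_zero, zero_mul, smul_zero, zero_add]
  refine tsum_congr fun k => ?_
  simp only [smul_eq_mul]
  rw [← mul_assoc, poissonProb_succ_mul, mul_assoc]

theorem poissonAvg_natCast (r : ℝ) : poissonAvg r (fun k => (k : ℝ)) = r := by
  have := poissonAvg_natCast_mul (r := r) (expGrowth_const (1 : ℝ))
  simpa [poissonAvg_const] using this

theorem poissonAvg_natCast_mul_natCast (r : ℝ) :
    poissonAvg r (fun k => (k : ℝ) * k) = r * (r + 1) := by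
  rw [poissonAvg_natCast_mul expGrowth_natCast]
  push_cast
  rw [poissonAvg_add expGrowth_natCast (expGrowth_const 1), poissonAvg_natCast, poissonAvg_const]

theorem poissonAvg_centered_sq (r : ℝ) :
    poissonAvg r (fun k => ((k : ℝ) - r) * (k - r)) = r := by
  have h : (fun k : ℕ => ((k : ℝ) - r) * (k - r)) =
      fun k : ℕ => (k : ℝ) * k + ((-2 * r) * (k : ℝ) + r * r) := by
    ext k; ring
  rw [h, poissonAvg_add (expGrowth_natCast.mul expGrowth_natCast)
    ((expGrowth_natCast.const_mul _).add (expGrowth_const _)),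
    poissonAvg_add (expGrowth_natCast.const_mul _) (expGrowth_const _),
    poissonAvg_const_mul, poissonAvg_const, poissonAvg_natCast, poissonAvg_natCast_mul_natCast]
  ring

theorem hasDerivAt_poissonProb {r : ℝ} (hr : r ≠ 0) (k : ℕ) :
    HasDerivAt (fun r => poissonProb r k) (poissonProb r k * (r⁻¹ * ((k : ℝ) - r))) r := by
  unfold poissonProb
  have h := (((hasDerivAt_id r).pow k).div_const (k.factorial : ℝ)).mul
    ((hasDerivAt_id r).neg.exp)
  refine h.congr_deriv ?_
  simp only [id, Pi.pow_apply, Pi.neg_apply]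
  rcases k with _ | k
  · simp; field_simp
  · simp only [Nat.add_sub_cancel]
    rw [pow_succ]
    field_simp
    ring

/-- The covariance of `f(Z)` and `Z` for `Z` Poisson with mean `r`. -/
noncomputable def poissonCovId (r : ℝ) (f : ℕ → ℝ) : ℝ :=
  poissonAvg r fun k => ((k : ℝ) - r) * f k

/-- The derivative of `r ↦ E f(Z_r)` is `Cov(f(Z_r), Z_r) / r`, and it is a strict derivative. -/
theorem hasStrictDerivAt_poissonAvg {r : ℝ} (hr : 0 < r) {f : ℕ → ℝ} (hf : ExpGrowth f) :
    HasStrictDerivAt (fun x => poissonAvg x f) (r⁻¹ * poissonCovId r f) r := by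
  have hderiv : ∀ y ∈ Set.Ioo (r / 2) (2 * r), HasDerivAt (fun x => poissonAvg x f)
      (y⁻¹ * poissonCovId y f) y := by
    intro y hy
    have hgrowth : ExpGrowth fun k : ℕ => (r / 2)⁻¹ * ((k : ℝ) + 2 * r) * f k :=
      ((expGrowth_natCast.add (expGrowth_const _)).const_mul _).mul hf
    obtain ⟨C, A, hC, hA, h⟩ := hgrowth
    have := hasDerivAt_tsum_of_isPreconnected (t := Set.Ioo (r / 2) (2 * r)) (y₀ := y) (y := y)
      (g := fun k x => poissonProb x k • f k)
      (g' := fun k x => poissonProb x k * (x⁻¹ * ((k : ℝ) - x)) * f k)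
      (summable_exp_bound C A (2 * r)) isOpen_Ioo isPreconnected_Ioo
      (fun k x hx => (hasDerivAt_poissonProb (by linarith [hx.1]) k).mul_const _) ?_ hy
      (hf.summable y) hy
    · refine this.congr_deriv ?_
      unfold poissonCovId poissonAvg
      rw [← tsum_mul_left]
      exact tsum_congr fun k => by simp only [smul_eq_mul]; ring
    · intro k x hx
      have hx0 : 0 < x := by linarith [hx.1]
      rw [mul_assoc, ← smul_eq_mul]
      refine norm_poissonProb_smul_le (by rw [abs_of_pos hx0]; exact hx.2.le) ((le_trans ?_ (h k)))
      have hk : (0 : ℝ) ≤ k := Nat.cast_nonneg k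
      have h1 : ‖(k : ℝ) - x‖ ≤ ‖(k : ℝ) + 2 * r‖ := by
        rw [Real.norm_of_nonneg (by positivity : 0 ≤ (k : ℝ) + 2 * r), Real.norm_eq_abs, abs_le]
        constructor <;> linarith [hx.2]
      have h2 : ‖x⁻¹‖ ≤ ‖(r / 2)⁻¹‖ := by
        rw [Real.norm_of_nonneg (by positivity), Real.norm_of_nonneg (by positivity)]
        exact inv_anti₀ (by positivity) hx.1.le
      rw [norm_mul, norm_mul, norm_mul, norm_mul]
      gcongr
  refine hasStrictDerivAt_of_hasDerivAt_of_continuousAt (f' := fun y => y⁻¹ * poissonCovId y f)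
    ?_ ?_
  · filter_upwards [Ioo_mem_nhds (by linarith : r / 2 < r) (by linarith : r < 2 * r)] with y hy
    exact hderiv y hy
  · refine (continuousAt_inv₀ hr.ne').mul ?_
    obtain ⟨C, A, hC, hA, h⟩ := ((expGrowth_natCast.add (expGrowth_const (2 * r))).mul hf)
    refine tendsto_poissonAvg (C := C) (A := A) tendsto_id (fun k => ?_) ?_
    · exact Continuous.tendsto (by fun_prop) r
    · filter_upwards [Ioo_mem_nhds (by linarith : 0 < r) (by linarith : r < 2 * r)] with y hy k
      refine le_trans ?_ (h k)
      have hk : (0 : ℝ) ≤ k := Nat.cast_nonneg k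
      have h1 : ‖(k : ℝ) - y‖ ≤ ‖(k : ℝ) + 2 * r‖ := by
        rw [Real.norm_of_nonneg (by positivity : 0 ≤ (k : ℝ) + 2 * r), Real.norm_eq_abs, abs_le]
        constructor <;> linarith [hy.2, hy.1]
      rw [norm_mul, norm_mul]
      gcongr

/-! ### Throwing balls into boxes: generating functions and Fourier inversion -/

section BallStep

variable {V : Type*} [Fintype V] [DecidableEq V]

/-- One step of the occupancy Markov chain, acting on functions of the occupancy vector `d`:
a ball is thrown into a uniformly random box. -/
noncomputable def ballStep (h : (V → ℕ) → ℂ) (d : V → ℕ) : ℂ :=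
  (∑ u, h (d + Pi.single u 1)) / Fintype.card V

omit [Fintype V] in
theorem derivation_prod {R A : Type*} [CommSemiring R] [CommRing A] [Algebra R A]
    (D : Derivation R A A) (f : V → A) (s : Finset V) :
    D (∏ v ∈ s, f v) = ∑ u ∈ s, ∏ v ∈ s, if v = u then D (f v) else f v := by
  induction s using Finset.induction_on with
  | empty => simp
  | insert a s ha ih =>
    rw [Finset.prod_insert ha, D.leibniz, ih, Finset.sum_insert ha, Finset.prod_insert ha,
      if_pos rfl]
    have h1 : ∏ v ∈ s, (if v = a then D (f v) else f v) = ∏ v ∈ s, f v :=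
      Finset.prod_congr rfl fun v hv => if_neg fun h : v = a => ha (h ▸ hv)
    have h2 : ∀ u ∈ s, ∏ v ∈ insert a s, (if v = u then D (f v) else f v)
        = f a * ∏ v ∈ s, (if v = u then D (f v) else f v) := fun u hu => by
      rw [Finset.prod_insert ha, if_neg fun h => ha (by rw [h]; exact hu)]
    rw [h1, Finset.sum_congr rfl h2, ← Finset.mul_sum, smul_eq_mul, smul_eq_mul]
    ring

/-- The exponential generating function of the shifted sequence `k ↦ φ (j + k)`, with the variable
rescaled by `μ`. -/
noncomputable def shiftedEGF (φ : ℕ → ℂ) (μ : ℂ) (j : ℕ) : PowerSeries ℂ :=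
  PowerSeries.mk fun k => μ ^ k * φ (j + k) / k.factorial

theorem derivative_shiftedEGF (φ : ℕ → ℂ) (μ : ℂ) (j : ℕ) :
    PowerSeries.derivative ℂ (shiftedEGF φ μ j) = PowerSeries.C μ * shiftedEGF φ μ (j + 1) := by
  ext k
  rw [PowerSeries.coeff_derivative, PowerSeries.coeff_C_mul, shiftedEGF, shiftedEGF,
    PowerSeries.coeff_mk, PowerSeries.coeff_mk, Nat.factorial_succ]
  have h : (k.factorial : ℂ) ≠ 0 := by exact_mod_cast k.factorial_ne_zero
  have h' : (k : ℂ) + 1 ≠ 0 := by exact_mod_cast k.succ_ne_zero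
  rw [show j + 1 + k = j + (k + 1) by ring]
  push_cast
  field_simp
  ring

/-- Differentiating a product of exponential generating functions is one ball throw. -/
theorem coeff_prod_shiftedEGF (φ : ℕ → ℂ) (μ : ℂ) (M : ℕ) (d : V → ℕ) :
    M.factorial * PowerSeries.coeff M (∏ v, shiftedEGF φ μ (d v))
      = (μ * Fintype.card V) ^ M * ballStep^[M] (fun d => ∏ v, φ (d v)) d := by
  induction M generalizing d with
  | zero =>
    simp [shiftedEGF, PowerSeries.coeff_zero_eq_constantCoeff, map_prod]
  | succ M ih =>
    have hD : PowerSeries.derivative ℂ (∏ v, shiftedEGF φ μ (d v))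
        = PowerSeries.C μ * ∑ u, ∏ v, shiftedEGF φ μ ((d + Pi.single u 1 : V → ℕ) v) := by
      rw [derivation_prod, Finset.mul_sum]
      refine Finset.sum_congr rfl fun u _ => ?_
      rw [← Finset.mul_prod_erase _ _ (Finset.mem_univ u), ← Finset.mul_prod_erase
        (a := u) Finset.univ _ (Finset.mem_univ u), if_pos rfl, derivative_shiftedEGF, mul_assoc]
      simp only [Pi.add_apply, Pi.single_eq_same]
      congr 2
      refine Finset.prod_congr rfl fun v hv => ?_
      have hv' := Finset.ne_of_mem_erase hv
      rw [if_neg hv', Pi.single_eq_of_ne hv', add_zero]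
    have hc := congrArg (PowerSeries.coeff M) hD
    rw [PowerSeries.coeff_derivative, PowerSeries.coeff_C_mul, map_sum] at hc
    rw [Function.iterate_succ_apply', ballStep]
    rcases isEmpty_or_nonempty V with hV | hV
    · simp
    · have hn : (Fintype.card V : ℂ) ≠ 0 := by exact_mod_cast Fintype.card_ne_zero
      rw [Nat.factorial_succ]
      calc (((M + 1) * M.factorial : ℕ) : ℂ) * PowerSeries.coeff (M + 1) (∏ v, shiftedEGF φ μ (d v))
          = M.factorial * (PowerSeries.coeff (M + 1) (∏ v, shiftedEGF φ μ (d v)) * (M + 1)) := by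
            push_cast; ring
        _ = μ * ∑ u, M.factorial *
              PowerSeries.coeff M (∏ v, shiftedEGF φ μ ((d + Pi.single u 1 : V → ℕ) v)) := by
            rw [hc, Finset.mul_sum, Finset.mul_sum, Finset.mul_sum]
            exact Finset.sum_congr rfl fun u _ => by ring
        _ = _ := by
            simp_rw [ih, ← Finset.mul_sum]
            field_simp
            ring

end BallStep

section Fourier

open Complex

theorem integral_exp_int_mul (m : ℤ) (hm : m ≠ 0) :
    ∫ s in (-Real.pi)..Real.pi, exp (m * I * s) = 0 := by
  have hc : (m : ℂ) * I ≠ 0 := mul_ne_zero (by exact_mod_cast hm) I_ne_zero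
  rw [integral_exp_mul_complex hc]
  have : exp (m * I * (Real.pi : ℝ)) = exp (m * I * ((-Real.pi : ℝ) : ℂ)) := by
    rw [exp_eq_exp_iff_exists_int]
    refine ⟨m, ?_⟩
    push_cast
    ring
  rw [this, sub_self, zero_div]

/-- Fourier inversion for an absolutely convergent power series on the unit circle. -/
theorem integral_tsum_mul_exp {c : ℕ → ℂ} (hc : Summable fun k => ‖c k‖) (M : ℕ) :
    ∫ s in (-Real.pi)..Real.pi, (∑' k, c k * exp (I * s) ^ k) * exp (-(I * (M * s)))
      = 2 * Real.pi * c M := by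
  have hnorm : ∀ (x : ℝ), ‖exp (I * x)‖ = 1 := fun x => by
    rw [mul_comm, norm_exp_ofReal_mul_I]
  have hnorm' : ∀ (x : ℝ), ‖exp (-(I * (M * x)))‖ = 1 := fun x => by
    have : -(I * ((M : ℂ) * x)) = ((-(M * x) : ℝ) : ℂ) * I := by push_cast; ring
    rw [this, norm_exp_ofReal_mul_I]
  have h := intervalIntegral.hasSum_integral_of_dominated_convergence (μ := volume)
    (a := -Real.pi) (b := Real.pi)
    (F := fun k (s : ℝ) => c k * exp (I * s) ^ k * exp (-(I * (M * s))))
    (f := fun s : ℝ => (∑' k, c k * exp (I * s) ^ k) * exp (-(I * (M * s))))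
    (fun k _ => ‖c k‖) (fun k => by
      refine Continuous.aestronglyMeasurable ?_
      fun_prop)
    (fun k => .of_forall fun s _ => by
      rw [norm_mul, norm_mul, norm_pow, hnorm, hnorm', one_pow, mul_one, mul_one])
    (.of_forall fun s _ => hc) (by simp)
    (.of_forall fun s _ => by
      refine HasSum.mul_right _ (Summable.hasSum (Summable.of_norm ?_))
      simpa [hnorm] using hc)
  have h1 : ∀ k, ∫ s in (-Real.pi)..Real.pi, c k * exp (I * s) ^ k * exp (-(I * (M * s)))
      = if k = M then 2 * Real.pi * c M else 0 := fun k => by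
    have h2 : ∀ s : ℝ, c k * exp (I * s) ^ k * exp (-(I * (M * s)))
        = c k * exp ((((k : ℤ) - M : ℤ) : ℂ) * I * s) := fun s => by
      rw [← exp_nat_mul, mul_assoc, ← exp_add]
      congr 2
      push_cast
      ring
    simp_rw [h2]
    rw [intervalIntegral.integral_const_mul]
    split_ifs with hk
    · subst hk
      simp
      ring
    · rw [integral_exp_int_mul _ (by omega), mul_zero]
  simp_rw [h1] at h
  exact h.unique (hasSum_ite_eq M _)

/-- An absolutely convergent power series may be raised to a power termwise on the unit circle. -/
theorem tsum_coeff_pow {p : PowerSeries ℂ} (hp : Summable fun k => ‖PowerSeries.coeff k p‖)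
    (n : ℕ) : (Summable fun k => ‖PowerSeries.coeff k (p ^ n)‖) ∧ ∀ z : ℂ, ‖z‖ = 1 →
      ∑' k, PowerSeries.coeff k (p ^ n) * z ^ k = (∑' k, PowerSeries.coeff k p * z ^ k) ^ n := by
  have key : ∀ q r : PowerSeries ℂ, (Summable fun k => ‖PowerSeries.coeff k q‖) →
      (Summable fun k => ‖PowerSeries.coeff k r‖) →
      (Summable fun k => ‖PowerSeries.coeff k (q * r)‖) ∧ ∀ z : ℂ, ‖z‖ = 1 →
      ∑' k, PowerSeries.coeff k (q * r) * z ^ k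
        = (∑' k, PowerSeries.coeff k q * z ^ k) * ∑' k, PowerSeries.coeff k r * z ^ k := by
    intro q r hq hr
    refine ⟨?_, fun z hz => ?_⟩
    · have := summable_norm_sum_mul_antidiagonal_of_summable_norm hq hr
      refine this.congr fun k => ?_
      rw [PowerSeries.coeff_mul]
    · have hz' : ∀ p : PowerSeries ℂ, (Summable fun k => ‖PowerSeries.coeff k p‖) →
          Summable fun k => ‖PowerSeries.coeff k p * z ^ k‖ := fun p hp =>
        hp.congr fun k => by rw [norm_mul, norm_pow, hz, one_pow, mul_one]
      rw [tsum_mul_tsum_eq_tsum_sum_antidiagonal_of_summable_norm (hz' q hq) (hz' r hr)]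
      refine tsum_congr fun k => ?_
      rw [PowerSeries.coeff_mul, Finset.sum_mul]
      refine Finset.sum_congr rfl fun x hx => ?_
      rw [← Finset.HasAntidiagonal.mem_antidiagonal.1 hx, pow_add]
      ring
  induction n with
  | zero =>
    constructor
    · refine summable_of_ne_finset_zero (s := {0}) fun k hk => ?_
      rw [pow_zero, PowerSeries.coeff_one, if_neg (by simpa using hk), norm_zero]
    · intro z _
      rw [pow_zero, pow_zero, tsum_eq_single 0]
      · simp
      · intro k hk
        rw [PowerSeries.coeff_one, if_neg hk, zero_mul]
  | succ n ih =>
    obtain ⟨h1, h2⟩ := key _ _ ih.1 hp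
    refine ⟨by simpa [pow_succ] using h1, fun z hz => ?_⟩
    rw [pow_succ, h2 z hz, ih.2 z hz, pow_succ]

/-- Poissonization inverted by Fourier analysis: the expectation of `∏ φ(d_v)` after `M` balls have
been thrown into `n` boxes, as an integral of the `n`-th power of a Poisson average. The Poisson
mean `μ` is free. -/
theorem integral_poissonAvg_pow {φ : ℕ → ℂ} (hφ : ∀ k, ‖φ k‖ ≤ 1) (μ : ℝ) (n M : ℕ) :
    ∫ s in (-Real.pi)..Real.pi,
      (poissonAvg μ fun k => φ k * exp (I * s) ^ k) ^ n * exp (-(I * (M * s)))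
      = 2 * Real.pi * (Real.exp (-μ) ^ n * (μ * n) ^ M / M.factorial *
        ballStep^[M] (fun d : Fin n → ℕ => ∏ v, φ (d v)) 0) := by
  have hp : Summable fun k => ‖PowerSeries.coeff k (shiftedEGF φ μ 0)‖ := by
    have h1 := (ExpGrowth.of_bdd hφ).summable_norm μ |>.mul_left (Real.exp μ)
    refine h1.congr fun k => ?_
    rw [shiftedEGF, PowerSeries.coeff_mk, norm_smul, poissonProb, norm_mul, norm_div, norm_div,
      norm_mul, zero_add, norm_pow, norm_pow, Complex.norm_real,
      Real.norm_of_nonneg (Real.exp_nonneg _)]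
    have := Real.exp_ne_zero μ
    rw [Real.exp_neg]
    simp
    field_simp
  have h2 : ∀ s : ℝ, poissonAvg μ (fun k => φ k * exp (I * s) ^ k)
      = Real.exp (-μ) * ∑' k, PowerSeries.coeff k (shiftedEGF φ μ 0) * exp (I * s) ^ k := fun s => by
    rw [← tsum_mul_left]
    refine tsum_congr fun k => ?_
    rw [shiftedEGF, PowerSeries.coeff_mk, poissonProb, Complex.real_smul, zero_add]
    push_cast
    ring
  obtain ⟨h3, h4⟩ := tsum_coeff_pow hp n
  have h5 : ∀ s : ℝ, (poissonAvg μ fun k => φ k * exp (I * s) ^ k) ^ n * exp (-(I * (M * s)))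
      = Real.exp (-μ) ^ n * ((∑' k, PowerSeries.coeff k (shiftedEGF φ μ 0 ^ n) * exp (I * s) ^ k)
        * exp (-(I * (M * s)))) := fun s => by
    rw [h2, mul_pow, h4 _ (by rw [mul_comm, norm_exp_ofReal_mul_I]), mul_assoc]
  simp_rw [h5]
  rw [intervalIntegral.integral_const_mul, integral_tsum_mul_exp h3]
  have h6 := coeff_prod_shiftedEGF (V := Fin n) φ μ M 0
  simp only [Pi.zero_apply, Finset.prod_const, Finset.card_univ, Fintype.card_fin] at h6
  have h7 : (M.factorial : ℂ) ≠ 0 := by exact_mod_cast M.factorial_ne_zero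
  rw [(eq_div_iff h7).2 ((mul_comm _ _).trans h6)]
  push_cast
  ring

end Fourier

/-! ### Poisson characteristic functions -/

section CharFun

open Complex

theorem norm_exp_I_mul_sub_one_sub_le (x : ℝ) : ‖exp (I * x) - 1 - I * x‖ ≤ 3 * x ^ 2 := by
  have hn : ‖I * (x : ℂ)‖ = |x| := by simp
  rcases le_or_gt |x| 1 with h | h
  · have := norm_exp_sub_one_sub_id_le (x := I * x) (by rwa [hn])
    rw [hn, sq_abs] at this
    nlinarith [sq_nonneg x]
  · have h1 : ‖exp (I * x) - 1‖ ≤ ‖x‖ := Real.norm_exp_I_mul_ofReal_sub_one_le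
    calc ‖exp (I * x) - 1 - I * x‖ ≤ |x| + |x| := by
          refine (norm_sub_le _ _).trans (add_le_add h1 hn.le)
      _ ≤ 3 * x ^ 2 := by rw [← sq_abs x]; nlinarith

theorem norm_exp_I_mul_sub_quadratic_le (x : ℝ) (hx : |x| ≤ 1) :
    ‖exp (I * x) - 1 - I * x + x ^ 2 / 2‖ ≤ |x| ^ 3 := by
  have hn : ‖I * (x : ℂ)‖ = |x| := by simp
  have := exp_bound (x := I * x) (by rwa [hn]) (n := 3) (by norm_num)
  rw [hn] at this
  have h2 : exp (I * x) - 1 - I * x + x ^ 2 / 2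
      = exp (I * x) - ∑ m ∈ Finset.range 3, (I * x) ^ m / m.factorial := by
    simp only [Finset.sum_range_succ, Finset.sum_range_zero, mul_pow, I_sq]
    norm_num
    ring
  rw [h2]
  refine this.trans (mul_le_of_le_one_right (by positivity) ?_)
  norm_num [Nat.factorial]

/-- The second-order expansion behind the central limit theorem, for a convergent sequence. -/
theorem tendsto_mul_exp_sub_one_sub {y : ℕ → ℝ} {y' : ℝ} (hy : Tendsto y atTop (𝓝 y')) :
    Tendsto (fun n : ℕ => (n : ℂ) * (exp (I * ((√(n : ℝ))⁻¹ * y n : ℝ)) - 1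
      - I * ((√(n : ℝ))⁻¹ * y n : ℝ))) atTop (𝓝 (-(y' ^ 2 : ℝ) / 2)) := by
  have hs : Tendsto (fun n : ℕ => (√(n : ℝ))⁻¹) atTop (𝓝 0) :=
    tendsto_inv_atTop_zero.comp (Real.tendsto_sqrt_atTop.comp tendsto_natCast_atTop_atTop)
  have hx : Tendsto (fun n : ℕ => (√(n : ℝ))⁻¹ * y n) atTop (𝓝 0) := by
    simpa using hs.mul hy
  have h1 : Tendsto (fun n : ℕ => (n : ℂ) * (exp (I * ((√(n : ℝ))⁻¹ * y n : ℝ)) - 1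
      - I * ((√(n : ℝ))⁻¹ * y n : ℝ) + ((√(n : ℝ))⁻¹ * y n : ℝ) ^ 2 / 2)) atTop (𝓝 0) := by
    have hb : Tendsto (fun n : ℕ => (√(n : ℝ))⁻¹ * |y n| ^ 3) atTop (𝓝 0) := by
      simpa using hs.mul (hy.abs.pow 3)
    refine squeeze_zero_norm' ?_ hb
    filter_upwards [hx.abs.eventually (gt_mem_nhds (by simp : |(0 : ℝ)| < 1)),
      eventually_gt_atTop 0] with n hn hn0
    rw [norm_mul, Complex.norm_natCast]
    have hn1 : (0 : ℝ) < n := by exact_mod_cast hn0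
    calc (n : ℝ) * _ ≤ n * |(√(n : ℝ))⁻¹ * y n| ^ 3 := by
          gcongr; exact norm_exp_I_mul_sub_quadratic_le _ hn.le
      _ = (√(n : ℝ))⁻¹ * |y n| ^ 3 := by
          rw [abs_mul, abs_of_nonneg (by positivity : 0 ≤ (√(n : ℝ))⁻¹), mul_pow]
          have h3 : √(n : ℝ) ^ 2 = n := Real.sq_sqrt hn1.le
          have h4 : √(n : ℝ) ≠ 0 := (Real.sqrt_pos.2 hn1).ne'
          nth_rewrite 1 [← h3]
          field_simp
  have h2 : Tendsto (fun n : ℕ => -((y n ^ 2 : ℝ) : ℂ) / 2) atTop (𝓝 (-(y' ^ 2 : ℝ) / 2)) :=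
    (((continuous_ofReal.tendsto _).comp (hy.pow 2)).neg).div_const 2
  refine ((h1.add h2).congr' ?_).trans (by simp)
  filter_upwards [eventually_gt_atTop 0] with n hn0
  have hn1 : (0 : ℝ) < n := by exact_mod_cast hn0
  have h3 : (n : ℂ) * (((√(n : ℝ))⁻¹ * y n : ℝ) : ℂ) ^ 2 = ((y n ^ 2 : ℝ) : ℂ) := by
    have : (n : ℝ) * ((√(n : ℝ))⁻¹ * y n) ^ 2 = y n ^ 2 := by
      rw [mul_pow, inv_pow, Real.sq_sqrt hn1.le]
      field_simp
    exact_mod_cast this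
  rw [← h3]
  ring

/-- A central limit theorem for triangular arrays of functions of Poisson variables whose mean
varies. -/
theorem tendsto_poissonAvg_exp_pow {r : ℕ → ℝ} {s : ℝ} (hr : Tendsto r atTop (𝓝 s))
    {y : ℕ → ℕ → ℝ} {y' : ℕ → ℝ} {C A : ℝ}
    (hy : ∀ k, Tendsto (fun n => y n k) atTop (𝓝 (y' k))) (hA : 1 ≤ A)
    (hb : ∀ᶠ n in atTop, ∀ k, |y n k| ≤ C * A ^ k)
    (h0 : ∀ᶠ n in atTop, poissonAvg (r n) (y n) = 0) :
    Tendsto (fun n : ℕ => (poissonAvg (r n) fun k => exp (I * ((√(n : ℝ))⁻¹ * y n k : ℝ))) ^ n)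
      atTop (𝓝 (exp (-(poissonAvg s fun k => y' k ^ 2 : ℝ) / 2))) := by
  have hmain : Tendsto (fun n : ℕ => poissonAvg (r n) fun k =>
      (n : ℂ) * (exp (I * ((√(n : ℝ))⁻¹ * y n k : ℝ)) - 1 - I * ((√(n : ℝ))⁻¹ * y n k : ℝ)))
      atTop (𝓝 (poissonAvg s fun k => -(y' k ^ 2 : ℝ) / 2)) := by
    refine tendsto_poissonAvg (C := 3 * C ^ 2) (A := A ^ 2) hr
      (fun k => tendsto_mul_exp_sub_one_sub (hy k)) ?_
    filter_upwards [hb, eventually_gt_atTop 0] with n hn hn0 k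
    have hn1 : (0 : ℝ) < n := by exact_mod_cast hn0
    rw [norm_mul, Complex.norm_natCast]
    calc (n : ℝ) * _ ≤ n * (3 * ((√(n : ℝ))⁻¹ * y n k) ^ 2) := by
          gcongr; exact norm_exp_I_mul_sub_one_sub_le _
      _ = 3 * |y n k| ^ 2 := by
          rw [mul_pow, inv_pow, Real.sq_sqrt hn1.le, sq_abs]; field_simp
      _ ≤ 3 * (C * A ^ k) ^ 2 := by gcongr; exact hn k
      _ = _ := by rw [← pow_mul, mul_pow, ← pow_mul, mul_comm 2 k]; ring
  have hlim : (poissonAvg s fun k => -((y' k ^ 2 : ℝ) : ℂ) / 2)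
      = -(poissonAvg s fun k => y' k ^ 2 : ℝ) / 2 := by
    rw [← poissonAvg_ofReal]
    unfold poissonAvg
    rw [← tsum_neg, ← tsum_div_const]
    refine tsum_congr fun k => ?_
    simp only [Complex.real_smul]
    ring
  rw [hlim] at hmain
  -- The linear term has mean `0`, so it may be subtracted inside the average.
  have hexp := tendsto_one_add_pow_exp_of_tendsto
    (g := fun n => (poissonAvg (r n) fun k => exp (I * ((√(n : ℝ))⁻¹ * y n k : ℝ))) - 1)
    (hmain.congr' ?_)
  · simpa using hexp
  filter_upwards [h0, hb] with n hn hbn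
  have hg1 : ExpGrowth fun k => exp (I * ((√(n : ℝ))⁻¹ * y n k : ℝ)) :=
    .of_bdd (C := 1) fun k => (Complex.norm_exp_I_mul_ofReal _).le
  have hC : 0 ≤ C := by simpa using (abs_nonneg _).trans (hbn 0)
  have hg2 : ExpGrowth fun k => (√(n : ℝ))⁻¹ * y n k :=
    ExpGrowth.const_mul ⟨C, A, hC, hA, hbn⟩ _
  have hg3 : ExpGrowth fun k => I * ((√(n : ℝ))⁻¹ * y n k : ℝ) := by
    obtain ⟨D, B, hD, hB, h⟩ := hg2
    exact ⟨D, B, hD, hB, fun k => by simpa using h k⟩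
  have e1 : poissonAvg (r n) (fun k => I * ((√(n : ℝ))⁻¹ * y n k : ℝ)) = 0 := by
    have : (poissonAvg (r n) fun k => (((√(n : ℝ))⁻¹ * y n k : ℝ) : ℂ)) = 0 := by
      rw [poissonAvg_ofReal, poissonAvg_const_mul, hn, mul_zero, ofReal_zero]
    unfold poissonAvg at this ⊢
    rw [← mul_zero I, ← this, ← tsum_mul_left]
    exact tsum_congr fun k => by simp only [Complex.real_smul]; ring
  have e2 : (poissonAvg (r n) fun k => (n : ℂ) * (exp (I * ((√(n : ℝ))⁻¹ * y n k : ℝ)) - 1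
      - I * ((√(n : ℝ))⁻¹ * y n k : ℝ))) = n * (poissonAvg (r n) fun k =>
        (exp (I * ((√(n : ℝ))⁻¹ * y n k : ℝ)) - 1 - I * ((√(n : ℝ))⁻¹ * y n k : ℝ))) := by
    unfold poissonAvg
    rw [← tsum_mul_left]
    exact tsum_congr fun k => by simp only [Complex.real_smul]; ring
  rw [e2, poissonAvg_sub (hg1.sub (expGrowth_const 1)) hg3, poissonAvg_sub hg1 (expGrowth_const 1),
    e1, poissonAvg_const, sub_zero]

/-- The modulus of a combination of two unit vectors at angle `s`, with weights `a` and `b`. -/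
theorem norm_add_mul_exp_le {a b s : ℝ} (ha : 0 ≤ a) (hb : 0 ≤ b) (hab : a + b ≤ 1) :
    ‖(a : ℂ) + b * exp (I * s)‖ ≤ a + b - a * b * (1 - Real.cos s) := by
  have h1 := Real.cos_le_one s
  have h2 := Real.neg_one_le_cos s
  have h3 : 0 ≤ a * b := mul_nonneg ha hb
  have h4 : a * b ≤ (a + b) / 2 := by nlinarith [sq_nonneg (a - b)]
  have h5 : ‖(a : ℂ) + b * exp (I * s)‖ ^ 2 = (a + b) ^ 2 - 2 * (a * b) * (1 - Real.cos s) := by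
    rw [← normSq_eq_norm_sq, mul_comm I, exp_mul_I, normSq_apply]
    simp only [add_re, ofReal_re, cos_ofReal_re, add_im, ofReal_im, mul_re, sin_ofReal_re, I_re,
      sin_ofReal_im, I_im, mul_im, cos_ofReal_im]
    linear_combination b ^ 2 * Real.sin_sq_add_cos_sq s
  refine abs_le_of_sq_le_sq' ?_ (by nlinarith) |>.2
  rw [h5]
  have h6 : 0 ≤ a * b * (1 - Real.cos s) := mul_nonneg h3 (by linarith)
  nlinarith [mul_nonneg h6 (by linarith : 0 ≤ 1 - (a + b)), sq_nonneg (a * b * (1 - Real.cos s))]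

/-- A Gaussian bound on a Poisson average of unimodular numbers, from the phase difference between
the values at `0` and at `1`. -/
theorem norm_poissonAvg_le {r : ℝ} (hr : 0 ≤ r) {g : ℕ → ℂ} (hg : ∀ k, ‖g k‖ ≤ 1) {s : ℝ}
    (hs : |s| ≤ Real.pi) (h01 : g 1 = g 0 * exp (I * s)) :
    ‖poissonAvg r g‖ ≤ Real.exp (-(poissonProb r 0 * poissonProb r 1 * (2 / Real.pi ^ 2) * s ^ 2)) := by
  have hp := poissonProb_nonneg hr
  have h1 := (ExpGrowth.of_bdd hg).summable_norm r
  have h2 : ‖∑' k, poissonProb r (k + 2) • g (k + 2)‖ ≤ 1 - (poissonProb r 0 + poissonProb r 1) := by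
    have h3 : Summable fun k => poissonProb r (k + 2) :=
      (summable_nat_add_iff 2).2 (hasSum_poissonProb r).summable
    have h4 := (hasSum_poissonProb r).summable.sum_add_tsum_nat_add 2
    rw [(hasSum_poissonProb r).tsum_eq, Finset.sum_range_succ, Finset.sum_range_one] at h4
    refine (tsum_of_norm_bounded h3.hasSum fun k => ?_).trans (by linarith)
    rw [norm_smul, Real.norm_of_nonneg (hp _)]
    exact mul_le_of_le_one_right (hp _) (hg _)
  have hab : poissonProb r 0 + poissonProb r 1 ≤ 1 := by
    linarith [norm_nonneg (∑' k, poissonProb r (k + 2) • g (k + 2))]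
  have h5 : poissonAvg r g = g 0 * (poissonProb r 0 + poissonProb r 1 * exp (I * s))
      + ∑' k, poissonProb r (k + 2) • g (k + 2) := by
    rw [poissonAvg, ← h1.of_norm.sum_add_tsum_nat_add 2, Finset.sum_range_succ,
      Finset.sum_range_one, h01]
    simp only [Complex.real_smul]
    ring
  have hcos : Real.cos s ≤ 1 - 2 / Real.pi ^ 2 * s ^ 2 := Real.cos_le_one_sub_mul_cos_sq hs
  have hpp := mul_nonneg (hp 0) (hp 1)
  calc ‖poissonAvg r g‖ ≤ (poissonProb r 0 + poissonProb r 1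
        - poissonProb r 0 * poissonProb r 1 * (1 - Real.cos s))
        + (1 - (poissonProb r 0 + poissonProb r 1)) := by
        rw [h5]
        refine (norm_add_le _ _).trans (add_le_add ?_ h2)
        rw [norm_mul]
        exact (mul_le_of_le_one_left (norm_nonneg _) (hg 0)).trans
          (norm_add_mul_exp_le (hp 0) (hp 1) hab)
    _ ≤ 1 + -(poissonProb r 0 * poissonProb r 1 * (2 / Real.pi ^ 2) * s ^ 2) := by
        nlinarith [mul_le_mul_of_nonneg_left hcos hpp]
    _ ≤ _ := by rw [add_comm]; exact Real.add_one_le_exp _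

end CharFun

/-! ### The central limit theorem for occupancy counts -/

section BallStepLemmas

variable {V : Type*} [Fintype V] [DecidableEq V]

theorem ballStep_iterate_const [Nonempty V] (M : ℕ) (c : ℂ) :
    ballStep^[M] (fun _ : V → ℕ => c) = fun _ => c := by
  induction M with
  | zero => rfl
  | succ M ih =>
    rw [Function.iterate_succ_apply', ih]
    ext d
    have : (Fintype.card V : ℂ) ≠ 0 := by exact_mod_cast Fintype.card_ne_zero
    simp only [ballStep, Finset.sum_const, Finset.card_univ, nsmul_eq_mul]
    field_simp

theorem ballStep_iterate_const_mul (M : ℕ) (c : ℂ) (h : (V → ℕ) → ℂ) (d : V → ℕ) :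
    ballStep^[M] (fun d => c * h d) d = c * ballStep^[M] h d := by
  induction M generalizing d with
  | zero => rfl
  | succ M ih =>
    rw [Function.iterate_succ_apply', Function.iterate_succ_apply', ballStep, ballStep]
    simp_rw [ih]
    rw [← Finset.mul_sum, mul_div_assoc]

/-- The total number of balls is deterministic, so a factor that depends on it only can be taken
out. -/
theorem ballStep_iterate_pow_sum_mul (M : ℕ) (c : ℂ) (h : (V → ℕ) → ℂ) (d : V → ℕ) :
    ballStep^[M] (fun d => c ^ (∑ v, d v) * h d) d
      = c ^ ((∑ v, d v) + M) * ballStep^[M] h d := by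
  induction M generalizing d with
  | zero => rfl
  | succ M ih =>
    rw [Function.iterate_succ_apply', Function.iterate_succ_apply', ballStep, ballStep]
    simp_rw [ih]
    have : ∀ u, ∑ v, (d + Pi.single u 1 : V → ℕ) v = (∑ v, d v) + 1 := fun u => by
      simp only [Pi.add_apply, Finset.sum_add_distrib, Finset.sum_pi_single', Finset.mem_univ,
        if_true]
    simp_rw [this]
    rw [← Finset.mul_sum, mul_div_assoc]
    congr 2
    ring

end BallStepLemmas

/-- The variance of `f(Z)` minus the part explained by linear regression on `Z`, for `Z` Poisson with
mean `r`. -/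
noncomputable def residualVariance (r : ℝ) (f : ℕ → ℝ) : ℝ :=
  poissonAvg r (fun k => f k ^ 2) - poissonAvg r f ^ 2 - poissonCovId r f ^ 2 / r

theorem poissonCovId_sub_const_mul {r : ℝ} {f : ℕ → ℝ} (hf : ExpGrowth f) (D : ℝ) :
    poissonCovId r (fun k => f k - D * k) = poissonCovId r f - D * r := by
  have hid := expGrowth_natCast.sub (expGrowth_const r)
  have h1 : (fun k : ℕ => ((k : ℝ) - r) * (f k - D * k))
      = fun k : ℕ => ((k : ℝ) - r) * f k
        - (D * (((k : ℝ) - r) * (k - r)) + D * r * ((k : ℝ) - r)) := by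
    ext k; ring
  unfold poissonCovId
  rw [h1, poissonAvg_sub (hid.mul hf) (((hid.mul hid).const_mul _).add (hid.const_mul _)),
    poissonAvg_add ((hid.mul hid).const_mul _) (hid.const_mul _), poissonAvg_const_mul,
    poissonAvg_const_mul, poissonAvg_centered_sq, poissonAvg_sub expGrowth_natCast (expGrowth_const r),
    poissonAvg_natCast, poissonAvg_const]
  ring

theorem poissonAvg_natCast_mul_eq {r : ℝ} {f : ℕ → ℝ} (hf : ExpGrowth f) :
    poissonAvg r (fun k => (k : ℝ) * f k) = poissonCovId r f + r * poissonAvg r f := by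
  unfold poissonCovId
  rw [← poissonAvg_const_mul, ← poissonAvg_add
    ((expGrowth_natCast.sub (expGrowth_const r)).mul hf) (hf.const_mul r)]
  congr 1
  ext k
  ring

theorem residualVariance_sub_const_mul {r : ℝ} (hr : r ≠ 0) {f : ℕ → ℝ} (hf : ExpGrowth f)
    (D : ℝ) : residualVariance r (fun k => f k - D * k) = residualVariance r f := by
  have h1 : (fun k : ℕ => (f k - D * k) ^ 2)
      = fun k : ℕ => f k * f k - (2 * D * ((k : ℝ) * f k) - D ^ 2 * ((k : ℝ) * k)) := by
    ext k; ring
  have h2 : (fun k : ℕ => f k ^ 2) = fun k => f k * f k := by ext k; ring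
  have hid := expGrowth_natCast
  unfold residualVariance
  rw [poissonCovId_sub_const_mul hf, h1, h2, poissonAvg_sub (hf.mul hf)
    (((hid.mul hf).const_mul _).sub ((hid.mul hid).const_mul _)),
    poissonAvg_sub ((hid.mul hf).const_mul _) ((hid.mul hid).const_mul _), poissonAvg_const_mul,
    poissonAvg_const_mul, poissonAvg_natCast_mul_natCast, poissonAvg_sub hf (hid.const_mul _),
    poissonAvg_const_mul, poissonAvg_natCast, poissonAvg_natCast_mul_eq hf]
  field_simp
  ring

theorem residualVariance_const_mul (r c : ℝ) (f : ℕ → ℝ) :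
    residualVariance r (fun k => c * f k) = c ^ 2 * residualVariance r f := by
  have h : (fun k : ℕ => ((k : ℝ) - r) * (c * f k)) = fun k : ℕ => c * (((k : ℝ) - r) * f k) := by
    ext k; ring
  unfold residualVariance poissonCovId
  simp_rw [mul_pow]
  rw [poissonAvg_const_mul, poissonAvg_const_mul, h, poissonAvg_const_mul]
  ring

/-- The second moment of a linear combination of `Z` and `f(Z)`, with the square completed. -/
theorem poissonAvg_sq_completed {r : ℝ} (hr : r ≠ 0) {f : ℕ → ℝ} (hf : ExpGrowth f) (u : ℝ) :
    poissonAvg r (fun k => (u * ((k : ℝ) - r) + (f k - poissonAvg r f)) ^ 2)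
      = r * (u + poissonCovId r f / r) ^ 2 + residualVariance r f := by
  set m := poissonAvg r f with hm
  have hid := expGrowth_natCast.sub (expGrowth_const r)
  have h1 : (fun k : ℕ => (u * ((k : ℝ) - r) + (f k - m)) ^ 2)
      = fun k : ℕ => (u ^ 2 * (((k : ℝ) - r) * (k - r)) + 2 * u * (((k : ℝ) - r) * f k))
        + (f k * f k + ((-2 * m) * f k + ((- 2 * u * m) * ((k : ℝ) - r) + m ^ 2))) := by
    ext k; ring
  have h2 : (fun k : ℕ => f k ^ 2) = fun k => f k * f k := by ext k; ring
  have g1 := (hid.mul hid).const_mul (u ^ 2)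
  have g2 := (hid.mul hf).const_mul (2 * u)
  have g3 := hf.const_mul (-2 * m)
  have g4 := hid.const_mul (-2 * u * m)
  have g5 := expGrowth_const (m ^ 2)
  rw [h1, poissonAvg_add (g1.add g2) ((hf.mul hf).add (g3.add (g4.add g5))), poissonAvg_add g1 g2,
    poissonAvg_add (hf.mul hf) (g3.add (g4.add g5)), poissonAvg_add g3 (g4.add g5),
    poissonAvg_add g4 g5, poissonAvg_const_mul, poissonAvg_const_mul, poissonAvg_const_mul,
    poissonAvg_const_mul, poissonAvg_centered_sq, poissonAvg_sub expGrowth_natCast (expGrowth_const r),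
    poissonAvg_natCast, poissonAvg_const, poissonAvg_const, residualVariance, h2, ← hm]
  unfold poissonCovId
  field_simp
  ring

section OccupancyCLT

open Complex

/-- The characteristic exponent at `u` of `Z` and at `1` of `f(Z)`, both centred, on the scale
`n ^ (-1/2)`, for `Z` Poisson with mean `r`. -/
noncomputable def scaledPoissonCharFun (n : ℕ) (r : ℝ) (f : ℕ → ℝ) (u : ℝ) : ℂ :=
  poissonAvg r fun k => exp (I * ((√(n : ℝ))⁻¹ * (u * ((k : ℝ) - r) + (f k - poissonAvg r f)) : ℝ))

theorem continuous_scaledPoissonCharFun (n : ℕ) (r : ℝ) (f : ℕ → ℝ) :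
    Continuous (scaledPoissonCharFun n r f) := by
  refine continuous_iff_continuousAt.2 fun u => ?_
  refine tendsto_poissonAvg (C := 1) (A := 1) tendsto_const_nhds (fun k => ?_)
    (.of_forall fun u k => ?_)
  · exact Continuous.tendsto (by fun_prop) u
  · rw [Complex.norm_exp_I_mul_ofReal, one_pow, one_mul]

theorem tendsto_scaledPoissonCharFun_pow {r : ℕ → ℝ} {s : ℝ} (hs : s ≠ 0)
    (hr : Tendsto r atTop (𝓝 s)) {f : ℕ → ℝ} (hf : ExpGrowth f) (u : ℝ) :
    Tendsto (fun n => scaledPoissonCharFun n (r n) f u ^ n) atTop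
      (𝓝 (exp (-(s * (u + poissonCovId s f / s) ^ 2 + residualVariance s f : ℝ) / 2))) := by
  rw [← poissonAvg_sq_completed hs hf]
  have hm := hf.tendsto_poissonAvg hr
  obtain ⟨C, A, hC, hA, hb⟩ := ((expGrowth_natCast.add (expGrowth_const (|s| + 1))).const_mul |u|).add
    (hf.abs.add (expGrowth_const (|poissonAvg s f| + 1)))
  refine tendsto_poissonAvg_exp_pow (C := C) (A := A) hr (fun k => ?_) hA ?_ ?_
  · exact (tendsto_const_nhds.mul (tendsto_const_nhds.sub hr)).add (tendsto_const_nhds.sub hm)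
  · filter_upwards [hr.abs.eventually (gt_mem_nhds (lt_add_one |s|)),
      hm.abs.eventually (gt_mem_nhds (lt_add_one |poissonAvg s f|))] with n h1 h2 k
    refine le_trans ?_ (hb k)
    have hk : (0 : ℝ) ≤ k := Nat.cast_nonneg k
    rw [Real.norm_of_nonneg (by positivity)]
    refine (abs_add_le _ _).trans (add_le_add ?_ ?_)
    · rw [abs_mul]
      gcongr
      refine (abs_sub _ _).trans ?_
      rw [abs_of_nonneg hk]
      linarith
    · exact (abs_sub _ _).trans (by linarith)
  · refine .of_forall fun n => ?_
    rw [poissonAvg_add ((expGrowth_natCast.sub (expGrowth_const _)).const_mul _)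
      (hf.sub (expGrowth_const _)), poissonAvg_const_mul, poissonAvg_sub expGrowth_natCast
      (expGrowth_const _), poissonAvg_sub hf (expGrowth_const _), poissonAvg_natCast,
      poissonAvg_const, poissonAvg_const]
    ring

/-- The local limit integral: dominated convergence, with the domination coming from the atoms at
`0` and `1`. -/
theorem tendsto_integral_scaledPoissonCharFun {r : ℕ → ℝ} {s : ℝ} (hs : 0 < s)
    (hr : Tendsto r atTop (𝓝 s)) {f : ℕ → ℝ} (hf : ExpGrowth f) (h01 : f 1 = f 0) :
    Tendsto (fun n : ℕ => ∫ u in (√(n : ℝ) * -Real.pi)..(√(n : ℝ) * Real.pi),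
        scaledPoissonCharFun n (r n) f u ^ n) atTop
      (𝓝 (exp (-(residualVariance s f : ℝ) / 2) * ∫ u : ℝ, exp (-(s * u ^ 2 : ℝ) / 2))) := by
  -- The regression on `Z` only translates the Gaussian integrand.
  have hlim : exp (-(residualVariance s f : ℝ) / 2) * ∫ u : ℝ, exp (-(s * u ^ 2 : ℝ) / 2)
      = ∫ u : ℝ, exp (-(s * (u + poissonCovId s f / s) ^ 2 + residualVariance s f : ℝ) / 2) := by
    rw [← integral_add_right_eq_self _ (poissonCovId s f / s), ← integral_const_mul]
    refine integral_congr_ae (.of_forall fun u => ?_)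
    simp only
    rw [← Complex.exp_add]
    congr 1
    push_cast
    ring
  have hset : ∀ n : ℕ, √(n : ℝ) * -Real.pi ≤ √(n : ℝ) * Real.pi := fun n => by
    have := mul_nonneg (Real.sqrt_nonneg (n : ℝ)) Real.pi_pos.le
    linarith
  set c := poissonProb s 0 * poissonProb s 1 / 2 * (2 / Real.pi ^ 2) with hc
  have hpos : 0 < poissonProb s 0 * poissonProb s 1 :=
    mul_pos (poissonProb_pos hs 0) (poissonProb_pos hs 1)
  have hcpos : 0 < c := by positivity
  rw [hlim]
  have hI : ∀ n : ℕ, ∫ u in (√(n : ℝ) * -Real.pi)..(√(n : ℝ) * Real.pi),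
        scaledPoissonCharFun n (r n) f u ^ n
      = ∫ u, (Set.Ioc (√(n : ℝ) * -Real.pi) (√(n : ℝ) * Real.pi)).indicator
          (fun u => scaledPoissonCharFun n (r n) f u ^ n) u := fun n => by
    rw [integral_indicator measurableSet_Ioc, intervalIntegral.integral_of_le (hset n)]
  simp_rw [hI]
  refine tendsto_integral_filter_of_dominated_convergence (fun u => Real.exp (-c * u ^ 2))
    ?_ ?_ (integrable_exp_neg_mul_sq hcpos) ?_
  · refine .of_forall fun n => AEStronglyMeasurable.indicator ?_ measurableSet_Ioc
    exact ((continuous_scaledPoissonCharFun n (r n) f).pow n).aestronglyMeasurable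
  · have h1 : Tendsto (fun n => poissonProb (r n) 0 * poissonProb (r n) 1) atTop
        (𝓝 (poissonProb s 0 * poissonProb s 1)) :=
      (((continuous_poissonProb 0).tendsto s).comp hr).mul
        (((continuous_poissonProb 1).tendsto s).comp hr)
    filter_upwards [h1.eventually (lt_mem_nhds (half_lt_self hpos)),
      hr.eventually (lt_mem_nhds hs), eventually_gt_atTop 0] with n hn hrn hn0
    refine .of_forall fun u => ?_
    rw [Set.indicator_apply]
    split_ifs with hu
    · have hn1 : (0 : ℝ) < n := by exact_mod_cast hn0
      have hsq : 0 < √(n : ℝ) := Real.sqrt_pos.2 hn1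
      have hs1 : |(√(n : ℝ))⁻¹ * u| ≤ Real.pi := by
        have h2 : |u| ≤ √(n : ℝ) * Real.pi := by
          rw [abs_le]; constructor <;> linarith [hu.1, hu.2]
        rw [abs_mul, abs_of_pos (inv_pos.2 hsq)]
        rwa [inv_mul_le_iff₀ hsq]
      have h3 := norm_poissonAvg_le hrn.le (g := fun k => exp (I * ((√(n : ℝ))⁻¹ *
          (u * ((k : ℝ) - r n) + (f k - poissonAvg (r n) f)) : ℝ)))
          (fun k => (Complex.norm_exp_I_mul_ofReal _).le) hs1 (by
            rw [← Complex.exp_add, h01]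
            congr 1
            push_cast
            ring)
      rw [norm_pow]
      refine (pow_le_pow_left₀ (norm_nonneg _) h3 n).trans ?_
      rw [← Real.exp_nat_mul]
      refine Real.exp_le_exp.2 ?_
      have h4 : (n : ℝ) * -(poissonProb (r n) 0 * poissonProb (r n) 1 * (2 / Real.pi ^ 2) *
          ((√(n : ℝ))⁻¹ * u) ^ 2)
          = -(poissonProb (r n) 0 * poissonProb (r n) 1 * (2 / Real.pi ^ 2) * u ^ 2) := by
        rw [mul_pow, inv_pow, Real.sq_sqrt hn1.le]
        field_simp
      rw [h4, hc, neg_mul, neg_le_neg_iff]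
      gcongr
    · rw [norm_zero]; positivity
  · refine .of_forall fun u => ?_
    refine (tendsto_scaledPoissonCharFun_pow hs.ne' hr hf u).congr' ?_
    have h5 : Tendsto (fun n : ℕ => √(n : ℝ) * Real.pi) atTop atTop :=
      (Real.tendsto_sqrt_atTop.comp tendsto_natCast_atTop_atTop).atTop_mul_const Real.pi_pos
    filter_upwards [h5.eventually_gt_atTop |u|] with n hn
    rw [Set.indicator_of_mem]
    have := abs_lt.1 hn
    exact ⟨by linarith [this.1], this.2.le⟩

theorem integral_exp_neg_mul_sq_ne_zero {s : ℝ} (hs : 0 < s) :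
    ∫ u : ℝ, exp (-(s * u ^ 2 : ℝ) / 2) ≠ 0 := by
  have h1 : ∀ u : ℝ, exp (-(s * u ^ 2 : ℝ) / 2) = (Real.exp (-(s / 2) * u ^ 2) : ℂ) := fun u => by
    push_cast
    congr 1
    ring
  simp_rw [h1]
  rw [integral_complex_ofReal, integral_gaussian]
  exact_mod_cast (Real.sqrt_pos.2 (by positivity)).ne'

/-- Fourier inversion for the occupancy numbers, after the substitution `u = √n s`. -/
theorem integral_scaledPoissonCharFun_eq {n M : ℕ} (hn : 0 < n) (f : ℕ → ℝ) :
    ∫ u in (√(n : ℝ) * -Real.pi)..(√(n : ℝ) * Real.pi), scaledPoissonCharFun n (M / n) f u ^ n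
      = √(n : ℝ) * (2 * Real.pi * (Real.exp (-(M / n : ℝ)) ^ n * (M : ℂ) ^ M / M.factorial)) *
        ballStep^[M] (fun d : Fin n → ℕ => exp (I * ((√(n : ℝ))⁻¹ *
          (∑ v, f (d v) - n * poissonAvg (M / n) f) : ℝ))) 0 := by
  have hn1 : (0 : ℝ) < n := by exact_mod_cast hn
  have hsq : √(n : ℝ) ≠ 0 := (Real.sqrt_pos.2 hn1).ne'
  set r : ℝ := M / n with hr
  set φ : ℕ → ℂ := fun k => exp (I * ((√(n : ℝ))⁻¹ * (f k - poissonAvg r f) : ℝ)) with hφ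
  have hnr : (n : ℝ) * r = M := by rw [hr]; field_simp
  have h1 := integral_poissonAvg_pow (φ := φ) (fun k => (Complex.norm_exp_I_mul_ofReal _).le) r n M
  rw [← intervalIntegral.smul_integral_comp_mul_left]
  have h2 : ∀ s : ℝ, scaledPoissonCharFun n r f (√(n : ℝ) * s) ^ n
      = (poissonAvg r fun k => φ k * exp (I * s) ^ k) ^ n * exp (-(I * (M * s))) := fun s => by
    have h3 : scaledPoissonCharFun n r f (√(n : ℝ) * s)
        = exp (-(I * (r * s))) * poissonAvg r fun k => φ k * exp (I * s) ^ k := by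
      have h4 : ∀ (c : ℂ) (g : ℕ → ℂ), c * poissonAvg r g = ∑' k, c * poissonProb r k • g k :=
        fun c g => tsum_mul_left.symm
      rw [scaledPoissonCharFun, h4]
      refine tsum_congr fun k => ?_
      simp only [hφ, Complex.real_smul]
      rw [← Complex.exp_nat_mul, ← Complex.exp_add, mul_left_comm, ← Complex.exp_add]
      congr 2
      have : (√(n : ℝ))⁻¹ * (√(n : ℝ) * s * (k - r) + (f k - poissonAvg r f))
          = s * (k - r) + (√(n : ℝ))⁻¹ * (f k - poissonAvg r f) := by field_simp
      rw [this]
      push_cast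
      ring
    rw [h3, mul_pow, ← Complex.exp_nat_mul, mul_comm]
    congr 2
    rw [← Complex.ofReal_natCast M, ← hnr]
    push_cast
    ring
  simp_rw [h2]
  rw [h1, Complex.real_smul]
  have h4 : (fun d : Fin n → ℕ => ∏ v, φ (d v)) = fun d : Fin n → ℕ =>
      exp (I * ((√(n : ℝ))⁻¹ * (∑ v, f (d v) - n * poissonAvg r f) : ℝ)) := by
    ext d
    rw [hφ, ← Complex.exp_sum, ← Finset.mul_sum, ← Complex.ofReal_sum, ← Finset.mul_sum,
      Finset.sum_sub_distrib]
    simp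
  have h5 : (r : ℂ) * n = M := by
    rw [mul_comm]; exact_mod_cast hnr
  rw [h4, h5]
  push_cast
  ring

/-- The occupancy central limit theorem when `f 1 = f 0`, so that the values at `0` and `1` of the
integrand in the Fourier integral have the phase difference required by `norm_poissonAvg_le`. The
normalising constants cancel in the quotient by the same integral for `f = 0`. -/
theorem tendsto_ballStep_of_eq {M : ℕ → ℕ} {s : ℝ} (hs : 0 < s)
    (hM : Tendsto (fun n => (M n : ℝ) / n) atTop (𝓝 s)) {f : ℕ → ℝ} (hf : ExpGrowth f)
    (h01 : f 1 = f 0) :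
    Tendsto (fun n => ballStep^[M n] (fun d : Fin n → ℕ => exp (I * ((√(n : ℝ))⁻¹ *
      (∑ v, f (d v) - n * poissonAvg (M n / n) f) : ℝ))) 0) atTop
      (𝓝 (exp (-(residualVariance s f : ℝ) / 2))) := by
  have h1 := tendsto_integral_scaledPoissonCharFun hs hM hf h01
  have h2 := tendsto_integral_scaledPoissonCharFun hs hM (expGrowth_const (0 : ℝ)) rfl
  have h0 : residualVariance s (fun _ => 0) = 0 := by
    simp [residualVariance, poissonCovId, poissonAvg]
  have hG := integral_exp_neg_mul_sq_ne_zero hs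
  rw [h0] at h2
  have h3 := h1.div h2 (by simpa using hG)
  have h4 : exp (-(residualVariance s f : ℝ) / 2) * (∫ u : ℝ, exp (-(s * u ^ 2 : ℝ) / 2))
      / (exp (-((0 : ℝ) : ℂ) / 2) * ∫ u : ℝ, exp (-(s * u ^ 2 : ℝ) / 2))
      = exp (-(residualVariance s f : ℝ) / 2) := by
    simp only [ofReal_zero, neg_zero, zero_div, exp_zero, one_mul]
    exact mul_div_cancel_right₀ _ hG
  rw [h4] at h3
  refine h3.congr' ?_
  filter_upwards [eventually_gt_atTop 0, hM.eventually (lt_mem_nhds hs)] with n hn hMn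
  have : Nonempty (Fin n) := ⟨⟨0, hn⟩⟩
  have hn1 : (0 : ℝ) < n := by exact_mod_cast hn
  have hM0 : (M n : ℂ) ≠ 0 := by
    intro h
    have : (M n : ℝ) = 0 := by exact_mod_cast h
    simp [this] at hMn
  have hsq : (√(n : ℝ) : ℂ) ≠ 0 := by exact_mod_cast (Real.sqrt_pos.2 hn1).ne'
  have hpi : (Real.pi : ℂ) ≠ 0 := by exact_mod_cast Real.pi_ne_zero
  have hfac : ((M n).factorial : ℂ) ≠ 0 := by exact_mod_cast (M n).factorial_ne_zero
  have hexp : (Real.exp (-(M n / n : ℝ)) : ℂ) ≠ 0 := by exact_mod_cast (Real.exp_pos _).ne'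
  have hone : ballStep^[M n] (fun d : Fin n → ℕ => exp (I * ((√(n : ℝ))⁻¹ *
      (∑ v, (fun _ => (0 : ℝ)) (d v) - n * poissonAvg (M n / n) (fun _ => (0 : ℝ))) : ℝ))) 0
      = 1 := by
    rw [poissonAvg_const]
    simp [ballStep_iterate_const]
  rw [Pi.div_apply, integral_scaledPoissonCharFun_eq hn, integral_scaledPoissonCharFun_eq hn,
    hone, mul_one]
  refine mul_div_cancel_left₀ _ (mul_ne_zero hsq (mul_ne_zero (mul_ne_zero two_ne_zero hpi) ?_))
  exact div_ne_zero (mul_ne_zero (pow_ne_zero _ hexp) (pow_ne_zero _ hM0)) hfac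

/-- **Central limit theorem for occupancy counts**: throw `M n` balls into `n` boxes, where
`M n / n` tends to `s`. Then `∑ f(d_v)`, centred by the Poisson mean and scaled by `n ^ (-1/2)`, has
asymptotically the characteristic function of a centred normal variable. -/
theorem tendsto_ballStep {M : ℕ → ℕ} {s : ℝ} (hs : 0 < s)
    (hM : Tendsto (fun n => (M n : ℝ) / n) atTop (𝓝 s)) {f : ℕ → ℝ} (hf : ExpGrowth f) :
    Tendsto (fun n => ballStep^[M n] (fun d : Fin n → ℕ => exp (I * ((√(n : ℝ))⁻¹ *
      (∑ v, f (d v) - n * poissonAvg (M n / n) f) : ℝ))) 0) atTop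
      (𝓝 (exp (-(residualVariance s f : ℝ) / 2))) := by
  -- Subtracting a multiple of the identity changes the sum by a constant, since the number of balls
  -- is fixed.
  set D := f 1 - f 0 with hD
  have h := tendsto_ballStep_of_eq hs hM (hf.sub (expGrowth_natCast.const_mul D))
    (by simp [hD])
  rw [residualVariance_sub_const_mul hs.ne' hf] at h
  refine h.congr' ?_
  filter_upwards [eventually_gt_atTop 0] with n hn
  have hn1 : (n : ℝ) ≠ 0 := by exact_mod_cast hn.ne'
  have hfun : (fun d : Fin n → ℕ => exp (I * ((√(n : ℝ))⁻¹ *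
      (∑ v, f (d v) - n * poissonAvg (M n / n) f) : ℝ)))
      = fun d : Fin n → ℕ => exp (I * ((√(n : ℝ))⁻¹ * D : ℝ)) ^ (∑ v, d v) *
        (exp (-(I * ((√(n : ℝ))⁻¹ * D * M n : ℝ))) * exp (I * ((√(n : ℝ))⁻¹ *
      (∑ v, (f (d v) - D * d v) - n * poissonAvg (M n / n) (fun k => f k - D * k)) : ℝ))) := by
    ext d
    rw [← Complex.exp_nat_mul, ← Complex.exp_add, ← Complex.exp_add, poissonAvg_sub hf
      (expGrowth_natCast.const_mul D), poissonAvg_const_mul, poissonAvg_natCast,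
      Finset.sum_sub_distrib, ← Finset.mul_sum]
    congr 1
    have : (n : ℝ) * (poissonAvg (M n / n) f - D * (M n / n))
        = n * poissonAvg (M n / n) f - D * M n := by field_simp
    rw [this]
    push_cast
    ring
  rw [hfun, ballStep_iterate_pow_sum_mul, ballStep_iterate_const_mul, ← mul_assoc,
    ← Complex.exp_nat_mul, ← Complex.exp_add]
  simp only [Pi.zero_apply, Finset.sum_const_zero, zero_add]
  have : (M n : ℂ) * (I * ((√(n : ℝ))⁻¹ * D : ℝ)) + -(I * ((√(n : ℝ))⁻¹ * D * M n : ℝ)) = 0 := by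
    push_cast; ring
  rw [this, Complex.exp_zero, one_mul]

end OccupancyCLT

/-! ### Uniform random sets of edges, added one at a time -/

section UniformAvg

variable {α X : Type*} [DecidableEq α] [NormedAddCommGroup X] [NormedSpace ℝ X]

/-- The average of `F` over the subsets of `E` with `j` elements. -/
noncomputable def uniformAvg (E : Finset α) (j : ℕ) (F : Finset α → X) : X :=
  ((E.card.choose j : ℕ) : ℝ)⁻¹ • ∑ s ∈ E.powersetCard j, F s

/-- The average over the elements of `E` outside `s` of the value of `F` when that element is added
to `s`. -/
noncomputable def insertAvg (E : Finset α) (F : Finset α → X) (s : Finset α) : X :=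
  ((E.card : ℝ) - s.card)⁻¹ • ∑ e ∈ E \ s, F (insert e s)

omit [NormedSpace ℝ X] in
theorem sum_powersetCard_insert (E : Finset α) (j : ℕ) (F : Finset α → X) :
    ∑ s ∈ E.powersetCard j, ∑ e ∈ E \ s, F (insert e s)
      = (j + 1) • ∑ s ∈ E.powersetCard (j + 1), F s := by
  have h1 : (j + 1) • ∑ s ∈ E.powersetCard (j + 1), F s
      = ∑ s ∈ E.powersetCard (j + 1), ∑ _e ∈ s, F s := by
    rw [Finset.smul_sum]
    refine Finset.sum_congr rfl fun s hs => ?_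
    rw [Finset.sum_const, (Finset.mem_powersetCard.1 hs).2]
  rw [h1, Finset.sum_sigma', Finset.sum_sigma']
  refine Finset.sum_bij' (fun x _ => ⟨insert x.2 x.1, x.2⟩) (fun x _ => ⟨x.1.erase x.2, x.2⟩)
    ?_ ?_ ?_ ?_ ?_
  · rintro ⟨s, e⟩ h
    simp only [Finset.mem_sigma, Finset.mem_powersetCard, Finset.mem_sdiff] at h ⊢
    refine ⟨⟨Finset.insert_subset h.2.1 h.1.1, ?_⟩, Finset.mem_insert_self _ _⟩
    rw [Finset.card_insert_of_notMem h.2.2, h.1.2]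
  · rintro ⟨s, e⟩ h
    simp only [Finset.mem_sigma, Finset.mem_powersetCard, Finset.mem_sdiff] at h ⊢
    refine ⟨⟨(Finset.erase_subset _ _).trans h.1.1, ?_⟩, h.1.1 h.2, Finset.notMem_erase _ _⟩
    rw [Finset.card_erase_of_mem h.2, h.1.2, Nat.add_sub_cancel]
  · rintro ⟨s, e⟩ h
    simp only [Finset.mem_sigma, Finset.mem_powersetCard, Finset.mem_sdiff] at h
    simp [Finset.erase_insert h.2.2]
  · rintro ⟨s, e⟩ h
    simp only [Finset.mem_sigma] at h
    simp [Finset.insert_erase h.2]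
  · rintro ⟨s, e⟩ h
    rfl

/-- A uniform random set with `j + 1` elements arises by adding a uniformly random new element to a
uniform random set with `j` elements. -/
theorem uniformAvg_succ (E : Finset α) {j : ℕ} (hj : j < E.card) (F : Finset α → X) :
    uniformAvg E (j + 1) F = uniformAvg E j (insertAvg E F) := by
  have h1 : ∑ s ∈ E.powersetCard j, insertAvg E F s
      = ((E.card : ℝ) - j)⁻¹ • ((j + 1) • ∑ s ∈ E.powersetCard (j + 1), F s) := by
    rw [← sum_powersetCard_insert, Finset.smul_sum]
    refine Finset.sum_congr rfl fun s hs => ?_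
    rw [insertAvg, (Finset.mem_powersetCard.1 hs).2]
  have h2 : (E.card.choose (j + 1) : ℝ) * (j + 1) = E.card.choose j * ((E.card : ℝ) - j) := by
    rw [← Nat.cast_sub hj.le]
    exact_mod_cast Nat.choose_succ_right_eq E.card j
  have h3 : (0 : ℝ) < E.card - j := sub_pos.2 (by exact_mod_cast hj)
  have h4 : (E.card.choose (j + 1) : ℝ) ≠ 0 := by
    exact_mod_cast (Nat.choose_pos (Nat.succ_le_of_lt hj)).ne'
  have h5 : (E.card.choose j : ℝ) ≠ 0 := by
    exact_mod_cast (Nat.choose_pos hj.le).ne'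
  rw [uniformAvg, uniformAvg, h1, ← Nat.cast_smul_eq_nsmul ℝ, smul_smul, smul_smul]
  congr 1
  push_cast
  field_simp
  linarith

omit [DecidableEq α] in
theorem uniformAvg_zero (E : Finset α) (F : Finset α → X) : uniformAvg E 0 F = F ∅ := by
  simp [uniformAvg]

omit [DecidableEq α] in
theorem uniformAvg_mono {E : Finset α} {j : ℕ} {F G : Finset α → ℝ}
    (h : ∀ s ∈ E.powersetCard j, F s ≤ G s) : uniformAvg E j F ≤ uniformAvg E j G := by
  unfold uniformAvg
  rw [smul_eq_mul, smul_eq_mul]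
  exact mul_le_mul_of_nonneg_left (Finset.sum_le_sum h) (by positivity)

omit [DecidableEq α] in
theorem norm_uniformAvg_sub_le {E : Finset α} {j : ℕ} {F G : Finset α → X} {B : Finset α → ℝ}
    (h : ∀ s ∈ E.powersetCard j, ‖F s - G s‖ ≤ B s) :
    ‖uniformAvg E j F - uniformAvg E j G‖ ≤ uniformAvg E j B := by
  unfold uniformAvg
  rw [← smul_sub, ← Finset.sum_sub_distrib, norm_smul, Real.norm_of_nonneg (by positivity),
    smul_eq_mul]
  exact mul_le_mul_of_nonneg_left (norm_sum_le_of_le _ h) (by positivity)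

omit [DecidableEq α] in
theorem uniformAvg_const_mul (E : Finset α) (j : ℕ) (c : ℝ) (F : Finset α → ℝ) :
    uniformAvg E j (fun s => c * F s) = c * uniformAvg E j F := by
  unfold uniformAvg
  rw [← Finset.mul_sum, smul_eq_mul, smul_eq_mul]
  ring

end UniformAvg

/-! ### Comparison of the uniform random graph with balls thrown into boxes -/

section Comparison

variable {V : Type*} [Fintype V] [DecidableEq V]

variable (V) in
/-- All possible edges on the vertex set `V`. -/
def allEdges : Finset (Sym2 V) := {e | ¬ e.IsDiag}

/-- The degree of the vertex `v` in the graph with edge set `s`. -/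
def edgeDegree (s : Finset (Sym2 V)) (v : V) : ℕ := (s.filter fun e => v ∈ e).card

omit [Fintype V] in
theorem edgeDegree_empty : edgeDegree (∅ : Finset (Sym2 V)) = 0 := by
  ext v; simp [edgeDegree]

omit [Fintype V] in
theorem edgeDegree_insert {s : Finset (Sym2 V)} {u v : V} (huv : u ≠ v) (h : s(u, v) ∉ s) :
    edgeDegree (insert s(u, v) s) = edgeDegree s + Pi.single u 1 + Pi.single v 1 := by
  ext w
  unfold edgeDegree
  rw [Finset.filter_insert]
  simp only [Pi.add_apply, Sym2.mem_iff, Pi.single_apply]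
  split_ifs with h1 h2 h3 h3 h2 h3
  · exact absurd (h2.symm.trans h3) huv
  · rw [Finset.card_insert_of_notMem (by simp [h]), add_zero]
  · rw [Finset.card_insert_of_notMem (by simp [h]), add_zero]
  · tauto
  · tauto
  · tauto
  · tauto
  · rfl

/-- A sum over ordered pairs, split into the loops and twice the edges. -/
theorem sum_sym2_eq (G : Sym2 V → ℂ) :
    ∑ u, ∑ v, G s(u, v) = ∑ u, G s(u, u) + 2 * ∑ e ∈ allEdges V, G e := by
  have h1 : ∑ u, ∑ v, G s(u, v) = ∑ p ∈ (Finset.univ : Finset (V × V)), G s(p.1, p.2) := by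
    rw [← Finset.univ_product_univ, Finset.sum_product]
  rw [h1, ← Finset.univ_product_univ, ← Finset.diag_union_offDiag,
    Finset.sum_union (Finset.disjoint_diag_offDiag _)]
  congr 1
  · rw [Finset.sum_diag]
  rw [← Finset.sum_fiberwise_of_maps_to (t := allEdges V) (g := fun p : V × V => s(p.1, p.2)),
    Finset.mul_sum]
  · refine Finset.sum_congr rfl fun e he => ?_
    induction e using Sym2.ind with | _ u v
    have huv : u ≠ v := by simpa [allEdges] using he
    have h2 : (Finset.univ : Finset V).offDiag.filter (fun p : V × V => s(p.1, p.2) = s(u, v))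
        = {(u, v), (v, u)} := by
      ext ⟨a, b⟩
      simp only [Finset.mem_filter, Finset.mem_offDiag, Finset.mem_univ, true_and, Sym2.eq_iff,
        Finset.mem_insert, Finset.mem_singleton, Prod.mk.injEq]
      constructor
      · exact fun h => h.2
      · rintro (⟨rfl, rfl⟩ | ⟨rfl, rfl⟩)
        · exact ⟨huv, Or.inl ⟨rfl, rfl⟩⟩
        · exact ⟨huv.symm, Or.inr ⟨rfl, rfl⟩⟩
    rw [h2, Finset.sum_pair (by simp [huv]), Sym2.eq_swap (a := v)]
    ring
  · rintro ⟨a, b⟩ h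
    simpa [allEdges] using h

theorem card_allEdges : (allEdges V).card = (Fintype.card V).choose 2 := by
  rw [← Sym2.card_subtype_not_diag, Fintype.card_subtype]
  rfl

theorem two_mul_card_allEdges : 2 * ((allEdges V).card : ℝ) + Fintype.card V
    = (Fintype.card V : ℝ) ^ 2 := by
  rw [card_allEdges, Nat.cast_choose_two]
  ring

/-- Adding one ball to box `u` changes `h` by at most `κ A ^ d_u`. -/
def IsOccupancyLipschitz (κ A : ℝ) (h : (V → ℕ) → ℂ) : Prop :=
  ∀ d u, ‖h (d + Pi.single u 1) - h d‖ ≤ κ * A ^ d u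

theorem sum_pow_add_single (A : ℝ) (d : V → ℕ) (v : V) :
    ∑ u, A ^ (d + Pi.single u 1 : V → ℕ) v = A ^ d v * (Fintype.card V + (A - 1)) := by
  have h : ∀ u, A ^ (d + Pi.single u 1 : V → ℕ) v
      = A ^ d v + if v = u then A ^ d v * (A - 1) else 0 := fun u => by
    rw [Pi.add_apply, Pi.single_apply]
    split_ifs
    · rw [pow_succ]; ring
    · simp
  simp_rw [h]
  rw [Finset.sum_add_distrib, Finset.sum_ite_eq, if_pos (Finset.mem_univ v), Finset.sum_const,
    Finset.card_univ, nsmul_eq_mul]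
  ring

/-- The Lipschitz property survives a ball throw, since a shift commutes with it. -/
theorem IsOccupancyLipschitz.ballStep [Nonempty V] {κ A : ℝ} {h : (V → ℕ) → ℂ}
    (hh : IsOccupancyLipschitz κ A h) :
    IsOccupancyLipschitz (κ * (1 + (A - 1) / Fintype.card V)) A (ballStep h) := by
  intro d v
  have hn : (0 : ℝ) < Fintype.card V := by exact_mod_cast Fintype.card_pos
  unfold _root_.ballStep
  rw [← sub_div, ← Finset.sum_sub_distrib, norm_div, Complex.norm_natCast, div_le_iff₀ hn]
  calc ‖∑ u, (h (d + Pi.single v 1 + Pi.single u 1) - h (d + Pi.single u 1))‖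
      ≤ ∑ u, κ * A ^ (d + Pi.single u 1 : V → ℕ) v := by
        refine norm_sum_le_of_le _ fun u _ => ?_
        rw [add_right_comm]
        exact hh _ _
    _ = κ * (1 + (A - 1) / Fintype.card V) * A ^ d v * Fintype.card V := by
        rw [← Finset.mul_sum, sum_pow_add_single]
        field_simp

theorem IsOccupancyLipschitz.ballStep_iterate [Nonempty V] {κ A : ℝ} {h : (V → ℕ) → ℂ}
    (hh : IsOccupancyLipschitz κ A h) (M : ℕ) :
    IsOccupancyLipschitz (κ * (1 + (A - 1) / Fintype.card V) ^ M) A (_root_.ballStep^[M] h) := by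
  induction M with
  | zero => simpa using hh
  | succ M ih =>
    rw [Function.iterate_succ_apply', pow_succ, ← mul_assoc]
    exact ih.ballStep

omit [Fintype V] in
theorem IsOccupancyLipschitz.norm_two_le {κ A : ℝ} (hκ : 0 ≤ κ) (hA : 1 ≤ A) {h : (V → ℕ) → ℂ}
    (hh : IsOccupancyLipschitz κ A h) (d : V → ℕ) (u v : V) :
    ‖h (d + Pi.single u 1 + Pi.single v 1) - h d‖ ≤ κ * A * (A ^ d u + A ^ d v) := by
  have h1 := hh (d + Pi.single u 1) v
  have h2 := hh d u
  have h3 : A ^ (d + Pi.single u 1 : V → ℕ) v ≤ A * A ^ d v := by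
    rw [← pow_succ']
    refine pow_le_pow_right₀ hA ?_
    rw [Pi.add_apply, Pi.single_apply]
    split_ifs <;> omega
  have h4 : κ * A ^ d u ≤ κ * A * A ^ d u := by
    have : 0 ≤ κ * A ^ d u := by positivity
    nlinarith
  calc _ ≤ ‖h (d + Pi.single u 1 + Pi.single v 1) - h (d + Pi.single u 1)‖
        + ‖h (d + Pi.single u 1) - h d‖ := norm_sub_le_norm_sub_add_norm_sub _ _ _
    _ ≤ κ * (A * A ^ d v) + κ * A * A ^ d u :=
        add_le_add (h1.trans (mul_le_mul_of_nonneg_left h3 hκ)) (h2.trans h4)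
    _ = _ := by ring

theorem sum_sum_mem (s : Finset (Sym2 V)) (g : V → ℝ) :
    ∑ e ∈ s, ∑ v, (if v ∈ e then g v else 0) = ∑ v, edgeDegree s v * g v := by
  rw [Finset.sum_comm]
  refine Finset.sum_congr rfl fun v _ => ?_
  rw [← Finset.sum_filter, Finset.sum_const, nsmul_eq_mul, edgeDegree]

theorem sum_mem_sym2 {u v : V} (huv : u ≠ v) (g : V → ℝ) :
    ∑ w, (if w ∈ s(u, v) then g w else 0) = g u + g v := by
  have : ∀ w, (if w ∈ s(u, v) then g w else 0)
      = (if w = u then g w else 0) + if w = v then g w else 0 := fun w => by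
    simp only [Sym2.mem_iff]
    split_ifs with h1 h2 h3 h3 h2 h3
    · exact absurd (h2.symm.trans h3) huv
    all_goals first | tauto | simp
  simp_rw [this]
  rw [Finset.sum_add_distrib, Finset.sum_ite_eq', Finset.sum_ite_eq', if_pos (Finset.mem_univ _),
    if_pos (Finset.mem_univ _)]

theorem edgeDegree_le_card (s : Finset (Sym2 V)) (v : V) : edgeDegree s v ≤ Fintype.card V := by
  refine (Finset.card_le_card (t := Finset.univ.image fun u => s(v, u)) fun e he => ?_).trans
    Finset.card_image_le
  obtain ⟨u, rfl⟩ := (Finset.mem_filter.1 he).2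
  exact Finset.mem_image_of_mem _ (Finset.mem_univ u)

/-- Adding a random new edge differs from throwing two balls only through loops and repeated edges,
which have probability `O(1 / n)`. -/
theorem norm_insertAvg_sub_ballStep_le [Nonempty V] {κ A K : ℝ} (hκ : 0 ≤ κ) (hA : 1 ≤ A)
    {H : (V → ℕ) → ℂ} (hH : IsOccupancyLipschitz κ A H) {s : Finset (Sym2 V)}
    (hs : s ⊆ allEdges V) (hK : ((Fintype.card V : ℝ) + 2 * s.card) * Fintype.card V
      ≤ K * ((allEdges V).card - s.card)) (hN : s.card < (allEdges V).card) :
    ‖insertAvg (allEdges V) (fun s => H (edgeDegree s)) s - ballStep (ballStep H) (edgeDegree s)‖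
      ≤ κ * A * (K + 4) / (Fintype.card V : ℝ) ^ 2 * ∑ v, (2 * A) ^ edgeDegree s v := by
  set n : ℝ := (Fintype.card V : ℝ) with hn
  set N : ℝ := ((allEdges V).card : ℝ) with hNdef
  set d := edgeDegree s with hd
  have hn0 : 0 < n := by rw [hn]; exact_mod_cast Fintype.card_pos
  have hN0 : 0 < N - s.card := sub_pos.2 (by rw [hNdef]; exact_mod_cast hN)
  have hnN : 2 * N + n = n ^ 2 := two_mul_card_allEdges
  -- The change of `H` when the edge `e` is added, or two balls are thrown according to `e`.
  let Δ : Sym2 V → ℂ := Sym2.lift ⟨fun u v => H (d + Pi.single u 1 + Pi.single v 1) - H d,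
    fun u v => by simp only [add_right_comm]⟩
  have hΔ : ∀ u v, H (d + Pi.single u 1 + Pi.single v 1) = Δ s(u, v) + H d := fun u v => by
    simp [Δ]
  have hins : ∀ e ∈ allEdges V \ s, H (edgeDegree (insert e s)) = Δ e + H d := fun e he => by
    induction e using Sym2.ind with | _ u v
    rw [Finset.mem_sdiff] at he
    have huv : u ≠ v := by simpa [allEdges] using he.1
    rw [edgeDegree_insert huv he.2, hΔ]
  have hcard : ((allEdges V \ s).card : ℝ) = N - s.card := by
    rw [Finset.card_sdiff_of_subset hs, Nat.cast_sub hN.le]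
  have e1 : insertAvg (allEdges V) (fun s => H (edgeDegree s)) s
      = ((N - s.card)⁻¹ : ℝ) * ∑ e ∈ allEdges V \ s, Δ e + H d := by
    rw [insertAvg, Finset.sum_congr rfl hins, Finset.sum_add_distrib, Finset.sum_const,
      nsmul_eq_mul, smul_add, Complex.real_smul, Complex.real_smul, ← mul_assoc]
    congr 1
    have : (((N - s.card)⁻¹ : ℝ) : ℂ) * ((allEdges V \ s).card : ℂ) = 1 := by
      rw [← Complex.ofReal_natCast, hcard, ← Complex.ofReal_mul, inv_mul_cancel₀ hN0.ne',
        Complex.ofReal_one]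
    rw [this, one_mul]
  have e2 : ballStep (ballStep H) d
      = (n ^ 2 : ℝ)⁻¹ * (∑ u, Δ s(u, u) + 2 * ∑ e ∈ allEdges V, Δ e) + H d := by
    have hnc : (Fintype.card V : ℂ) ≠ 0 := by exact_mod_cast Fintype.card_ne_zero
    have hnn : (n : ℂ) = Fintype.card V := by rw [hn]; push_cast; rfl
    unfold ballStep
    simp_rw [hΔ]
    rw [← sum_sym2_eq, ← Finset.sum_div]
    simp_rw [Finset.sum_add_distrib, Finset.sum_const, Finset.card_univ, nsmul_eq_mul]
    rw [hnn.symm] at hnc ⊢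
    push_cast
    field_simp
  have e3 : ∑ e ∈ allEdges V, Δ e = ∑ e ∈ allEdges V \ s, Δ e + ∑ e ∈ s, Δ e :=
    (Finset.sum_sdiff hs).symm
  -- A new edge `e` has probability `1 / (N - |s|)`, and two balls produce `e` with probability
  -- `2 / n ^ 2`.
  have e4 : insertAvg (allEdges V) (fun s => H (edgeDegree s)) s - ballStep (ballStep H) d
      = ((n ^ 2 : ℝ)⁻¹ : ℝ) * (((n + 2 * s.card) / (N - s.card) : ℝ) * ∑ e ∈ allEdges V \ s, Δ e
        - 2 * ∑ e ∈ s, Δ e - ∑ u, Δ s(u, u)) := by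
    have h5 : (N - s.card)⁻¹ = (n ^ 2)⁻¹ * ((n + 2 * s.card) / (N - s.card)) + 2 * (n ^ 2)⁻¹ := by
      field_simp
      linarith
    rw [e1, e2, e3, h5]
    push_cast
    ring
  have hbound : ∀ e ∈ allEdges V, ‖Δ e‖ ≤ κ * A * ∑ v, (if v ∈ e then A ^ d v else 0) :=
    fun e he => by
    induction e using Sym2.ind with | _ u v
    have huv : u ≠ v := by simpa [allEdges] using he
    rw [sum_mem_sym2 huv]
    exact hH.norm_two_le hκ hA d u v
  have hsum : ∀ t ⊆ allEdges V, ‖∑ e ∈ t, Δ e‖ ≤ κ * A * ∑ v, edgeDegree t v * A ^ d v :=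
    fun t ht => by
    rw [← sum_sum_mem, Finset.mul_sum]
    exact norm_sum_le_of_le _ fun e he => hbound e (ht he)
  set S := ∑ v, (2 * A) ^ d v with hS
  have hA0 : 0 ≤ κ * A := by positivity
  have hAd : ∀ v, A ^ d v ≤ (2 * A) ^ d v := fun v => by
    gcongr; linarith
  -- Over all edges the degrees are at most `n`; over `s` the degree is absorbed into `2 ^ d v`.
  have b1 : ‖∑ e ∈ allEdges V \ s, Δ e‖ ≤ κ * A * (n * S) := by
    refine (hsum _ Finset.sdiff_subset).trans (mul_le_mul_of_nonneg_left ?_ hA0)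
    rw [hS, Finset.mul_sum]
    refine Finset.sum_le_sum fun v _ => ?_
    refine mul_le_mul ?_ (hAd v) (by positivity) hn0.le
    rw [hn]
    exact_mod_cast edgeDegree_le_card _ v
  have b2 : ‖∑ e ∈ s, Δ e‖ ≤ κ * A * S := by
    refine (hsum _ hs).trans (mul_le_mul_of_nonneg_left ?_ hA0)
    refine Finset.sum_le_sum fun v _ => ?_
    rw [mul_pow]
    refine mul_le_mul_of_nonneg_right ?_ (by positivity)
    exact_mod_cast (Nat.lt_two_pow_self (n := d v)).le
  have b3 : ‖∑ u, Δ s(u, u)‖ ≤ κ * A * (2 * S) := by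
    rw [hS, Finset.mul_sum, Finset.mul_sum]
    refine norm_sum_le_of_le _ fun u _ => ?_
    have := hH.norm_two_le hκ hA d u u
    refine this.trans (mul_le_mul_of_nonneg_left ?_ hA0)
    linarith [hAd u]
  have hK' : (n + 2 * s.card) / (N - s.card) * n ≤ K := by
    rw [div_mul_eq_mul_div, div_le_iff₀ hN0]
    exact hK
  have hq : 0 ≤ (n + 2 * s.card) / (N - s.card) :=
    div_nonneg (add_nonneg hn0.le (mul_nonneg zero_le_two (Nat.cast_nonneg _))) hN0.le
  have hS0 : 0 ≤ S := Finset.sum_nonneg fun v _ => by positivity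
  have hn2 : 0 ≤ (n ^ 2)⁻¹ := inv_nonneg.2 (sq_nonneg n)
  rw [e4, norm_mul, Complex.norm_real, Real.norm_of_nonneg hn2]
  calc (n ^ 2)⁻¹ * _ ≤ (n ^ 2)⁻¹ * ((n + 2 * s.card) / (N - s.card) * (κ * A * (n * S))
        + 2 * (κ * A * S) + κ * A * (2 * S)) := by
        refine mul_le_mul_of_nonneg_left ?_ hn2
        refine (norm_sub_le _ _).trans (add_le_add ((norm_sub_le _ _).trans (add_le_add ?_ ?_)) b3)
        · rw [norm_mul, Complex.norm_real, Real.norm_of_nonneg hq]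
          exact mul_le_mul_of_nonneg_left b1 hq
        · rw [norm_mul, Complex.norm_ofNat]
          exact mul_le_mul_of_nonneg_left b2 zero_le_two
    _ = (n ^ 2)⁻¹ * (κ * A * S * ((n + 2 * s.card) / (N - s.card) * n + 4)) := by ring
    _ ≤ (n ^ 2)⁻¹ * (κ * A * S * (K + 4)) :=
        mul_le_mul_of_nonneg_left (mul_le_mul_of_nonneg_left (by linarith)
          (mul_nonneg hA0 hS0)) hn2
    _ = _ := by ring

/-- Exponential moments of the degrees in the uniform random graph. The bound is `O(n)` when the
number of edges is. -/
theorem uniformAvg_sum_pow_edgeDegree_le [Nonempty V] {B K : ℝ} (hB : 1 ≤ B) {m : ℕ}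
    (hm : m ≤ (allEdges V).card) (hK : (Fintype.card V : ℝ) * Fintype.card V
      ≤ K * ((allEdges V).card - m)) :
    uniformAvg (allEdges V) m (fun s => ∑ v, B ^ edgeDegree s v)
      ≤ Fintype.card V * (1 + (B - 1) * K / Fintype.card V) ^ m := by
  set n : ℝ := (Fintype.card V : ℝ) with hn
  have hn0 : 0 < n := by rw [hn]; exact_mod_cast Fintype.card_pos
  have hN0 : (0 : ℝ) ≤ (allEdges V).card - m := sub_nonneg.2 (by exact_mod_cast hm)
  have hK0 : 0 ≤ K := by
    by_contra h
    nlinarith [mul_pos hn0 hn0, mul_nonneg (neg_nonneg.2 (not_le.1 h).le) hN0]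
  induction m with
  | zero => rw [uniformAvg_zero, edgeDegree_empty]; simp [hn]
  | succ m ih =>
    have hlt : m < (allEdges V).card := hm
    have hpos : (0 : ℝ) < (allEdges V).card - m := sub_pos.2 (by exact_mod_cast hlt)
    have hK' : n * n ≤ K * ((allEdges V).card - m) := by
      refine hK.trans (mul_le_mul_of_nonneg_left ?_ hK0)
      push_cast
      linarith
    specialize ih hlt.le hK' hpos.le
    rw [uniformAvg_succ _ hlt, pow_succ, ← mul_assoc, mul_comm]
    refine le_trans ?_ (mul_le_mul_of_nonneg_left ih (by
      have : 0 ≤ B - 1 := by linarith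
      positivity))
    rw [← uniformAvg_const_mul]
    refine uniformAvg_mono fun s hs => ?_
    obtain ⟨hs, hcs⟩ := Finset.mem_powersetCard.1 hs
    have h1 : ∀ e ∈ allEdges V \ s, ∑ v, B ^ edgeDegree (insert e s) v
        = ∑ v, B ^ edgeDegree s v + ∑ v, (if v ∈ e then (B - 1) * B ^ edgeDegree s v else 0) :=
      fun e he => by
      rw [← Finset.sum_add_distrib]
      refine Finset.sum_congr rfl fun v _ => ?_
      have : edgeDegree (insert e s) v = edgeDegree s v + if v ∈ e then 1 else 0 := by
        unfold edgeDegree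
        rw [Finset.filter_insert]
        split_ifs
        · rw [Finset.card_insert_of_notMem (by simp [(Finset.mem_sdiff.1 he).2])]
        · rfl
      rw [this]
      split_ifs
      · rw [pow_succ]; ring
      · simp
    have hcard : ((allEdges V \ s).card : ℝ) = (allEdges V).card - m := by
      rw [Finset.card_sdiff_of_subset hs, hcs, Nat.cast_sub hlt.le]
    rw [insertAvg, Finset.sum_congr rfl h1, Finset.sum_add_distrib, Finset.sum_const, nsmul_eq_mul,
      sum_sum_mem, hcard, hcs, smul_eq_mul, inv_mul_le_iff₀ hpos]
    have h2 : ∑ v, edgeDegree (allEdges V \ s) v * ((B - 1) * B ^ edgeDegree s v)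
        ≤ n * (B - 1) * ∑ v, B ^ edgeDegree s v := by
      rw [Finset.mul_sum]
      refine Finset.sum_le_sum fun v _ => ?_
      rw [← mul_assoc]
      have : 0 ≤ B - 1 := by linarith
      gcongr
      rw [hn]
      exact_mod_cast edgeDegree_le_card _ v
    have h3 : n ≤ K / n * ((allEdges V).card - m) := by
      rw [div_mul_eq_mul_div, le_div_iff₀ hn0]
      exact hK'
    have hS0 : 0 ≤ ∑ v, B ^ edgeDegree s v := Finset.sum_nonneg fun v _ => by positivity
    have h4 := mul_le_mul_of_nonneg_right h3 (mul_nonneg (by linarith : 0 ≤ B - 1) hS0)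
    calc _ ≤ _ := add_le_add_right h2 _
      _ ≤ _ := by
        have : ((allEdges V).card - (m : ℝ)) * ((1 + (B - 1) * K / n) * ∑ v, B ^ edgeDegree s v)
          = ((allEdges V).card - (m : ℝ)) * ∑ v, B ^ edgeDegree s v
            + K / n * ((allEdges V).card - (m : ℝ)) * ((B - 1) * ∑ v, B ^ edgeDegree s v) := by
          field_simp
        rw [this]
        linarith

/-- **Comparison theorem**: for functions of the degree sequence, the uniform random graph with `m`
edges may be replaced by `2 m` balls thrown into `n` boxes. The proof replaces the edges by pairs of
balls one at a time. -/
theorem norm_uniformAvg_sub_ballStep_le [Nonempty V] {κ A K : ℝ} (hκ : 0 ≤ κ) (hA : 1 ≤ A)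
    {h : (V → ℕ) → ℂ} (hh : IsOccupancyLipschitz κ A h) {m : ℕ} (hm : m ≤ (allEdges V).card)
    (hK : ((Fintype.card V : ℝ) + 2 * m) * Fintype.card V ≤ K * ((allEdges V).card - m)) :
    ‖uniformAvg (allEdges V) m (fun s => h (edgeDegree s)) - ballStep^[2 * m] h 0‖
      ≤ κ * (A * (K + 4) * (m / Fintype.card V)
        * Real.exp ((A - 1) * (2 * m / Fintype.card V))
        * Real.exp ((2 * A - 1) * K * (m / Fintype.card V))) := by
  set n : ℝ := (Fintype.card V : ℝ) with hn
  have hn0 : 0 < n := by rw [hn]; exact_mod_cast Fintype.card_pos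
  have hN0 : (0 : ℝ) ≤ (allEdges V).card - m := sub_nonneg.2 (by exact_mod_cast hm)
  have hK0 : 0 ≤ K := by
    by_contra hneg
    have h1 : 0 < (n + 2 * m) * n := by positivity
    nlinarith [mul_nonneg (neg_nonneg.2 (not_le.1 hneg).le) hN0]
  -- The interpolation: `i` edges, and two balls in place of each of the other `m - i`.
  set W : ℕ → ℂ := fun i =>
    uniformAvg (allEdges V) i (fun s => ballStep^[2 * (m - i)] h (edgeDegree s)) with hW
  have hWm : W m = uniformAvg (allEdges V) m (fun s => h (edgeDegree s)) := by simp [hW]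
  have hW0 : W 0 = ballStep^[2 * m] h 0 := by
    simp [hW, uniformAvg_zero, edgeDegree_empty]
  have hstep : ∀ i ∈ Finset.range m, ‖W (i + 1) - W i‖ ≤ κ * (A * (K + 4) / n
        * Real.exp ((A - 1) * (2 * m / n)) * Real.exp ((2 * A - 1) * K * (m / n))) := by
    intro i hi
    rw [Finset.mem_range] at hi
    have hlt : i < (allEdges V).card := hi.trans_le hm
    have him : (i : ℝ) ≤ m := by exact_mod_cast hi.le
    set κ' := κ * (1 + (A - 1) / n) ^ (2 * (m - (i + 1))) with hκ'
    have hbase : 0 ≤ (A - 1) / n := div_nonneg (by linarith) hn0.le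
    have hκ'0 : 0 ≤ κ' := by positivity
    have hL : IsOccupancyLipschitz κ' A (ballStep^[2 * (m - (i + 1))] h) := hh.ballStep_iterate _
    have hi2 : 2 * (m - i) = 2 * (m - (i + 1)) + 1 + 1 := by omega
    have hKi : (n + 2 * i) * n ≤ K * ((allEdges V).card - i) := by
      calc (n + 2 * i) * n ≤ (n + 2 * m) * n := by gcongr
        _ ≤ _ := hK
        _ ≤ _ := by gcongr
    have h1 : ‖W (i + 1) - W i‖ ≤ uniformAvg (allEdges V) i (fun s =>
        κ' * A * (K + 4) / n ^ 2 * ∑ v, (2 * A) ^ edgeDegree s v) := by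
      rw [hW]
      simp only
      rw [uniformAvg_succ _ hlt, hi2]
      simp only [Function.iterate_succ_apply']
      refine norm_uniformAvg_sub_le fun s hs => ?_
      obtain ⟨hs, hcs⟩ := Finset.mem_powersetCard.1 hs
      exact norm_insertAvg_sub_ballStep_le hκ'0 hA hL hs (by rw [hcs]; exact hKi) (by rwa [hcs])
    rw [uniformAvg_const_mul] at h1
    have h2 := uniformAvg_sum_pow_edgeDegree_le (V := V) (B := 2 * A) (K := K) (by linarith) hlt.le
      (by
        refine le_trans ?_ hKi
        rw [← hn]
        gcongr
        have : (0 : ℝ) ≤ i := Nat.cast_nonneg i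
        linarith)
    have h3 : (1 + (2 * A - 1) * K / n) ^ i ≤ Real.exp ((2 * A - 1) * K * (m / n)) := by
      have h0 : 0 ≤ (2 * A - 1) * K / n := by
        have : 0 ≤ 2 * A - 1 := by linarith
        positivity
      calc (1 + (2 * A - 1) * K / n) ^ i ≤ Real.exp ((2 * A - 1) * K / n) ^ i := by
            gcongr
            rw [add_comm]; exact Real.add_one_le_exp _
        _ = Real.exp (i * ((2 * A - 1) * K / n)) := by rw [Real.exp_nat_mul]
        _ ≤ Real.exp (m * ((2 * A - 1) * K / n)) := by gcongr
        _ = _ := by congr 1; ring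
    have h4 : (1 + (A - 1) / n) ^ (2 * (m - (i + 1))) ≤ Real.exp ((A - 1) * (2 * m / n)) := by
      calc (1 + (A - 1) / n) ^ (2 * (m - (i + 1))) ≤ (1 + (A - 1) / n) ^ (2 * m) := by
            refine pow_le_pow_right₀ (by linarith) (by omega)
        _ ≤ Real.exp ((A - 1) / n) ^ (2 * m) := by
            gcongr
            rw [add_comm]; exact Real.add_one_le_exp _
        _ = Real.exp ((2 * m : ℕ) * ((A - 1) / n)) := by rw [Real.exp_nat_mul]
        _ = _ := by congr 1; push_cast; ring
    calc ‖W (i + 1) - W i‖ ≤ _ := h1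
      _ ≤ κ' * A * (K + 4) / n ^ 2 * (n * Real.exp ((2 * A - 1) * K * (m / n))) := by
          gcongr
          exact h2.trans (by gcongr)
      _ ≤ (κ * Real.exp ((A - 1) * (2 * m / n))) * A * (K + 4) / n ^ 2 *
            (n * Real.exp ((2 * A - 1) * K * (m / n))) := by
          rw [hκ']
          gcongr
      _ = _ := by field_simp
  rw [← hWm, ← hW0, ← Finset.sum_range_sub]
  refine (norm_sum_le_of_le _ hstep).trans (le_of_eq ?_)
  rw [Finset.sum_const, Finset.card_range, nsmul_eq_mul]
  ring

end Comparison

/-! ### Characteristic functions for the uniform random graph -/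

section UniformGraph

open Complex

theorem isOccupancyLipschitz_exp {V : Type*} [Fintype V] [DecidableEq V] {f : ℕ → ℝ} {C A : ℝ}
    (hC : 0 ≤ C) (hA : 1 ≤ A) (hf : ∀ k, ‖f k‖ ≤ C * A ^ k) {τ : ℝ} (hτ : 0 ≤ τ) (b : ℝ) :
    IsOccupancyLipschitz (τ * (2 * C * A)) A
      (fun d : V → ℕ => exp (I * (τ * (∑ v, f (d v) - b) : ℝ))) := by
  intro d u
  have h1 : ∑ v, f ((d + Pi.single u 1 : V → ℕ) v) - ∑ v, f (d v) = f (d u + 1) - f (d u) := by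
    rw [← Finset.sum_sub_distrib, Finset.sum_eq_single u]
    · simp
    · intro v _ hv
      simp [Pi.single_eq_of_ne hv]
    · simp
  have h2 : exp (I * (τ * (∑ v, f ((d + Pi.single u 1 : V → ℕ) v) - b) : ℝ))
      - exp (I * (τ * (∑ v, f (d v) - b) : ℝ))
      = exp (I * (τ * (∑ v, f (d v) - b) : ℝ)) *
        (exp (I * (τ * (f (d u + 1) - f (d u)) : ℝ)) - 1) := by
    rw [mul_sub (exp _), mul_one, ← Complex.exp_add, ← h1]
    congr 2
    push_cast
    ring
  have h3 : ‖f (d u + 1) - f (d u)‖ ≤ 2 * C * A * A ^ d u := by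
    refine (norm_sub_le _ _).trans ((add_le_add (hf _) (hf _)).trans ?_)
    rw [pow_succ]
    have : 0 ≤ C * A ^ d u := by positivity
    nlinarith
  simp only
  rw [h2, norm_mul, Complex.norm_exp_I_mul_ofReal, one_mul]
  refine Real.norm_exp_I_mul_ofReal_sub_one_le.trans ?_
  rw [norm_mul, Real.norm_of_nonneg hτ, mul_assoc τ]
  exact mul_le_mul_of_nonneg_left h3 hτ

theorem card_allEdges_fin (n : ℕ) : (allEdges (Fin n)).card = n.choose 2 := by
  rw [card_allEdges, Fintype.card_fin]

/-- The average, over the graphs with `j` edges on `n` vertices, of the exponential of `i` times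
`∑ f(deg v) - b`, scaled by `n ^ (-1/2)`. -/
noncomputable def degreeCharFun (n j : ℕ) (f : ℕ → ℝ) (b : ℝ) : ℂ :=
  uniformAvg (allEdges (Fin n)) j fun s =>
    exp (I * ((√(n : ℝ))⁻¹ * (∑ v, f (edgeDegree s v) - b) : ℝ))

theorem norm_degreeCharFun_le (n j : ℕ) (f : ℕ → ℝ) (b : ℝ) : ‖degreeCharFun n j f b‖ ≤ 1 := by
  unfold degreeCharFun uniformAvg
  rw [norm_smul, Real.norm_of_nonneg (by positivity)]
  have h : ‖∑ s ∈ (allEdges (Fin n)).powersetCard j,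
      exp (I * ((√(n : ℝ))⁻¹ * (∑ v, f (edgeDegree s v) - b) : ℝ))‖
      ≤ ((allEdges (Fin n)).card.choose j : ℕ) := by
    refine (norm_sum_le_of_le (f := fun s => exp (I * ((√(n : ℝ))⁻¹ *
      (∑ v, f (edgeDegree s v) - b) : ℝ))) (n := fun _ => (1 : ℝ)) _ fun s _ =>
        (Complex.norm_exp_I_mul_ofReal _).le).trans ?_
    rw [Finset.sum_const, Finset.card_powersetCard, nsmul_eq_mul, mul_one]
  exact inv_mul_le_one_of_le₀ h (by positivity)

/-- A change of the centring multiplies the characteristic function by a phase. -/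
theorem degreeCharFun_shift (n j : ℕ) (f : ℕ → ℝ) (b c : ℝ) :
    degreeCharFun n j f b = exp (I * ((√(n : ℝ))⁻¹ * (c - b) : ℝ)) * degreeCharFun n j f c := by
  unfold degreeCharFun uniformAvg
  rw [mul_smul_comm, Finset.mul_sum]
  refine congrArg _ ?_
  refine Finset.sum_congr rfl fun s _ => ?_
  rw [← Complex.exp_add]
  push_cast
  ring_nf

theorem tendsto_inv_sqrt_natCast : Tendsto (fun n : ℕ => (√(n : ℝ))⁻¹) atTop (𝓝 0) :=
  tendsto_inv_atTop_zero.comp (Real.tendsto_sqrt_atTop.comp tendsto_natCast_atTop_atTop)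

/-- The limit of the characteristic functions for the uniform random graph. -/
theorem tendsto_degreeCharFun {s : ℝ} (hs : 0 < s) {m : ℕ → ℕ}
    (hm : ∀ᶠ n in atTop, m n ≤ n.choose 2)
    (hlim : Tendsto (fun n : ℕ => 2 * (m n : ℝ) / n) atTop (𝓝 s)) {f : ℕ → ℝ} (hf : ExpGrowth f) :
    Tendsto (fun n => degreeCharFun n (m n) f (n * poissonAvg (2 * (m n : ℝ) / n) f)) atTop
      (𝓝 (exp (-(residualVariance s f : ℝ) / 2))) := by
  obtain ⟨C, A, hC, hA, hfb⟩ := hf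
  have hlim' : Tendsto (fun n : ℕ => ((2 * m n : ℕ) : ℝ) / n) atTop (𝓝 s) := by
    push_cast; exact hlim
  have hocc := tendsto_ballStep hs hlim' (f := f) ⟨C, A, hC, hA, hfb⟩
  -- Eventually `m n ≤ (s + 1) n / 2`, so at least `n ^ 2 / 4` edges remain free, and
  -- `(n + 2 m) n ≤ (s + 2) n ^ 2`.
  set K : ℝ := 4 * (s + 2) with hK
  have hhalf : Tendsto (fun n : ℕ => (m n : ℝ) / n) atTop (𝓝 (s / 2)) := by
    refine (hlim.div_const 2).congr fun n => by ring
  -- The error of the comparison theorem tends to `0`.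
  have herr : Tendsto (fun n : ℕ => ((√(n : ℝ))⁻¹ * (2 * C * A)) * (A * (K + 4) * ((m n : ℝ) / n)
        * Real.exp ((A - 1) * (2 * (m n : ℝ) / n))
        * Real.exp ((2 * A - 1) * K * ((m n : ℝ) / n)))) atTop (𝓝 0) := by
    have h1 := tendsto_inv_sqrt_natCast.mul_const (2 * C * A)
    have h2 := ((hhalf.const_mul (A * (K + 4))).mul
      ((Real.continuous_exp.tendsto _).comp (hlim.const_mul (A - 1)))).mul
      ((Real.continuous_exp.tendsto _).comp (hhalf.const_mul ((2 * A - 1) * K)))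
    have h3 := h1.mul h2
    rw [zero_mul, zero_mul] at h3
    exact h3
  have hdiff : Tendsto (fun n => degreeCharFun n (m n) f (n * poissonAvg (2 * (m n : ℝ) / n) f)
      - ballStep^[2 * m n] (fun d : Fin n → ℕ => exp (I * ((√(n : ℝ))⁻¹ *
      (∑ v, f (d v) - n * poissonAvg ((2 * m n : ℕ) / n) f) : ℝ))) 0) atTop (𝓝 0) := by
    refine squeeze_zero_norm' ?_ herr
    filter_upwards [hm, eventually_gt_atTop 0, hlim.eventually (gt_mem_nhds (lt_add_one s)),
      eventually_ge_atTop (⌈2 * s + 4⌉₊)] with n hmn hn hn2 hn3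
    have : Nonempty (Fin n) := ⟨⟨0, hn⟩⟩
    have hn1 : (0 : ℝ) < n := by exact_mod_cast hn
    have hn4 : 2 * s + 4 ≤ n := Nat.ceil_le.1 hn3
    have h2m : 2 * (m n : ℝ) ≤ (s + 1) * n := ((div_lt_iff₀ hn1).1 hn2).le
    have hN : ((allEdges (Fin n)).card : ℝ) = n * (n - 1) / 2 := by
      rw [card_allEdges_fin, Nat.cast_choose_two]
    have hcond : ((Fintype.card (Fin n) : ℝ) + 2 * m n) * Fintype.card (Fin n)
        ≤ K * ((allEdges (Fin n)).card - m n) := by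
      rw [Fintype.card_fin, hN]
      have h5 : (n : ℝ) * n / 4 ≤ n * (n - 1) / 2 - m n := by nlinarith
      have h6 : ((n : ℝ) + 2 * m n) * n ≤ (s + 2) * (n * n) := by nlinarith
      have h7 := mul_le_mul_of_nonneg_left h5 (by positivity : 0 ≤ K)
      calc _ ≤ _ := h6
        _ = K * ((n : ℝ) * n / 4) := by rw [hK]; ring
        _ ≤ _ := h7
    have h8 := norm_uniformAvg_sub_ballStep_le (by positivity) hA
      (isOccupancyLipschitz_exp (V := Fin n) hC hA hfb (inv_nonneg.2 (Real.sqrt_nonneg n))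
        (n * poissonAvg (2 * (m n : ℝ) / n) f)) (m := m n) (K := K)
      (by rw [card_allEdges_fin]; exact hmn) hcond
    rw [Fintype.card_fin] at h8
    rw [Nat.cast_mul, Nat.cast_two]
    exact h8
  simpa using hdiff.add hocc

end UniformGraph

/-! ### Binomial mixtures -/

section Binomial

open Complex

/-- The binomial probability of `j` successes in `N` trials. -/
noncomputable def binomialProb (N : ℕ) (p : ℝ) (j : ℕ) : ℝ :=
  N.choose j * p ^ j * (1 - p) ^ (N - j)

theorem binomialProb_nonneg {p : ℝ} (hp : p ∈ Set.Icc (0 : ℝ) 1) (N j : ℕ) :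
    0 ≤ binomialProb N p j := by
  have := sub_nonneg.2 hp.2
  have := hp.1
  unfold binomialProb
  positivity

theorem sum_binomialProb (N : ℕ) (p : ℝ) : ∑ j ∈ Finset.range (N + 1), binomialProb N p j = 1 := by
  have h := add_pow p (1 - p) N
  rw [add_sub_cancel, one_pow] at h
  rw [h]
  exact Finset.sum_congr rfl fun j _ => by unfold binomialProb; ring

theorem sum_binomialProb_mul_exp (N : ℕ) (p : ℝ) (z : ℂ) :
    ∑ j ∈ Finset.range (N + 1), (binomialProb N p j : ℂ) * z ^ j = (1 + p * (z - 1)) ^ N := by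
  have h := add_pow (p * z) (1 - p) N
  rw [show (p : ℂ) * z + (1 - p) = 1 + p * (z - 1) by ring] at h
  rw [h]
  refine Finset.sum_congr rfl fun j _ => ?_
  unfold binomialProb
  push_cast
  ring

theorem sum_binomialProb_mul_sub_sq (N : ℕ) (p c : ℝ) :
    ∑ j ∈ Finset.range (N + 1), binomialProb N p j * (j - c) ^ 2
      = N * p * (1 - p) + (N * p - c) ^ 2 := by
  have hb : ∀ j, binomialProb N p j = (bernsteinPolynomial ℝ N j).eval p := fun j => by
    simp [binomialProb, bernsteinPolynomial]
  have h1 := congrArg (Polynomial.eval p) (bernsteinPolynomial.variance ℝ N)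
  have h2 := congrArg (Polynomial.eval p) (bernsteinPolynomial.sum_smul ℝ N)
  simp only [Polynomial.eval_finsetSum, Polynomial.eval_mul, Polynomial.eval_pow, Polynomial.eval_sub,
    nsmul_eq_mul, Polynomial.eval_natCast, Polynomial.eval_X, ← hb, Polynomial.eval_one] at h1 h2
  have h3 : ∀ j : ℕ, binomialProb N p j * (j - c) ^ 2 = (N * p - j) ^ 2 * binomialProb N p j
      + 2 * (N * p - c) * (j * binomialProb N p j)
      + (c ^ 2 - (N * p) ^ 2) * binomialProb N p j := fun j => by ring
  simp_rw [h3]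
  rw [Finset.sum_add_distrib, Finset.sum_add_distrib, ← Finset.mul_sum, ← Finset.mul_sum, h1, h2,
    sum_binomialProb]
  ring

/-- Characteristic functions of binomial variables with mean of order `n`, on the scale
`n ^ (-1/2)`. -/
theorem tendsto_binomial_charFun {r : ℕ → ℝ} {s : ℝ} (hr : Tendsto r atTop (𝓝 s)) {p : ℕ → ℝ}
    (hp : ∀ n, p n ∈ Set.Icc (0 : ℝ) 1) (hpr : ∀ n : ℕ, 0 < n → p n = r n / n) (γ : ℝ) :
    Tendsto (fun n : ℕ => ∑ j ∈ Finset.range (n.choose 2 + 1), (binomialProb (n.choose 2) (p n) j : ℂ)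
      * exp (I * (√(n : ℝ) * (γ * (2 * (j : ℝ) / n - r n)) : ℝ))) atTop
      (𝓝 (exp (-(s * γ ^ 2 : ℝ)))) := by
  set z : ℕ → ℂ := fun n => p n * (exp (I * ((√(n : ℝ))⁻¹ * (2 * γ) : ℝ)) - 1) with hz
  have hsum : ∀ᶠ n : ℕ in atTop, exp (-(I * (√(n : ℝ) * (γ * r n) : ℝ))) * (1 + z n) ^ n.choose 2
      = ∑ j ∈ Finset.range (n.choose 2 + 1), (binomialProb (n.choose 2) (p n) j : ℂ)
      * exp (I * (√(n : ℝ) * (γ * (2 * (j : ℝ) / n - r n)) : ℝ)) := by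
    filter_upwards [eventually_gt_atTop 0] with n hn
    have hn1 : (0 : ℝ) < n := by exact_mod_cast hn
    have hsq : √(n : ℝ) ≠ 0 := (Real.sqrt_pos.2 hn1).ne'
    rw [hz, ← sum_binomialProb_mul_exp, Finset.mul_sum]
    refine Finset.sum_congr rfl fun j _ => ?_
    rw [mul_left_comm, ← Complex.exp_nat_mul, ← Complex.exp_add]
    congr 2
    have : √(n : ℝ) * (γ * (2 * (j : ℝ) / n - r n))
        = -(√(n : ℝ) * (γ * r n)) + j * ((√(n : ℝ))⁻¹ * (2 * γ)) := by
      nth_rewrite 2 [← Real.mul_self_sqrt hn1.le]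
      field_simp
      ring
    rw [this]
    push_cast
    ring
  refine Tendsto.congr' hsum ?_
  have hNp : ∀ᶠ n : ℕ in atTop, (n.choose 2 : ℝ) * p n = (1 - 1 / (n : ℝ)) * (r n / 2) * n := by
    filter_upwards [eventually_gt_atTop 0] with n hn
    have hn1 : (n : ℝ) ≠ 0 := by exact_mod_cast hn.ne'
    rw [Nat.cast_choose_two, hpr n hn]
    field_simp
  have hzn : ∀ n, ‖z n‖ ≤ p n * ((√(n : ℝ))⁻¹ * (2 * |γ|)) := fun n => by
    rw [hz]
    simp only
    rw [norm_mul, Complex.norm_real, Real.norm_of_nonneg (hp n).1]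
    refine mul_le_mul_of_nonneg_left (Real.norm_exp_I_mul_ofReal_sub_one_le.trans ?_) (hp n).1
    rw [norm_mul, Real.norm_of_nonneg (by positivity), Real.norm_eq_abs, abs_mul, abs_two]
  have hone : Tendsto (fun n : ℕ => 1 - 1 / (n : ℝ)) atTop (𝓝 1) := by
    simpa using (tendsto_const_nhds (x := (1 : ℝ))).sub tendsto_one_div_atTop_nhds_zero_nat
  -- Replace `1 + z` by `exp z`: both lie in the unit disc.
  have hdiff : Tendsto (fun n : ℕ => exp (-(I * (√(n : ℝ) * (γ * r n) : ℝ))) * ((1 + z n) ^ n.choose 2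
      - exp (z n) ^ n.choose 2)) atTop (𝓝 0) := by
    have hb : Tendsto (fun n : ℕ => (1 - 1 / (n : ℝ)) * (r n / 2) * r n * (2 * |γ|) ^ 2
        * (1 / (n : ℝ))) atTop (𝓝 0) := by
      have := (((hone.mul (hr.div_const 2)).mul hr).mul_const ((2 * |γ|) ^ 2)).mul
        (tendsto_one_div_atTop_nhds_zero_nat (𝕜 := ℝ))
      simpa using this
    have hsmall : ∀ᶠ n : ℕ in atTop, (√(n : ℝ))⁻¹ * (2 * |γ|) < 1 := by
      have := tendsto_inv_sqrt_natCast.mul_const (2 * |γ|)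
      rw [zero_mul] at this
      exact this.eventually (gt_mem_nhds one_pos)
    refine squeeze_zero_norm' ?_ hb
    filter_upwards [eventually_gt_atTop 0, hNp, hsmall] with n hn hNpn hsm
    have hn1 : (0 : ℝ) < n := by exact_mod_cast hn
    have hnormE : ‖exp (-(I * (√(n : ℝ) * (γ * r n) : ℝ)))‖ = 1 := by
      have : -(I * ((√(n : ℝ) * (γ * r n) : ℝ) : ℂ)) = I * (-(√(n : ℝ) * (γ * r n)) : ℝ) := by
        push_cast; ring
      rw [this, Complex.norm_exp_I_mul_ofReal]
    have hz1 : ‖z n‖ ≤ 1 := (hzn n).trans (mul_le_one₀ (hp n).2 (by positivity) hsm.le)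
    have ha : ‖1 + z n‖ ≤ 1 := by
      have : 1 + z n = (1 - p n : ℝ) + p n * exp (I * ((√(n : ℝ))⁻¹ * (2 * γ) : ℝ)) := by
        rw [hz]; push_cast; ring
      rw [this]
      refine (norm_add_le _ _).trans ?_
      rw [norm_mul, Complex.norm_exp_I_mul_ofReal, Complex.norm_real, Complex.norm_real,
        Real.norm_of_nonneg (hp n).1, Real.norm_of_nonneg (sub_nonneg.2 (hp n).2)]
      linarith
    have hbd : ‖exp (z n)‖ ≤ 1 := by
      rw [Complex.norm_exp, Real.exp_le_one_iff]
      have h1 : (1 + z n).re ≤ 1 := (Complex.re_le_norm _).trans ha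
      simpa using h1
    have hpow : ∀ N : ℕ, ‖(1 + z n) ^ N - exp (z n) ^ N‖ ≤ N * ‖1 + z n - exp (z n)‖ := fun N => by
      induction N with
      | zero => simp
      | succ N ih =>
        have : (1 + z n) ^ (N + 1) - exp (z n) ^ (N + 1) = (1 + z n) ^ N * (1 + z n - exp (z n))
            + ((1 + z n) ^ N - exp (z n) ^ N) * exp (z n) := by ring
        rw [this]
        refine (norm_add_le _ _).trans ?_
        rw [norm_mul, norm_mul, norm_pow]
        have h1 : ‖1 + z n‖ ^ N ≤ 1 := pow_le_one₀ (norm_nonneg _) ha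
        push_cast
        nlinarith [mul_le_of_le_one_left (norm_nonneg (1 + z n - exp (z n))) h1,
          mul_le_of_le_one_right (norm_nonneg ((1 + z n) ^ N - exp (z n) ^ N)) hbd]
    rw [norm_mul, hnormE, one_mul]
    calc _ ≤ (n.choose 2 : ℝ) * ‖1 + z n - exp (z n)‖ := hpow _
      _ ≤ n.choose 2 * (p n * ((√(n : ℝ))⁻¹ * (2 * |γ|))) ^ 2 := by
          refine mul_le_mul_of_nonneg_left ?_ (Nat.cast_nonneg _)
          have h1 := norm_exp_sub_one_sub_id_le hz1
          rw [norm_sub_rev, ← sub_sub]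
          exact h1.trans (pow_le_pow_left₀ (norm_nonneg _) (hzn n) 2)
      _ = (n.choose 2 * p n) * p n * (2 * |γ|) ^ 2 * ((√(n : ℝ))⁻¹) ^ 2 := by ring
      _ = _ := by
          rw [hNpn, inv_pow, Real.sq_sqrt hn1.le, hpr n hn]
          field_simp
  have hexp : Tendsto (fun n : ℕ => exp (-(I * (√(n : ℝ) * (γ * r n) : ℝ))) * exp (z n) ^ n.choose 2)
      atTop (𝓝 (exp (-(s * γ ^ 2 : ℝ)))) := by
    have h1 := tendsto_mul_exp_sub_one_sub (tendsto_const_nhds (x := 2 * γ))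
    have h2 : Tendsto (fun n : ℕ => (((1 - 1 / (n : ℝ)) * (r n / 2) : ℝ) : ℂ)) atTop
        (𝓝 (((1 * (s / 2) : ℝ)) : ℂ)) :=
      (continuous_ofReal.tendsto _).comp (hone.mul (hr.div_const 2))
    have h3 : Tendsto (fun n : ℕ => I * ((-(γ * r n * (√(n : ℝ))⁻¹) : ℝ) : ℂ)) atTop
        (𝓝 (I * (0 : ℝ))) := by
      refine ((continuous_ofReal.tendsto _).comp ?_).const_mul I
      have := ((hr.const_mul γ).mul tendsto_inv_sqrt_natCast).neg
      simpa using this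
    have h4 := (continuous_exp.tendsto _).comp ((h2.mul h1).add h3)
    have h5 : ((1 * (s / 2) : ℝ) : ℂ) * (-((2 * γ) ^ 2 : ℝ) / 2) + I * (0 : ℝ) = -(s * γ ^ 2 : ℝ) := by
      push_cast; ring
    rw [h5] at h4
    refine h4.congr' ?_
    filter_upwards [eventually_gt_atTop 0, hNp] with n hn hNpn
    have hn1 : (0 : ℝ) < n := by exact_mod_cast hn
    have hsq : √(n : ℝ) ≠ 0 := (Real.sqrt_pos.2 hn1).ne'
    have hNpc : (n.choose 2 : ℂ) * p n = (((1 - 1 / (n : ℝ)) * (r n / 2) * n : ℝ) : ℂ) := by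
      rw [← hNpn]; push_cast; rfl
    have h6 : (1 - 1 / (n : ℝ)) * (r n / 2) * n * ((√(n : ℝ))⁻¹ * (2 * γ))
        = √(n : ℝ) * (γ * r n) + -(γ * r n * (√(n : ℝ))⁻¹) := by
      have h7 : √(n : ℝ) ^ 2 = n := Real.sq_sqrt hn1.le
      field_simp
      rw [h7]
      ring
    simp only [Function.comp_apply]
    rw [← Complex.exp_nat_mul, ← Complex.exp_add, hz]
    congr 1
    simp only
    rw [← mul_assoc (n.choose 2 : ℂ), hNpc]
    have h8 : (((1 - 1 / (n : ℝ)) * (r n / 2) * n : ℝ) : ℂ) * (((√(n : ℝ))⁻¹ * (2 * γ) : ℝ) : ℂ)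
        = ((√(n : ℝ) * (γ * r n) : ℝ) : ℂ) + ((-(γ * r n * (√(n : ℝ))⁻¹) : ℝ) : ℂ) := by
      exact_mod_cast h6
    have h9 : (((1 - 1 / (n : ℝ)) * (r n / 2) : ℝ) : ℂ) * n
        = (((1 - 1 / (n : ℝ)) * (r n / 2) * n : ℝ) : ℂ) := by push_cast; ring
    rw [← mul_assoc, h9]
    linear_combination (-I) * h8
  have := hdiff.add hexp
  rw [zero_add] at this
  refine this.congr fun n => by ring

/-- The limit of the characteristic functions for the binomial random graph: its number of edges is
random, and its fluctuations contribute through the derivative of the Poisson mean. -/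
theorem tendsto_binomial_mixture {r : ℕ → ℝ} {s : ℝ} (hs : 0 < s) (hr : Tendsto r atTop (𝓝 s))
    {p : ℕ → ℝ} (hp : ∀ n, p n ∈ Set.Icc (0 : ℝ) 1) (hpr : ∀ n : ℕ, 0 < n → p n = r n / n)
    {f : ℕ → ℝ} (hf : ExpGrowth f) :
    Tendsto (fun n : ℕ => ∑ j ∈ Finset.range (n.choose 2 + 1), (binomialProb (n.choose 2) (p n) j : ℂ)
      * degreeCharFun n j f (n * poissonAvg (r n) f)) atTop
      (𝓝 (exp (-(residualVariance s f + 2 * (poissonCovId s f ^ 2 / s) : ℝ) / 2))) := by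
  set γ := s⁻¹ * poissonCovId s f with hγ
  set θ : ℂ := exp (-(residualVariance s f : ℝ) / 2) with hθ
  set x : ℕ → ℕ → ℝ := fun n j => 2 * (j : ℝ) / n - r n with hx
  -- `B` bounds the difference of a characteristic function and its limit, and `c` the second moment
  -- of `√n x`.
  set B : ℝ := 1 + ‖θ‖ with hB
  set c : ℝ := 2 * (s + 1) + (s + 1) ^ 2 with hc
  have hderiv : HasStrictDerivAt (fun x => poissonAvg x f) γ s := hasStrictDerivAt_poissonAvg hs hf
  have hr1 : ∀ᶠ n in atTop, r n < s + 1 := hr.eventually (gt_mem_nhds (lt_add_one s))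
  have hr0 : ∀ᶠ n in atTop, 0 < r n := hr.eventually (lt_mem_nhds hs)
  have hrn : ∀ n : ℕ, 0 < n → (n.choose 2 : ℝ) * p n = (n - 1) * r n / 2 := fun n hn => by
    have hn1 : (n : ℝ) ≠ 0 := by exact_mod_cast hn.ne'
    rw [Nat.cast_choose_two, hpr n hn]
    field_simp
  -- The number of edges is within `O(n ^ (1/2))` of its mean.
  have hvar : ∀ᶠ n : ℕ in atTop, n * ∑ j ∈ Finset.range (n.choose 2 + 1),
      binomialProb (n.choose 2) (p n) j * x n j ^ 2 ≤ c := by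
    filter_upwards [eventually_gt_atTop 0, hr1, hr0] with n hn h1 h0
    have hn1 : (1 : ℝ) ≤ n := by exact_mod_cast hn
    have hn0 : (0 : ℝ) < n := by linarith
    have h2 : ∀ j : ℕ, binomialProb (n.choose 2) (p n) j * x n j ^ 2
        = 4 / (n : ℝ) ^ 2 * (binomialProb (n.choose 2) (p n) j * (j - n * r n / 2) ^ 2) := fun j => by
      rw [hx]
      field_simp
      ring
    simp_rw [h2]
    rw [← Finset.mul_sum, sum_binomialProb_mul_sub_sq, hrn n hn]
    have h3 : (n - 1) * r n / 2 * (1 - p n) ≤ n * r n / 2 := by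
      have h5 : 0 ≤ (n - 1) * r n / 2 := by
        have : 0 ≤ (n : ℝ) - 1 := by linarith
        positivity
      have h6 := mul_le_of_le_one_right h5 (by linarith [(hp n).1] : 1 - p n ≤ 1)
      nlinarith
    have h4 : r n ^ 2 ≤ n * (s + 1) ^ 2 := by nlinarith
    rw [← mul_assoc, show (n : ℝ) * (4 / n ^ 2) = 4 / n by field_simp, div_mul_eq_mul_div,
      div_le_iff₀ hn0, hc]
    nlinarith
  -- A sequence `m` realising the worst case in a window that carries almost all the mass.
  set Wn : ℕ → Finset ℕ := fun n =>
    (Finset.range (n.choose 2 + 1)).filter fun j => √(n : ℝ) * x n j ^ 2 ≤ 1 with hWn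
  set ψ : ℕ → ℕ → ℝ := fun n j => ‖degreeCharFun n j f (n * poissonAvg (2 * (j : ℝ) / n) f) - θ‖
    with hψ
  have hm : ∀ n, ∃ m, m ≤ n.choose 2 ∧ ((Wn n).Nonempty → m ∈ Wn n ∧ ∀ j ∈ Wn n, ψ n j ≤ ψ n m) :=
    fun n => by
    by_cases h : (Wn n).Nonempty
    · obtain ⟨m, hm1, hm2⟩ := Finset.exists_max_image (Wn n) (ψ n) h
      have := Finset.mem_range.1 (Finset.mem_filter.1 hm1).1
      exact ⟨m, by omega, fun _ => ⟨hm1, hm2⟩⟩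
    · exact ⟨0, Nat.zero_le _, fun h' => absurd h' h⟩
  choose m hmN hmW using hm
  have hne : ∀ᶠ n in atTop, (Wn n).Nonempty := by
    filter_upwards [eventually_gt_atTop 0, hr1, hr0,
      tendsto_natCast_atTop_atTop.eventually_ge_atTop ((s + 3) ^ 2)] with n hn h1 h0 h2
    have hn1 : (1 : ℝ) ≤ n := by exact_mod_cast hn
    have hn0 : (0 : ℝ) < n := by linarith
    have h3 : (0 : ℝ) ≤ n.choose 2 * p n := mul_nonneg (Nat.cast_nonneg _) (hp n).1
    have h4 := Nat.floor_le h3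
    have h5 := Nat.lt_floor_add_one ((n.choose 2 : ℝ) * p n)
    refine ⟨⌊(n.choose 2 : ℝ) * p n⌋₊, Finset.mem_filter.2 ⟨Finset.mem_range.2 ?_, ?_⟩⟩
    · refine Nat.lt_succ_of_le ?_
      have : ((⌊(n.choose 2 : ℝ) * p n⌋₊ : ℕ) : ℝ) ≤ n.choose 2 :=
        h4.trans (mul_le_of_le_one_right (Nat.cast_nonneg _) (hp n).2)
      exact_mod_cast this
    · set q := ((⌊(n.choose 2 : ℝ) * p n⌋₊ : ℕ) : ℝ) with hq
      rw [hrn n hn] at h4 h5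
      have h6 : (n * x n ⌊(n.choose 2 : ℝ) * p n⌋₊) ^ 2 ≤ (s + 3) ^ 2 := by
        have : n * x n ⌊(n.choose 2 : ℝ) * p n⌋₊ = 2 * q - n * r n := by
          rw [hx]; field_simp; rfl
        rw [this]
        refine sq_le_sq' ?_ ?_ <;> nlinarith
      have h7 : √(n : ℝ) ≤ n := by
        rw [Real.sqrt_le_left hn0.le]; nlinarith
      have h8 : √(n : ℝ) * (n * x n ⌊(n.choose 2 : ℝ) * p n⌋₊) ^ 2 ≤ n * n :=
        mul_le_mul h7 (h6.trans h2) (sq_nonneg _) hn0.le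
      rw [mul_pow] at h8
      have h9 : 0 < (n : ℝ) * n := by positivity
      nlinarith
  have hsqrt : Tendsto (fun n : ℕ => √(n : ℝ)) atTop atTop :=
    Real.tendsto_sqrt_atTop.comp tendsto_natCast_atTop_atTop
  have hwin : ∀ δ > 0, ∀ᶠ n in atTop, ∀ j ∈ Wn n, |x n j| < δ := fun δ hδ => by
    filter_upwards [hsqrt.eventually_gt_atTop (1 / δ ^ 2)] with n hn j hj
    have h1 := (Finset.mem_filter.1 hj).2
    refine lt_of_pow_lt_pow_left₀ 2 hδ.le ?_
    rw [sq_abs]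
    rw [div_lt_iff₀ (by positivity)] at hn
    by_contra hcon
    have h2 := mul_le_mul_of_nonneg_left (not_lt.1 hcon) (Real.sqrt_nonneg (n : ℝ))
    linarith
  have hmlim : Tendsto (fun n : ℕ => 2 * (m n : ℝ) / n) atTop (𝓝 s) := by
    have h1 : Tendsto (fun n => x n (m n)) atTop (𝓝 0) := by
      rw [Metric.tendsto_nhds]
      intro δ hδ
      filter_upwards [hwin δ hδ, hne] with n h1 h2
      simpa using h1 _ (hmW n h2).1
    have := h1.add hr
    rw [zero_add] at this
    exact this.congr fun n => by simp [hx]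
  have hψm : Tendsto (fun n => ψ n (m n)) atTop (𝓝 0) := by
    have h1 := tendsto_degreeCharFun hs (.of_forall hmN) hmlim hf
    have h2 := (h1.sub_const θ).norm
    rwa [sub_self, norm_zero] at h2
  -- Inside the window the characteristic function is its limit times the phase that comes from the
  -- change of centring; outside, Chebyshev's inequality bounds the mass.
  have hkey : Tendsto (fun n : ℕ => ∑ j ∈ Finset.range (n.choose 2 + 1),
      (binomialProb (n.choose 2) (p n) j : ℂ) * (degreeCharFun n j f (n * poissonAvg (r n) f)
        - exp (I * (√(n : ℝ) * (γ * x n j) : ℝ)) * θ)) atTop (𝓝 0) := by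
    rw [Metric.tendsto_nhds]
    intro η hη
    have hB0 : 0 < B := by positivity
    have hc0 : 0 < c := by positivity
    set ε := η / (2 * (1 + B + B * c)) with hε
    have hε0 : 0 < ε := by positivity
    have hlo := hderiv.isLittleO.def hε0
    rw [Metric.eventually_nhds_iff] at hlo
    obtain ⟨δ, hδ, hlo⟩ := hlo
    filter_upwards [hψm.eventually (gt_mem_nhds hε0), hwin (δ / 2) (by positivity), hne, hvar,
      eventually_gt_atTop 0, (Metric.tendsto_nhds.1 hr) (δ / 2) (by positivity),
      hsqrt.eventually_gt_atTop (2 * (B * c) / η)] with n h1 h2 h3 h4 hn h5 h6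
    have hn0 : (0 : ℝ) < n := by exact_mod_cast hn
    have hsq0 : 0 < √(n : ℝ) := Real.sqrt_pos.2 hn0
    have hsq : √(n : ℝ) * √(n : ℝ) = n := Real.mul_self_sqrt hn0.le
    have hinv : (√(n : ℝ))⁻¹ * n = √(n : ℝ) := by rw [inv_mul_eq_iff_eq_mul₀ hsq0.ne', hsq]
    have hterm : ∀ j ∈ Finset.range (n.choose 2 + 1), ‖degreeCharFun n j f (n * poissonAvg (r n) f)
        - exp (I * (√(n : ℝ) * (γ * x n j) : ℝ)) * θ‖
        ≤ ε + B * ε + (B * ε * n + B * √(n : ℝ)) * x n j ^ 2 := by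
      intro j hj
      by_cases hjW : j ∈ Wn n
      · have hψj : ψ n j ≤ ε := ((hmW n h3).2 j hjW).trans h1.le
        have hxj := h2 j hjW
        rw [degreeCharFun_shift n j f _ (n * poissonAvg (2 * (j : ℝ) / n) f)]
        set E1 := exp (I * ((√(n : ℝ))⁻¹ * (n * poissonAvg (2 * (j : ℝ) / n) f
          - n * poissonAvg (r n) f) : ℝ)) with hE1
        set E2 := exp (I * (√(n : ℝ) * (γ * x n j) : ℝ)) with hE2
        have hE : ‖E1 - E2‖ ≤ ε * (1 + n * x n j ^ 2) := by
          have e1 : E1 - E2 = E2 * (exp (I * (√(n : ℝ) * (poissonAvg (2 * (j : ℝ) / n) f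
              - poissonAvg (r n) f - γ * x n j) : ℝ)) - 1) := by
            rw [mul_sub E2, mul_one, hE1, hE2, ← Complex.exp_add]
            congr 2
            have : (√(n : ℝ))⁻¹ * (n * poissonAvg (2 * (j : ℝ) / n) f - n * poissonAvg (r n) f)
                = √(n : ℝ) * (γ * x n j) + √(n : ℝ) * (poissonAvg (2 * (j : ℝ) / n) f
                  - poissonAvg (r n) f - γ * x n j) := by
              rw [← mul_sub, ← mul_assoc, hinv]
              ring
            rw [this]
            push_cast
            ring
          rw [e1, norm_mul, hE2, Complex.norm_exp_I_mul_ofReal, one_mul]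
          refine Real.norm_exp_I_mul_ofReal_sub_one_le.trans ?_
          rw [norm_mul, Real.norm_of_nonneg hsq0.le]
          have hdist : dist ((2 * (j : ℝ) / n, r n) : ℝ × ℝ) (s, s) < δ := by
            rw [Prod.dist_eq, max_lt_iff]
            refine ⟨?_, by linarith⟩
            have : 2 * (j : ℝ) / n - s = x n j + (r n - s) := by rw [hx]; ring
            rw [Real.dist_eq, this]
            rw [Real.dist_eq] at h5
            exact (abs_add_le _ _).trans_lt (by linarith)
          have hl := hlo hdist
          simp only [ContinuousLinearMap.toSpanSingleton_apply, smul_eq_mul] at hl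
          rw [mul_comm (2 * (j : ℝ) / n - r n) γ] at hl
          calc _ ≤ √(n : ℝ) * (ε * |x n j|) := by
                exact mul_le_mul_of_nonneg_left hl hsq0.le
            _ = ε * (√(n : ℝ) * |x n j|) := by ring
            _ ≤ ε * (1 + n * x n j ^ 2) := by
                refine mul_le_mul_of_nonneg_left ?_ hε0.le
                have h10 : n * x n j ^ 2 = (√(n : ℝ) * |x n j|) ^ 2 := by
                  rw [mul_pow, sq_abs, sq (√(n : ℝ)), hsq]
                rw [h10]
                nlinarith [sq_nonneg (√(n : ℝ) * |x n j| - 1)]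
        have e2 : E1 * degreeCharFun n j f (n * poissonAvg (2 * (j : ℝ) / n) f) - E2 * θ
            = E1 * (degreeCharFun n j f (n * poissonAvg (2 * (j : ℝ) / n) f) - θ)
              + (E1 - E2) * θ := by ring
        rw [e2]
        refine (norm_add_le _ _).trans ?_
        rw [norm_mul, norm_mul, hE1, Complex.norm_exp_I_mul_ofReal, one_mul, ← hE1]
        have h7 : ‖E1 - E2‖ * ‖θ‖ ≤ ε * (1 + n * x n j ^ 2) * B :=
          mul_le_mul hE (by linarith) (norm_nonneg _) (by positivity)
        have h8 : 0 ≤ B * √(n : ℝ) * x n j ^ 2 := by positivity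
        have h9 : ‖degreeCharFun n j f (n * poissonAvg (2 * (j : ℝ) / n) f) - θ‖ ≤ ε := hψj
        linarith
      · have h7 : 1 < √(n : ℝ) * x n j ^ 2 := by
          by_contra hcon
          exact hjW (Finset.mem_filter.2 ⟨hj, not_lt.1 hcon⟩)
        refine (norm_sub_le _ _).trans ?_
        rw [norm_mul, Complex.norm_exp_I_mul_ofReal, one_mul]
        have h8 := norm_degreeCharFun_le n j f (n * poissonAvg (r n) f)
        have h9 : 0 ≤ ε + B * ε + B * ε * n * x n j ^ 2 := by positivity
        have h10 := mul_le_mul_of_nonneg_left h7.le hB0.le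
        linarith
    rw [dist_zero_right]
    calc _ ≤ ∑ j ∈ Finset.range (n.choose 2 + 1), binomialProb (n.choose 2) (p n) j *
            (ε + B * ε + (B * ε * n + B * √(n : ℝ)) * x n j ^ 2) := by
          refine norm_sum_le_of_le _ fun j hj => ?_
          have hb := binomialProb_nonneg (hp n) (n.choose 2) j
          rw [norm_mul, Complex.norm_real, Real.norm_of_nonneg hb]
          exact mul_le_mul_of_nonneg_left (hterm j hj) hb
      _ = ε + B * ε + (B * ε + B * (√(n : ℝ))⁻¹) * (n * ∑ j ∈ Finset.range (n.choose 2 + 1),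
            binomialProb (n.choose 2) (p n) j * x n j ^ 2) := by
          have h7 : ∀ j : ℕ, binomialProb (n.choose 2) (p n) j *
              (ε + B * ε + (B * ε * n + B * √(n : ℝ)) * x n j ^ 2)
              = (ε + B * ε) * binomialProb (n.choose 2) (p n) j + (B * ε * n + B * √(n : ℝ)) *
                (binomialProb (n.choose 2) (p n) j * x n j ^ 2) := fun j => by ring
          simp_rw [h7]
          rw [Finset.sum_add_distrib, ← Finset.mul_sum, ← Finset.mul_sum, sum_binomialProb, mul_one,
            ← mul_assoc]
          congr 2
          linear_combination (-B) * hinv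
      _ ≤ ε + B * ε + (B * ε + B * (√(n : ℝ))⁻¹) * c := by gcongr
      _ = ε * (1 + B + B * c) + (B * c) / √(n : ℝ) := by ring
      _ < η / 2 + η / 2 := by
          have h7 : ε * (1 + B + B * c) = η / 2 := by rw [hε]; field_simp
          have h8 : B * c / √(n : ℝ) < η / 2 := by
            rw [div_lt_iff₀ hη] at h6
            rw [div_lt_iff₀ hsq0]
            linarith
          linarith
      _ = η := by ring
  have hbin := (tendsto_binomial_charFun hr hp hpr γ).mul_const θ
  have hfin := hkey.add hbin
  have hval : 0 + exp (-(s * γ ^ 2 : ℝ)) * θ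
      = exp (-(residualVariance s f + 2 * (poissonCovId s f ^ 2 / s) : ℝ) / 2) := by
    rw [zero_add, hθ, ← Complex.exp_add]
    congr 1
    have : s * γ ^ 2 = poissonCovId s f ^ 2 / s := by rw [hγ]; field_simp
    rw [this]
    push_cast
    ring
  rw [hval] at hfin
  refine hfin.congr fun n => ?_
  rw [Finset.sum_mul, ← Finset.sum_add_distrib]
  refine Finset.sum_congr rfl fun j _ => ?_
  ring

end Binomial

/-! ### Degree statistics of the random graphs `G(n, m)` and `G(n, p)` -/

section DegreeStatistics

attribute [local instance] measurableSingletonClass_simpleGraph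

open Classical in
theorem ncard_neighborSet_eq_edgeDegree {n : ℕ} (G : SimpleGraph (Fin n)) (v : Fin n) :
    (G.neighborSet v).ncard = edgeDegree G.edgeFinset v := by
  rw [edgeDegree, ← incidenceFinset_eq_filter, card_incidenceFinset_eq_degree,
    Set.ncard_eq_toFinset_card', ← card_neighborSet_eq_degree, Set.toFinset_card]

/-- A linear combination of the degree counts, rewritten as a sum over the vertices. -/
theorem hasSum_mul_degreeCount {n : ℕ} (G : SimpleGraph (Fin n)) (a : ℕ → ℝ) :
    HasSum (fun k => a k * (degreeCount G k : ℝ)) (∑ v, a ((G.neighborSet v).ncard)) := by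
  have h : ∀ k, a k * (degreeCount G k : ℝ)
      = ∑ v : Fin n, if k = (G.neighborSet v).ncard then a ((G.neighborSet v).ncard) else 0 := by
    intro k
    classical
    have : degreeCount G k = (Finset.univ.filter fun v => k = (G.neighborSet v).ncard).card := by
      rw [degreeCount, ← Set.ncard_coe_finset]
      congr 1
      ext v
      simp [eq_comm]
    rw [this, Finset.natCast_card_filter, Finset.mul_sum]
    refine Finset.sum_congr rfl fun v _ => ?_
    split_ifs with h <;> simp [h]
  simp_rw [h]
  exact hasSum_sum fun v _ => hasSum_ite_eq _ _

open Classical in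
theorem sum_simpleGraph_eq {n : ℕ} (Φ : Finset (Sym2 (Fin n)) → ℂ) :
    ∑ G : SimpleGraph (Fin n), Φ G.edgeFinset = ∑ s ∈ (allEdges (Fin n)).powerset, Φ s := by
  refine Finset.sum_bij (fun G _ => G.edgeFinset) (fun G _ => ?_) (fun G _ H _ h => ?_)
    (fun s hs => ?_) (fun _ _ => rfl)
  · rw [Finset.mem_powerset]
    intro e he
    simpa [allEdges] using G.not_isDiag_of_mem_edgeSet (mem_edgeFinset.1 he)
  · exact edgeFinset_inj.1 h
  · refine ⟨fromEdgeSet (s : Set (Sym2 (Fin n))), Finset.mem_univ _, ?_⟩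
    ext e
    rw [← Finset.mem_coe, coe_edgeFinset, edgeSet_fromEdgeSet]
    simp only [Set.mem_sdiff, Finset.mem_coe]
    refine ⟨fun h => h.1, fun h => ⟨h, ?_⟩⟩
    have := Finset.mem_powerset.1 hs h
    simpa [allEdges] using this

/-- The integral with respect to a random graph whose law depends on the number of edges only, as
a mixture of averages over the edge sets of a given size. -/
theorem integral_eq_sum_uniformAvg {n : ℕ} (μ : ProbabilityMeasure (SimpleGraph (Fin n)))
    {w : ℕ → ℝ} (hw : ∀ G, (μ : Measure (SimpleGraph (Fin n))).real {G} = w G.edgeSet.ncard)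
    (Φ : (Fin n → ℕ) → ℂ) :
    ∫ G, Φ (fun v => (G.neighborSet v).ncard) ∂(μ : Measure (SimpleGraph (Fin n)))
      = ∑ j ∈ Finset.range (n.choose 2 + 1), (((n.choose 2).choose j : ℝ) * w j : ℝ) *
          uniformAvg (allEdges (Fin n)) j fun s => Φ (edgeDegree s) := by
  classical
  rw [integral_fintype .of_finite]
  have h : ∀ G : SimpleGraph (Fin n), (μ : Measure (SimpleGraph (Fin n))).real {G} •
      Φ (fun v => (G.neighborSet v).ncard)
      = (fun s : Finset (Sym2 (Fin n)) => w s.card • Φ (edgeDegree s)) G.edgeFinset := by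
    intro G
    have h1 : (fun v => (G.neighborSet v).ncard) = edgeDegree G.edgeFinset := by
      ext v; rw [ncard_neighborSet_eq_edgeDegree]
    rw [h1, hw, ← coe_edgeFinset, Set.ncard_coe_finset]
  simp_rw [h]
  refine (sum_simpleGraph_eq fun s => w s.card • Φ (edgeDegree s)).trans ?_
  rw [Finset.sum_powerset, card_allEdges_fin]
  refine Finset.sum_congr rfl fun j hj => ?_
  have hj' : (((n.choose 2).choose j : ℕ) : ℝ) ≠ 0 := by
    have := Nat.choose_pos (Finset.mem_range_succ_iff.1 hj)
    positivity
  rw [uniformAvg, card_allEdges_fin, ← Complex.real_smul, smul_smul, mul_assoc, mul_comm, mul_assoc,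
    inv_mul_cancel₀ hj', mul_one, Finset.smul_sum]
  exact Finset.sum_congr rfl fun s hs => by rw [(Finset.mem_powersetCard.1 hs).2]

/-- The characteristic function of the centred and normalised sum of `f` over the degrees. -/
theorem integral_exp_eq_sum_degreeCharFun {n : ℕ} (μ : ProbabilityMeasure (SimpleGraph (Fin n)))
    {w : ℕ → ℝ} (hw : ∀ G, (μ : Measure (SimpleGraph (Fin n))).real {G} = w G.edgeSet.ncard)
    (f : ℕ → ℝ) (b : ℝ) :
    ∫ G, Complex.exp (Complex.I * ((√(n : ℝ))⁻¹ * (∑ v, f ((G.neighborSet v).ncard) - b) : ℝ))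
        ∂(μ : Measure (SimpleGraph (Fin n)))
      = ∑ j ∈ Finset.range (n.choose 2 + 1), (((n.choose 2).choose j : ℝ) * w j : ℝ) *
          degreeCharFun n j f b :=
  integral_eq_sum_uniformAvg μ hw fun d =>
    Complex.exp (Complex.I * ((√(n : ℝ))⁻¹ * (∑ v, f (d v) - b) : ℝ))

theorem gnp_real_singleton (n : ℕ) (p : unitInterval) (G : SimpleGraph (Fin n)) :
    (gnp n p : Measure (SimpleGraph (Fin n))).real {G}
      = (p : ℝ) ^ G.edgeSet.ncard * (1 - (p : ℝ)) ^ (n.choose 2 - G.edgeSet.ncard) := by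
  change (SimpleGraph.binomialRandom (Fin n) p).real {G} = _
  rw [measureReal_def, binomialRandom_singleton]
  simp

theorem integral_gnp (n : ℕ) (p : unitInterval) (f : ℕ → ℝ) (b : ℝ) :
    ∫ G, Complex.exp (Complex.I * ((√(n : ℝ))⁻¹ * (∑ v, f ((G.neighborSet v).ncard) - b) : ℝ))
        ∂(gnp n p : Measure (SimpleGraph (Fin n)))
      = ∑ j ∈ Finset.range (n.choose 2 + 1),
          (binomialProb (n.choose 2) p j : ℂ) * degreeCharFun n j f b := by
  rw [integral_exp_eq_sum_degreeCharFun (gnp n p)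
    (w := fun j => (p : ℝ) ^ j * (1 - (p : ℝ)) ^ (n.choose 2 - j)) (gnp_real_singleton n p)]
  exact Finset.sum_congr rfl fun j _ => by rw [binomialProb, mul_assoc]

theorem integral_gnm (n m : ℕ) (h : m ≤ n.choose 2) (f : ℕ → ℝ) (b : ℝ) :
    ∫ G, Complex.exp (Complex.I * ((√(n : ℝ))⁻¹ * (∑ v, f ((G.neighborSet v).ncard) - b) : ℝ))
        ∂(gnm n m h : Measure (SimpleGraph (Fin n)))
      = degreeCharFun n m f b := by
  -- The value of the uniform density is left unspecified: it is found by integrating `1`.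
  set c : ℝ := (Measure.count (graphsWithEdges n m)).toReal⁻¹ with hc
  let w : ℕ → ℝ := fun j => if j = m then c else 0
  have hw : ∀ G, (gnm n m h : Measure (SimpleGraph (Fin n))).real {G}
      = w G.edgeSet.ncard := by
    intro G
    change (uniformOn (graphsWithEdges n m)).real {G} = _
    rw [measureReal_def, uniformOn, cond_apply (Set.toFinite _).measurableSet]
    by_cases hG : G.edgeSet.ncard = m
    · rw [Set.inter_eq_self_of_subset_right (by simpa [graphsWithEdges] using hG)]
      simp [w, hG, hc]
    · rw [Set.inter_singleton_eq_empty.2 (by simpa [graphsWithEdges] using hG)]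
      simp [w, hG]
  have hm : m ∈ Finset.range (n.choose 2 + 1) := Finset.mem_range_succ_iff.2 h
  have hsum : ∀ F : ℕ → ℂ, ∑ j ∈ Finset.range (n.choose 2 + 1),
      (((n.choose 2).choose j : ℝ) * w j : ℝ) * F j
      = (((n.choose 2).choose m : ℝ) * c : ℝ) * F m := by
    intro F
    rw [Finset.sum_eq_single_of_mem m hm fun j _ hj => by simp [w, hj]]
    simp only [w, if_pos]
  have h1 := integral_eq_sum_uniformAvg (gnm n m h) hw fun _ => 1
  have h2 : uniformAvg (allEdges (Fin n)) m (fun _ => (1 : ℂ)) = 1 := by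
    have : ((((n.choose 2).choose m : ℕ) : ℝ) : ℂ) ≠ 0 := by
      have := Nat.choose_pos h
      exact_mod_cast this.ne'
    rw [uniformAvg, Finset.sum_const, Finset.card_powersetCard, card_allEdges_fin, nsmul_eq_mul,
      mul_one, Complex.real_smul, Complex.ofReal_inv]
    exact inv_mul_cancel₀ this
  rw [hsum, h2, mul_one] at h1
  rw [integral_exp_eq_sum_degreeCharFun (gnm n m h) hw, hsum, ← h1]
  simp

end DegreeStatistics

/-! ### Construction of the limiting Gaussian sequences -/

section GaussianSeries

/-- The law of a sequence of independent standard normal variables. -/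
noncomputable def stdNormalSeq : Measure (ℕ → ℝ) := Measure.infinitePi fun _ => gaussianReal 0 1

instance : IsProbabilityMeasure stdNormalSeq := by unfold stdNormalSeq; infer_instance

/-- `stdNormalSeq` as a bundled probability measure. -/
noncomputable def stdNormalProb : ProbabilityMeasure (ℕ → ℝ) := ⟨stdNormalSeq, inferInstance⟩

theorem measurePreserving_eval_stdNormalSeq (j : ℕ) :
    MeasurePreserving (fun ω : ℕ → ℝ => ω j) stdNormalSeq (gaussianReal 0 1) :=
  measurePreserving_eval_infinitePi (fun _ : ℕ => gaussianReal 0 1) j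

theorem ae_summable_mul_stdNormalSeq {c : ℕ → ℝ} (hc : Summable fun j => |c j|) :
    ∀ᵐ ω ∂stdNormalSeq, Summable fun j => c j * ω j := by
  have hmom : ∀ j, ∫⁻ ω : ℕ → ℝ, ‖ω j‖ₑ ∂stdNormalSeq = ∫⁻ x, ‖x‖ₑ ∂gaussianReal 0 1 := fun j =>
    (measurePreserving_eval_stdNormalSeq j).lintegral_comp (f := fun x : ℝ => ‖x‖ₑ) (by fun_prop)
  have hfin : ∫⁻ x, ‖x‖ₑ ∂gaussianReal 0 1 ≠ ⊤ := by
    have h : Integrable id (gaussianReal 0 1) :=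
      memLp_one_iff_integrable.1 (by exact_mod_cast memLp_id_gaussianReal (μ := 0) (v := 1) 1)
    exact h.2.ne
  have hint : ∫⁻ ω, ∑' j, ‖c j * ω j‖ₑ ∂stdNormalSeq ≠ ⊤ := by
    rw [lintegral_tsum fun j => Measurable.aemeasurable (by fun_prop)]
    simp_rw [enorm_mul]
    have h1 : ∀ j, ∫⁻ ω : ℕ → ℝ, ‖c j‖ₑ * ‖ω j‖ₑ ∂stdNormalSeq
        = ‖c j‖ₑ * ∫⁻ x, ‖x‖ₑ ∂gaussianReal 0 1 := fun j => by
      rw [lintegral_const_mul _ (by fun_prop), hmom]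
    simp_rw [h1]
    rw [ENNReal.tsum_mul_right]
    refine ENNReal.mul_ne_top ?_ hfin
    exact ENNReal.tsum_coe_ne_top_iff_summable.2 (NNReal.summable_coe.1 hc)
  filter_upwards [ae_lt_top (by fun_prop) hint] with ω hω
  exact .of_norm (NNReal.summable_coe.2 (ENNReal.tsum_coe_ne_top_iff_summable.1 hω.ne))

theorem charFun_sum_mul_stdNormalSeq (c : ℕ → ℝ) (s : Finset ℕ) (t : ℝ) :
    charFun (stdNormalSeq.map fun ω => ∑ j ∈ s, c j * ω j) t
      = Complex.exp (-(((∑ j ∈ s, c j ^ 2 : ℝ) : ℂ) * t ^ 2 / 2)) := by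
  have hind : iIndepFun (fun (j : ℕ) (ω : ℕ → ℝ) => c j * ω j) stdNormalSeq :=
    iIndepFun_infinitePi (P := fun _ => gaussianReal 0 1) (X := fun j x => c j * x)
      fun j => by fun_prop
  rw [iIndepFun.charFun_map_fun_finsetSum_eq_prod
    (fun j _ => Measurable.aemeasurable (by fun_prop)) (hind.restrict s),
    Finset.prod_apply]
  have h : ∀ j, charFun (stdNormalSeq.map fun ω : ℕ → ℝ => c j * ω j) t
      = Complex.exp (-((c j ^ 2 : ℝ) * t ^ 2 / 2)) := by
    intro j
    have h1 : stdNormalSeq.map (fun ω : ℕ → ℝ => c j * ω j)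
        = (gaussianReal 0 1).map fun x => c j * x := by
      rw [← (measurePreserving_eval_stdNormalSeq j).map_eq, Measure.map_map (by fun_prop)
        (by fun_prop)]
      rfl
    rw [h1, gaussianReal_map_const_mul, charFun_gaussianReal]
    congr 1
    push_cast
    simp
  simp_rw [h]
  rw [← Complex.exp_sum]
  congr 1
  push_cast
  rw [Finset.sum_neg_distrib, Finset.sum_mul, Finset.sum_div]

/-- An absolutely summable series of independent normal variables has a normal law. -/
theorem hasLaw_tsum_mul_stdNormalSeq {c : ℕ → ℝ} (hc : Summable fun j => |c j|) {v : NNReal}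
    (hv : HasSum (fun j => c j ^ 2) (v : ℝ)) :
    HasLaw (fun ω => ∑' j, c j * ω j) (gaussianReal 0 v) stdNormalSeq := by
  have hconv : ∀ᵐ ω ∂stdNormalSeq,
      Tendsto (fun s : Finset ℕ => ∑ j ∈ s, c j * ω j) atTop (𝓝 (∑' j, c j * ω j)) := by
    filter_upwards [ae_summable_mul_stdNormalSeq hc] with ω hω using hω.hasSum
  have hmeas : AEMeasurable (fun ω : ℕ → ℝ => ∑' j, c j * ω j) stdNormalSeq :=
    aemeasurable_of_tendsto_metrizable_ae atTop
      (fun s : Finset ℕ => Measurable.aemeasurable (by fun_prop)) hconv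
  have := Measure.isProbabilityMeasure_map hmeas
  refine ⟨hmeas, Measure.ext_of_charFun ?_⟩
  ext t
  have h1 : Tendsto (fun s : Finset ℕ => ∫ ω : ℕ → ℝ,
        Complex.exp (t * (∑ j ∈ s, c j * ω j : ℝ) * Complex.I) ∂stdNormalSeq) atTop
      (𝓝 (∫ ω : ℕ → ℝ, Complex.exp (t * (∑' j, c j * ω j : ℝ) * Complex.I) ∂stdNormalSeq)) := by
    refine tendsto_integral_filter_of_dominated_convergence (fun _ => 1)
      (.of_forall fun s => (Measurable.aestronglyMeasurable (by fun_prop)))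
      (.of_forall fun s => .of_forall fun ω => ?_) (integrable_const _) ?_
    · rw [← Complex.ofReal_mul, Complex.norm_exp_ofReal_mul_I]
    · filter_upwards [hconv] with ω hω
      exact ((Complex.continuous_exp.comp (by fun_prop : Continuous fun x : ℝ =>
        (t : ℂ) * (x : ℂ) * Complex.I)).tendsto _).comp hω
  have h2 : Tendsto (fun s : Finset ℕ => Complex.exp (-(((∑ j ∈ s, c j ^ 2 : ℝ) : ℂ) * t ^ 2 / 2)))
      atTop (𝓝 (Complex.exp (-((v : ℝ) * t ^ 2 / 2)))) :=
    ((Complex.continuous_exp.comp (by fun_prop : Continuous fun x : ℝ =>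
      -((x : ℂ) * (t : ℂ) ^ 2 / 2))).tendsto _).comp hv
  have h3 : ∀ s : Finset ℕ, ∫ ω : ℕ → ℝ,
      Complex.exp (t * (∑ j ∈ s, c j * ω j : ℝ) * Complex.I) ∂stdNormalSeq
      = Complex.exp (-(((∑ j ∈ s, c j ^ 2 : ℝ) : ℂ) * t ^ 2 / 2)) := by
    intro s
    rw [← charFun_sum_mul_stdNormalSeq, charFun_apply_real,
      integral_map (Measurable.aemeasurable (by fun_prop)) (Measurable.aestronglyMeasurable (by fun_prop))]
  simp_rw [h3] at h1
  rw [charFun_apply_real, integral_map hmeas (Measurable.aestronglyMeasurable (by fun_prop)),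
    tendsto_nhds_unique h1 h2, charFun_gaussianReal]
  congr 1
  push_cast
  simp

end GaussianSeries

section LimitSequence

/-- The variance of the limit of the normalised sum of `f` over the vertex degrees: `β = 0` for a
fixed number of edges, and `β = 1` for the binomial random graph. -/
noncomputable def limitVariance (β r : ℝ) (f : ℕ → ℝ) : ℝ :=
  residualVariance r f + β ^ 2 * (2 * (poissonCovId r f ^ 2 / r))

theorem limitVariance_const_mul (β r t : ℝ) (f : ℕ → ℝ) :
    limitVariance β r (fun k => t * f k) = t ^ 2 * limitVariance β r f := by
  have h : (fun k : ℕ => ((k : ℝ) - r) * (t * f k)) = fun k : ℕ => t * (((k : ℝ) - r) * f k) := by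
    ext k; ring
  unfold limitVariance
  rw [residualVariance_const_mul]
  unfold poissonCovId
  rw [h, poissonAvg_const_mul]
  ring

/-- Independent centred normal variables with the Poisson probabilities as variances. -/
noncomputable def poissonNoise (r : ℝ) (k : ℕ) (ω : ℕ → ℝ) : ℝ := √(poissonProb r k) * ω (k + 1)

/-- The limiting sequence: the residual of `poissonNoise` after regression on its total mass and on
its first moment, plus an independent multiple (coming from the random number of edges) of the
derivative of the Poisson probabilities. The two series converge almost surely; `β` is as in
`limitVariance`. -/
noncomputable def limitSeq (β r : ℝ) (k : ℕ) (ω : ℕ → ℝ) : ℝ :=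
  poissonNoise r k ω - poissonProb r k * (∑' j, poissonNoise r j ω)
    - poissonProb r k * ((k : ℝ) - r) * ((∑' j : ℕ, ((j : ℝ) - r) * poissonNoise r j ω) / r)
    + poissonProb r k * ((k : ℝ) - r) * (β * √(2 / r) * ω 0)

theorem ExpGrowth.summable_sqrt_poissonProb {f : ℕ → ℝ} (hf : ExpGrowth f) {r : ℝ} (hr : 0 ≤ r) :
    Summable fun k => |√(poissonProb r k) * f k| := by
  have h4 : ExpGrowth fun k : ℕ => (4 : ℝ) ^ k :=
    ⟨1, 4, by norm_num, by norm_num, fun k => by simp⟩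
  have h1 := ((h4.mul (hf.mul hf)).hasSum' r).summable
  have h2 : Summable fun k : ℕ => ((1 : ℝ) / 4) ^ k :=
    summable_geometric_of_lt_one (by norm_num) (by norm_num)
  refine (h1.add h2).of_nonneg_of_le (fun _ => abs_nonneg _) fun k => ?_
  have hp := poissonProb_nonneg hr k
  -- The inequality of arithmetic and geometric means, after splitting off `2 ^ k * 2 ^ (-k)`.
  have h5 : |√(poissonProb r k) * f k| = (√(poissonProb r k) * |f k| * 2 ^ k) * (1 / 2) ^ k := by
    rw [mul_assoc, ← mul_pow, abs_mul, abs_of_nonneg (Real.sqrt_nonneg _)]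
    norm_num
  have h6 : (√(poissonProb r k) * |f k| * 2 ^ k) ^ 2 = poissonProb r k * (4 ^ k * (f k * f k)) := by
    rw [mul_pow, mul_pow, Real.sq_sqrt hp, sq_abs, ← pow_mul, mul_comm k 2, pow_mul]
    norm_num
    ring
  have h7 : (((1 : ℝ) / 2) ^ k) ^ 2 = (1 / 4) ^ k := by
    rw [← pow_mul, mul_comm k 2, pow_mul]
    norm_num
  have h8 : 0 ≤ |√(poissonProb r k) * f k| := abs_nonneg _
  rw [h5] at h8 ⊢
  nlinarith [two_mul_le_add_sq (√(poissonProb r k) * |f k| * 2 ^ k) ((1 / 2 : ℝ) ^ k)]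

theorem ExpGrowth.ae_summable_poissonNoise {f : ℕ → ℝ} (hf : ExpGrowth f) {r : ℝ} (hr : 0 ≤ r) :
    ∀ᵐ ω ∂stdNormalSeq, Summable fun k => f k * poissonNoise r k ω := by
  have hc : Summable fun j => |Nat.casesOn (motive := fun _ => ℝ) j 0
      fun k => √(poissonProb r k) * f k| :=
    (summable_nat_add_iff 1).1 (hf.summable_sqrt_poissonProb hr)
  filter_upwards [ae_summable_mul_stdNormalSeq hc] with ω hω
  refine ((summable_nat_add_iff 1).2 hω).congr fun k => ?_
  simp only [poissonNoise]
  ring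

/-- Coefficients of a linear combination of the limiting sequence, in terms of the independent
normal variables. -/
noncomputable def limitCoeff (β r : ℝ) (f : ℕ → ℝ) : ℕ → ℝ
  | 0 => β * √(2 / r) * poissonCovId r f
  | k + 1 => √(poissonProb r k) *
      (-(poissonCovId r f / r) * ((k : ℝ) - r) + (f k - poissonAvg r f))

theorem ExpGrowth.hasSum_limitSeq {f : ℕ → ℝ} (hf : ExpGrowth f) (β : ℝ) {r : ℝ} (hr : 0 < r) :
    ∀ᵐ ω ∂stdNormalSeq, HasSum (fun k => f k * limitSeq β r k ω)
      (∑' j, limitCoeff β r f j * ω j) := by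
  have hid := expGrowth_natCast.sub (expGrowth_const r)
  filter_upwards [hf.ae_summable_poissonNoise hr.le,
    (expGrowth_const (1 : ℝ)).ae_summable_poissonNoise hr.le,
    hid.ae_summable_poissonNoise hr.le] with ω h1 h2 h3
  simp only [one_mul] at h2
  set X := ∑' k, f k * poissonNoise r k ω
  set S := ∑' k, poissonNoise r k ω with hS
  set T := ∑' k : ℕ, ((k : ℝ) - r) * poissonNoise r k ω with hT
  have hcoeff : HasSum (fun k => limitCoeff β r f (k + 1) * ω (k + 1))
      (-(poissonCovId r f / r) * T + (X - poissonAvg r f * S)) := by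
    refine ((h3.hasSum.mul_left (-(poissonCovId r f / r))).add
      (h1.hasSum.sub (h2.hasSum.mul_left (poissonAvg r f)))).congr_fun fun k => ?_
    simp only [limitCoeff, poissonNoise]
    ring
  have htot : ∑' j, limitCoeff β r f j * ω j
      = limitCoeff β r f 0 * ω 0 + (-(poissonCovId r f / r) * T + (X - poissonAvg r f * S)) := by
    rw [Summable.tsum_eq_zero_add ((summable_nat_add_iff 1).1 hcoeff.summable), hcoeff.tsum_eq]
  have hA := hf.hasSum' r
  have hB : HasSum (fun k : ℕ => poissonProb r k * (((k : ℝ) - r) * f k)) (poissonCovId r f) :=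
    (hid.mul hf).hasSum' r
  rw [htot]
  convert! (h1.hasSum.sub (hA.mul_right S)).sub (hB.mul_right (T / r)) |>.add
    (hB.mul_right (β * √(2 / r) * ω 0)) using 1
  · ext k
    simp only [limitSeq, ← hS, ← hT]
    ring
  · simp only [limitCoeff]
    ring

theorem ExpGrowth.hasSum_limitCoeff_sq {f : ℕ → ℝ} (hf : ExpGrowth f) (β : ℝ) {r : ℝ} (hr : 0 < r) :
    HasSum (fun j => limitCoeff β r f j ^ 2) (limitVariance β r f) := by
  have hid := expGrowth_natCast.sub (expGrowth_const r)
  have hg := (hid.const_mul (-(poissonCovId r f / r))).add (hf.sub (expGrowth_const (poissonAvg r f)))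
  have h := (hg.mul hg).hasSum' r
  simp_rw [← pow_two] at h
  rw [poissonAvg_sq_completed hr.ne' hf] at h
  have h0 : limitCoeff β r f 0 ^ 2 = β ^ 2 * (2 * (poissonCovId r f ^ 2 / r)) := by
    simp only [limitCoeff]
    rw [mul_pow, mul_pow, Real.sq_sqrt (by positivity)]
    ring
  rw [← hasSum_nat_add_iff' 1, Finset.sum_range_one, h0]
  convert! h using 1
  · ext k
    simp only [limitCoeff]
    rw [mul_pow, Real.sq_sqrt (poissonProb_nonneg hr.le k)]
  · rw [limitVariance]
    ring

theorem limitVariance_nonneg (β : ℝ) {r : ℝ} (hr : 0 < r) {f : ℕ → ℝ} (hf : ExpGrowth f) :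
    0 ≤ limitVariance β r f :=
  (hf.hasSum_limitCoeff_sq β hr).nonneg fun _ => sq_nonneg _

theorem ExpGrowth.hasLaw_limitSeq {f : ℕ → ℝ} (hf : ExpGrowth f) (β : ℝ) {r : ℝ} (hr : 0 < r) :
    HasLaw (fun ω => ∑' k, f k * limitSeq β r k ω) (gaussianReal 0 (limitVariance β r f).toNNReal)
      stdNormalSeq := by
  have hid := expGrowth_natCast.sub (expGrowth_const r)
  have hg := (hid.const_mul (-(poissonCovId r f / r))).add (hf.sub (expGrowth_const (poissonAvg r f)))
  have hc : Summable fun j => |limitCoeff β r f j| :=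
    (summable_nat_add_iff 1).1 (hg.summable_sqrt_poissonProb hr.le)
  refine (hasLaw_tsum_mul_stdNormalSeq (v := (limitVariance β r f).toNNReal) hc ?_).congr ?_
  · rw [Real.coe_toNNReal _ (limitVariance_nonneg β hr hf)]
    exact hf.hasSum_limitCoeff_sq β hr
  · filter_upwards [hf.hasSum_limitSeq β hr] with ω hω using hω.tsum_eq

/-- The quadratic form of the covariances of the limiting sequence. -/
theorem ExpGrowth.hasSum_limitVariance {f : ℕ → ℝ} (hf : ExpGrowth f) (β r : ℝ) :
    HasSum (fun q : ℕ × ℕ => f q.1 * f q.2 *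
      (poissonProb r q.1 * poissonProb r q.2 *
        ((2 * β ^ 2 - 1) * (((q.1 : ℝ) - r) * ((q.2 : ℝ) - r) / r) - 1)
        + if q.1 = q.2 then poissonProb r q.1 else 0)) (limitVariance β r f) := by
  have hid := expGrowth_natCast.sub (expGrowth_const r)
  have hprod : ∀ {g : ℕ → ℝ}, ExpGrowth g → HasSum (fun q : ℕ × ℕ =>
      (poissonProb r q.1 * g q.1) * (poissonProb r q.2 * g q.2)) (poissonAvg r g * poissonAvg r g) :=
    fun hg => (hg.hasSum' r).mul (hg.hasSum' r)
      (summable_mul_of_summable_norm (hg.summable_norm r) (hg.summable_norm r))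
  have hdiag : HasSum (fun q : ℕ × ℕ => if q.1 = q.2 then poissonProb r q.1 * (f q.1 * f q.1) else 0)
      (poissonAvg r fun k => f k * f k) := by
    have hinj : Function.Injective fun k : ℕ => (k, k) := fun a b h => (Prod.ext_iff.1 h).1
    refine (hinj.hasSum_iff fun q hq => if_neg fun h => hq ⟨q.1, Prod.ext rfl h⟩).1 ?_
    simpa [Function.comp_def] using (hf.mul hf).hasSum' r
  convert! (((hprod (hid.mul hf)).mul_left ((2 * β ^ 2 - 1) / r)).sub (hprod hf)).add hdiag using 1
  · ext ⟨j, k⟩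
    dsimp only
    split_ifs with h
    · subst h; ring
    · ring
  · rw [limitVariance, residualVariance, poissonCovId]
    simp_rw [pow_two]
    ring

theorem normalLinearCombinations_limitSeq (β : ℝ) {r : ℝ} (hr : 0 < r) {σ : ℕ → ℕ → ℝ}
    (hσ : ∀ j k, σ j k = poissonProb r j * poissonProb r k *
        ((2 * β ^ 2 - 1) * (((j : ℝ) - r) * ((k : ℝ) - r) / r) - 1)
        + if j = k then poissonProb r j else 0) :
    NormalLinearCombinations (limitSeq β r) stdNormalProb σ := by
  intro a A ha
  have hf := expGrowth_of_isBigO ha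
  refine ⟨?_, (limitVariance β r a).toNNReal, ?_, hf.hasLaw_limitSeq β hr⟩
  · filter_upwards [hf.hasSum_limitSeq β hr] with ω hω using hω.summable
  · rw [Real.coe_toNNReal _ (limitVariance_nonneg β hr hf)]
    simp_rw [hσ]
    exact hf.hasSum_limitVariance β r

end LimitSequence

/-! ### Gaussian sequences from their linear combinations -/

section GaussianSequences

variable {Ω : Type*} [MeasurableSpace Ω] {U : ℕ → Ω → ℝ} {P : ProbabilityMeasure Ω}
  {σ : ℕ → ℕ → ℝ}

theorem isBigO_of_eq_zero_off_finset {a : ℕ → ℝ} {s : Finset ℕ} (ha : ∀ k ∉ s, a k = 0) :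
    a =O[atTop] fun k => (1 : ℝ) ^ k := by
  have h : a =ᶠ[atTop] fun _ => 0 := by
    filter_upwards [eventually_gt_atTop (s.sup id)] with k hk
    exact ha k fun hks => (Finset.le_sup (f := id) hks).not_gt hk
  exact h.trans_isBigO (Asymptotics.isBigO_zero _ _)

theorem NormalLinearCombinations.hasLaw_sum (hU : NormalLinearCombinations U P σ) (s : Finset ℕ)
    (a : ℕ → ℝ) :
    ∃ v : NNReal, (v : ℝ) = ∑ j ∈ s, ∑ k ∈ s, a j * a k * σ j k ∧
      HasLaw (fun ω => ∑ k ∈ s, a k * U k ω) (gaussianReal 0 v) (P : Measure Ω) := by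
  have h0 : ∀ k ∉ s, (fun k => if k ∈ s then a k else 0) k = 0 := fun k hk => if_neg hk
  obtain ⟨-, v, hv, hlaw⟩ := hU _ 1 (isBigO_of_eq_zero_off_finset h0)
  refine ⟨v, ?_, ?_⟩
  · let f : ℕ × ℕ → ℝ := fun q =>
      (if q.1 ∈ s then a q.1 else 0) * (if q.2 ∈ s then a q.2 else 0) * σ q.1 q.2
    have h1 : HasSum f (∑ q ∈ s ×ˢ s, f q) := hasSum_sum_of_ne_finset_zero fun q hq => by
      rw [Finset.mem_product, not_and_or] at hq
      rcases hq with hq | hq <;> simp [f, hq]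
    rw [hv.unique h1, Finset.sum_product]
    exact Finset.sum_congr rfl fun j hj => Finset.sum_congr rfl fun k hk => by simp [f, hj, hk]
  · refine hlaw.congr (.of_forall fun ω => ?_)
    dsimp only
    rw [tsum_eq_sum (s := s) fun k hk => by simp [hk]]
    exact Finset.sum_congr rfl fun k hk => by simp [hk]

theorem NormalLinearCombinations.hasLaw (hU : NormalLinearCombinations U P σ) (k : ℕ) :
    ∃ v : NNReal, (v : ℝ) = σ k k ∧ HasLaw (U k) (gaussianReal 0 v) (P : Measure Ω) := by
  simpa using hU.hasLaw_sum {k} 1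

theorem NormalLinearCombinations.aemeasurable (hU : NormalLinearCombinations U P σ) (k : ℕ) :
    AEMeasurable (U k) (P : Measure Ω) := by
  obtain ⟨v, -, h⟩ := hU.hasLaw k
  exact h.aemeasurable

/-- Normality of all linear combinations gives joint normality, and the covariances follow from the
variances by polarization. -/
theorem NormalLinearCombinations.isCenteredGaussianSeq (hU : NormalLinearCombinations U P σ)
    (hσ : ∀ j k, σ j k = σ k j) : IsCenteredGaussianSeq U P σ := by
  have hvar : ∀ k, Var[U k; (P : Measure Ω)] = σ k k := fun k => by
    obtain ⟨v, hv, h⟩ := hU.hasLaw k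
    rw [h.variance_eq, variance_id_gaussianReal, hv]
  have hL2 : ∀ k, MemLp (U k) 2 (P : Measure Ω) := fun k => by
    obtain ⟨v, hv, h⟩ := hU.hasLaw k
    exact h.hasGaussianLaw.memLp_two
  refine ⟨⟨fun I => ⟨isGaussian_of_map_eq_gaussianReal fun L => ?_⟩⟩, fun k => ?_, fun j k => ?_⟩
  · obtain ⟨v, -, h⟩ := hU.hasLaw_sum I
      fun k => if hk : k ∈ I then L (Pi.single (⟨k, hk⟩ : I) 1) else 0
    refine ⟨0, v, ?_⟩
    have hI : AEMeasurable (fun ω => I.restrict (U · ω)) (P : Measure Ω) :=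
      aemeasurable_pi_lambda _ fun i => hU.aemeasurable i
    rw [AEMeasurable.map_map_of_aemeasurable L.measurable.aemeasurable hI, ← h.map_eq]
    refine congrArg (fun g => Measure.map g (P : Measure Ω)) (funext fun ω => ?_)
    change L (fun i : I => U i ω) = _
    rw [← Finset.sum_coe_sort I]
    refine (LinearMap.pi_apply_eq_sum_univ (L : (I → ℝ) →ₗ[ℝ] ℝ) _).trans ?_
    refine Finset.sum_congr rfl fun i _ => ?_
    rw [dif_pos i.2, smul_eq_mul, mul_comm]
    refine congrArg (· * U i ω) (congrArg L (funext fun i' => ?_))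
    simp [Pi.single_apply, eq_comm]
  · obtain ⟨v, -, h⟩ := hU.hasLaw k
    rw [h.integral_eq, integral_id_gaussianReal]
  · rcases eq_or_ne j k with rfl | hjk
    · rw [covariance_self (hU.aemeasurable j), hvar]
    · obtain ⟨v, hv, h⟩ := hU.hasLaw_sum {j, k} 1
      have h1 := h.variance_eq
      rw [variance_id_gaussianReal, hv] at h1
      simp only [Pi.one_apply, one_mul, Finset.sum_pair hjk] at h1
      have h2 := variance_add (hL2 j) (hL2 k)
      rw [hvar, hvar, show U j + U k = fun ω => U j ω + U k ω from rfl, h1, hσ k j] at h2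
      linarith

end GaussianSequences

/-! ### Convergence in distribution of sequences -/

section JointConvergence

/-- The first `K` terms of a sequence, as a vector of the Euclidean space. -/
noncomputable def firstTerms (K : ℕ) (x : ℕ → ℝ) : EuclideanSpace ℝ (Fin K) :=
  WithLp.toLp 2 fun i => x i

theorem continuous_firstTerms (K : ℕ) : Continuous (firstTerms K) := by
  unfold firstTerms; fun_prop

/-- The union of the open cylinders over the first `K` coordinates that are contained in `G`. -/
theorem exists_monotone_cylinders {G : Set (ℕ → ℝ)} (hG : IsOpen G) :
    ∃ O : ∀ K, Set (EuclideanSpace ℝ (Fin K)), (∀ K, IsOpen (O K)) ∧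
      Monotone (fun K => firstTerms K ⁻¹' O K) ∧ ⋃ K, firstTerms K ⁻¹' O K = G := by
  refine ⟨fun K => ⋃₀ {V | IsOpen V ∧ firstTerms K ⁻¹' V ⊆ G},
    fun K => isOpen_sUnion fun V hV => hV.1, fun K L hKL x hx => ?_, ?_⟩
  · obtain ⟨V, ⟨hV, hVG⟩, hxV⟩ := hx
    let ρ : EuclideanSpace ℝ (Fin L) → EuclideanSpace ℝ (Fin K) :=
      fun y => WithLp.toLp 2 fun i => y (Fin.castLE hKL i)
    have hρ : Continuous ρ := by fun_prop
    exact ⟨ρ ⁻¹' V, ⟨hV.preimage hρ, fun y hy => hVG hy⟩, hxV⟩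
  · refine subset_antisymm (Set.iUnion_subset fun K x hx => ?_) fun x hx => ?_
    · obtain ⟨V, ⟨-, hVG⟩, hxV⟩ := hx
      exact hVG hxV
    · obtain ⟨I, u, hu, huG⟩ := isOpen_pi_iff.1 hG x hx
      obtain ⟨K, hK⟩ : ∃ K, ∀ i ∈ I, i < K :=
        ⟨I.sup id + 1, fun i hi => Nat.lt_succ_of_le (Finset.le_sup (f := id) hi)⟩
      refine Set.mem_iUnion.2 ⟨K, {y | ∀ i (hi : i ∈ I), y ⟨i, hK i hi⟩ ∈ u i}, ⟨?_, ?_⟩, ?_⟩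
      · have : {y : EuclideanSpace ℝ (Fin K) | ∀ i (hi : i ∈ I), y ⟨i, hK i hi⟩ ∈ u i}
            = ⋂ i : I, (fun y : EuclideanSpace ℝ (Fin K) => y ⟨i, hK i i.2⟩) ⁻¹' u i := by
          ext y; simp
        rw [this]
        exact isOpen_iInter_of_finite fun i => (hu i i.2).1.preimage (by fun_prop)
      · exact fun y hy => huG fun i hi => hy i hi
      · exact fun i hi => (hu i hi).2

/-- Weak convergence in the product space follows from the convergence of the finite-dimensional
marginals, since every open set is an increasing union of open cylinders. -/
theorem tendsto_of_forall_tendsto_map_firstTerms {ν : ProbabilityMeasure (ℕ → ℝ)}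
    {νs : ℕ → ProbabilityMeasure (ℕ → ℝ)}
    (h : ∀ K, Tendsto (fun n => (νs n).map (continuous_firstTerms K).aemeasurable) atTop
      (𝓝 (ν.map (continuous_firstTerms K).aemeasurable))) : Tendsto νs atTop (𝓝 ν) := by
  refine tendsto_of_forall_isOpen_le_liminf' fun G hG => ?_
  obtain ⟨O, hO, hmono, hunion⟩ := exists_monotone_cylinders hG
  conv_lhs => rw [← hunion]
  rw [hmono.measure_iUnion]
  refine iSup_le fun K => ?_
  have h1 := ProbabilityMeasure.le_liminf_measure_open_of_tendsto (h K) (hO K)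
  have h2 : ∀ μ : ProbabilityMeasure (ℕ → ℝ),
      (μ.map (continuous_firstTerms K).aemeasurable : Measure (EuclideanSpace ℝ (Fin K))) (O K)
      = (μ : Measure (ℕ → ℝ)) (firstTerms K ⁻¹' O K) := fun μ => by
    rw [ProbabilityMeasure.toMeasure_map, Measure.map_apply (continuous_firstTerms K).measurable
      (hO K).measurableSet]
  simp_rw [h2] at h1
  refine h1.trans (liminf_le_liminf (.of_forall fun n => measure_mono ?_))
  exact (Set.subset_iUnion _ K).trans hunion.subset

attribute [local instance] measurableSingletonClass_simpleGraph

theorem measurable_simpleGraph {n : ℕ} {X : Type*} [MeasurableSpace X]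
    (f : SimpleGraph (Fin n) → X) : Measurable f := measurable_of_finite f

theorem charFun_map_firstTerms {Ω : Type*} [MeasurableSpace Ω] {Q : Measure Ω} {X : ℕ → Ω → ℝ}
    (hX : AEMeasurable (fun ω k => X k ω) Q) {Y : Ω → ℝ} (hY : AEMeasurable Y Q) {K : ℕ}
    {t : EuclideanSpace ℝ (Fin K)} (hXY : ∀ ω, Y ω = ∑ i : Fin K, t i * X i ω) :
    charFun ((Q.map fun ω k => X k ω).map (firstTerms K)) t = charFun (Q.map Y) 1 := by
  rw [AEMeasurable.map_map_of_aemeasurable (continuous_firstTerms K).aemeasurable hX,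
    charFun_apply, charFun_apply_real,
    integral_map ((continuous_firstTerms K).measurable.comp_aemeasurable hX)
      (Continuous.aestronglyMeasurable (by fun_prop)),
    integral_map hY (Continuous.aestronglyMeasurable (by fun_prop))]
  refine integral_congr_ae (.of_forall fun ω => ?_)
  simp [hXY, firstTerms, PiLp.inner_apply]

/-- The **Cramér–Wold device**: the convergence of all linear combinations implies the joint
convergence. -/
theorem LinearCombinationConvergence.jointConvergence
    {μ : ∀ n : ℕ, ProbabilityMeasure (SimpleGraph (Fin n))} {r : ℕ → ℝ} {Ω : Type*}
    [MeasurableSpace Ω] {U : ℕ → Ω → ℝ} {P : ProbabilityMeasure Ω}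
    (h : LinearCombinationConvergence μ r U P) (hU : ∀ k, AEMeasurable (U k) (P : Measure Ω)) :
    JointConvergence μ r U P := by
  have hU' : AEMeasurable (fun ω k => U k ω) (P : Measure Ω) := aemeasurable_pi_lambda _ hU
  refine ⟨fun n => (measurable_simpleGraph _).aemeasurable, hU', ?_⟩
  refine tendsto_of_forall_tendsto_map_firstTerms fun K => ?_
  rw [ProbabilityMeasure.tendsto_iff_tendsto_charFun]
  intro t
  set a : ℕ → ℝ := fun k => if hk : k < K then t ⟨k, hk⟩ else 0 with ha
  have ha0 : ∀ k ∉ Finset.range K, a k = 0 := fun k hk => dif_neg (by simpa using hk)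
  have htsum : ∀ x : ℕ → ℝ, ∑' k, a k * x k = ∑ i : Fin K, t i * x i := fun x => by
    rw [tsum_eq_sum (s := Finset.range K) (fun k hk => by rw [ha0 k hk, zero_mul]),
      ← Fin.sum_univ_eq_sum_range (fun k => a k * x k)]
    exact Finset.sum_congr rfl fun i _ => by simp [ha]
  obtain ⟨-, hconv⟩ := h a 1 (isBigO_of_eq_zero_off_finset ha0)
  have h1 := (ProbabilityMeasure.tendsto_iff_tendsto_charFun.1 hconv.tendsto) 1
  refine (h1.congr fun n => ?_).trans_eq ?_
  · refine (charFun_map_firstTerms (measurable_simpleGraph _).aemeasurable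
      (measurable_simpleGraph _).aemeasurable fun G => ?_).symm
    simp_rw [mul_assoc (a _)]
    rw [htsum, htsum, ← Finset.sum_sub_distrib, Finset.mul_sum]
    exact Finset.sum_congr rfl fun i _ => by ring
  · exact congrArg 𝓝 (charFun_map_firstTerms hU' hconv.aemeasurable_limit
      fun ω => htsum fun k => U k ω).symm

end JointConvergence

/-! ### The limit theorems for the degree counts -/

section LinearCombinations

/-- Convergence of the characteristic functions of the centred sums over the vertex degrees, for all
functions of exponential growth, gives the convergence of all linear combinations of the degree
counts. -/
theorem linearCombinationConvergence_of_tendsto_integral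
    {μ : ∀ n : ℕ, ProbabilityMeasure (SimpleGraph (Fin n))} {r : ℕ → ℝ} {β s : ℝ} (hs : 0 < s)
    (h : ∀ f : ℕ → ℝ, ExpGrowth f → Tendsto (fun n => ∫ G, Complex.exp (Complex.I *
        ((√(n : ℝ))⁻¹ * (∑ v, f ((G.neighborSet v).ncard) - n * poissonAvg (r n) f) : ℝ))
        ∂(μ n : Measure (SimpleGraph (Fin n)))) atTop
      (𝓝 (Complex.exp (-(limitVariance β s f : ℝ) / 2)))) :
    LinearCombinationConvergence μ r (limitSeq β s) stdNormalProb := by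
  intro a A ha
  have hf := expGrowth_of_isBigO ha
  have hsum : ∀ n : ℕ, HasSum (fun k => a k * poissonProb (r n) k * (n : ℝ))
      (n * poissonAvg (r n) a) := fun n => by
    rw [mul_comm]
    exact ((hf.hasSum' (r n)).mul_right (n : ℝ)).congr_fun fun k => by ring
  have hlaw : HasLaw (fun ω => ∑' k, a k * limitSeq β s k ω)
      (gaussianReal 0 (limitVariance β s a).toNNReal) (stdNormalProb : Measure (ℕ → ℝ)) :=
    hf.hasLaw_limitSeq β hs
  refine ⟨fun n => (hsum n).summable, fun n => (measurable_simpleGraph _).aemeasurable,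
    hlaw.aemeasurable, ?_⟩
  refine ProbabilityMeasure.tendsto_iff_tendsto_charFun.2 fun t => ?_
  refine ((h _ (hf.const_mul t)).congr fun n => ?_).trans_eq (congrArg 𝓝 ?_)
  · change _ = charFun (Measure.map _ _) t
    rw [charFun_apply_real, integral_map (measurable_simpleGraph _).aemeasurable
      (Continuous.aestronglyMeasurable (by fun_prop))]
    refine integral_congr_ae (.of_forall fun G => ?_)
    dsimp only
    rw [(hasSum_mul_degreeCount G a).tsum_eq, (hsum n).tsum_eq, poissonAvg_const_mul,
      ← Finset.mul_sum]
    congr 1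
    push_cast
    ring
  · change _ = charFun (Measure.map _ _) t
    rw [hlaw.map_eq, charFun_gaussianReal, limitVariance_const_mul,
      Real.coe_toNNReal _ (limitVariance_nonneg β hs hf)]
    congr 1
    push_cast
    ring

end LinearCombinations

theorem linearCombinationConvergence_gnp {s : ℝ} (hs : 0 < s) {r : ℕ → ℝ} {p : ℕ → unitInterval}
    (hp : ∀ n : ℕ, 0 < n → (p n : ℝ) = r n / n) (hr : Tendsto r atTop (𝓝 s)) :
    LinearCombinationConvergence (fun n => gnp n (p n)) r (limitSeq 1 s)
      stdNormalProb := by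
  refine linearCombinationConvergence_of_tendsto_integral hs fun f hf => ?_
  simp_rw [integral_gnp]
  have := tendsto_binomial_mixture hs hr (p := fun n => (p n : ℝ)) (fun n => (p n).2) hp hf
  simpa [limitVariance] using this

theorem linearCombinationConvergence_gnm {s : ℝ} (hs : 0 < s) {m : ℕ → ℕ}
    (hm : ∀ n, m n ≤ n.choose 2)
    (hlim : Tendsto (fun n : ℕ => 2 * (m n : ℝ) / n) atTop (𝓝 s)) :
    LinearCombinationConvergence (fun n => gnm n (m n) (hm n)) (fun n => 2 * (m n : ℝ) / n)
      (limitSeq 0 s) stdNormalProb := by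
  refine linearCombinationConvergence_of_tendsto_integral hs fun f hf => ?_
  simp_rw [integral_gnm]
  have := tendsto_degreeCharFun hs (.of_forall hm) hlim hf
  simpa [limitVariance] using this

theorem theorem4p1 (lam : ℝ) (hlam : 0 < lam) :
    -- (i) the random graph `G(n, p)` with `p = r_n / n`, `r_n → lam`
    (∃ (Ω : Type) (_ : MeasurableSpace Ω) (P : ProbabilityMeasure Ω) (U : ℕ → Ω → ℝ),
      IsCenteredGaussianSeq U P (covGnp lam) ∧
      NormalLinearCombinations U P (covGnp lam) ∧
      ∀ (r : ℕ → ℝ) (p : ℕ → unitInterval),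
        (∀ n : ℕ, 0 < n → (p n : ℝ) = r n / n) →
        Tendsto r atTop (𝓝 lam) →
        JointConvergence (fun n => gnp n (p n)) r U P ∧
        LinearCombinationConvergence (fun n => gnp n (p n)) r U P) ∧
    -- (ii) the random graph `G(n, m)` with `2 m / n → lam`
    (∃ (Ω : Type) (_ : MeasurableSpace Ω) (P : ProbabilityMeasure Ω) (U : ℕ → Ω → ℝ),
      IsCenteredGaussianSeq U P (covGnm lam) ∧
      NormalLinearCombinations U P (covGnm lam) ∧
      ∀ (m : ℕ → ℕ) (hm : ∀ n, m n ≤ n.choose 2),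
        Tendsto (fun n : ℕ => 2 * (m n : ℝ) / n) atTop (𝓝 lam) →
        JointConvergence (fun n => gnm n (m n) (hm n)) (fun n => 2 * (m n : ℝ) / n) U P ∧
        LinearCombinationConvergence (fun n => gnm n (m n) (hm n))
          (fun n => 2 * (m n : ℝ) / n) U P) := by
  constructor
  · have hU : NormalLinearCombinations (limitSeq 1 lam) stdNormalProb
        (covGnp lam) := normalLinearCombinations_limitSeq 1 hlam fun j k => by
      unfold covGnp
      split_ifs with h
      · subst h; ring
      · ring
    refine ⟨ℕ → ℝ, inferInstance, stdNormalProb, limitSeq 1 lam,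
      hU.isCenteredGaussianSeq fun j k => ?_, hU, fun r p hp hr => ?_⟩
    · unfold covGnp
      rcases eq_or_ne j k with rfl | h
      · rfl
      · rw [if_neg h, if_neg h.symm]; ring
    · have h := linearCombinationConvergence_gnp hlam hp hr
      exact ⟨h.jointConvergence hU.aemeasurable, h⟩
  · have hU : NormalLinearCombinations (limitSeq 0 lam) stdNormalProb
        (covGnm lam) := normalLinearCombinations_limitSeq 0 hlam fun j k => by
      unfold covGnm
      split_ifs with h
      · subst h; ring
      · ring
    refine ⟨ℕ → ℝ, inferInstance, stdNormalProb, limitSeq 0 lam,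
      hU.isCenteredGaussianSeq fun j k => ?_, hU, fun m hm hlim => ?_⟩
    · unfold covGnm
      rcases eq_or_ne j k with rfl | h
      · rfl
      · rw [if_neg h, if_neg h.symm]; ring
    · have h := linearCombinationConvergence_gnm hlam hm hlim
      exact ⟨h.jointConvergence hU.aemeasurable, h⟩
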